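/- **Setting.** For $\sigma\in L_2(0,\pi)$ (complex-valued) and polynomials $r_1,r_2$ with complex coefficients, let $\mathcal L=\mathcal L(\sigma,r_1,r_2)$ denote the boundary value problem $$-(y^{[1]})'-\sigma y^{[1]}-\sigma^2y=\lambda y\ \text{ on }(0,\pi),\qquad y^{[1]}:=y'-\sigma y,\qquad y^{[1]}(0)=0,\quad r_1(\lambda)y^{[1]}(\pi)+r_2(\lambda)y(\pi)=0,$$ where $y,y^{[1]}$ are absolutely continuous on $[0,\pi]$. Let $\varphi(x,\lambda)$, $\psi(x,\lambda)$ be the solutions of the equation with $\varphi(0,\lambda)=1$, $\varphi^{[1]}(0,\lambda)=0$ and $\psi(\pi,\lambda)=r_1(\lambda)$, $\psi^{[1]}(\pi,\lambda)=-r_2(\lambda)$. Put $\Delta(\lambda)=r_1(\lambda)\varphi^{[1]}(\pi,\lambda)+r_2(\lambda)\varphi(\pi,\lambda)$ and let $M(\lambda)=\psi(0,\lambda)/\psi^{[1]}(0,\lambda)$ be the Weyl function. Let $\mathcal L=\mathcal L(\sigma,r_1,r_2)$ with $r_1$ monic of degree $M_1\ge 0$, $\deg r_2\le M_1$, and $r_1,r_2$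 relatively prime. Let $\tilde{\mathcal L}=\mathcal L(\tilde\sigma,\tilde r_1,\tilde r_2)$ be a model problem with $\tilde\sigma\in L_2(0,\pi)$, $\tilde r_1$ monic of the same degree $M_1$ and $\deg\tilde r_2\le M_1$ (for example $\tilde\sigma=0$, $\tilde r_1=\lambda^{M_1}$, $\tilde r_2=0$). A tilde marks the objects of $\tilde{\mathcal L}$. *Spectral data.* $\{\lambda_n\}_{n\ge1}$ are the zeros of $\Delta$, listed with multiplicities, equal ones consecutive, numbered so that $\rho_n=n-M_1-1+o(1)$, where $\rho_n=\sqrt{\lambda_n}$, $\arg\rho_n\in[-\frac\pi2,\frac\pi2)$. If $\lambda_k=\dots=\lambda_{k+m_k-1}$ is the block of an eigenvalue of multiplicity $m_k$, then $\alpha_k,\dots,\alpha_{k+m_k-1}$ are defined by requiring that $M(\lambda)-\sum_{j=0}^{m_k-1}\alpha_{k+j}(\lambda-\lambda_k)^{-j-1}$ be analytic at $\lambda_k$. Similarly $\tilde\lambda_n,\tilde\alpha_n,\tilde\rho_n$ for $\tilde{\mathcal L}$. Write $\lambda_{n0}=\lambda_n$, $\alpha_{n0}=\alpha_n$, $\lambda_{n1}=\tilde\lambda_n$,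 $\alpha_{n1}=\tilde\alpha_n$, and let $m_{k0},m_{k1}$ be the block lengths. The two numberings are assumed compatible: if $\lambda_n=\tilde\lambda_n$ and $\alpha_n=\tilde\alpha_n$, then $n$ has the same position in its block of $\{\lambda_k\}$ as in its block of $\{\tilde\lambda_k\}$ (this is automatic if both spectra are simple). For the first index $n$ of a block of $\{\lambda_{ki}\}_k$ and $0\le\nu<m_{ni}$ put $$\varphi_{n+\nu,i}(x)=\frac1{\nu!}\frac{\partial^\nu\varphi}{\partial\lambda^\nu}(x,\lambda_{ni}),\qquad \tilde\varphi_{n+\nu,i}(x)=\frac1{\nu!}\frac{\partial^\nu\tilde\varphi}{\partial\lambda^\nu}(x,\lambda_{ni}).$$ Let $\tilde D(x,\lambda,\mu)=\dfrac{\tilde\varphi(x,\lambda)\tilde\varphi^{[1]}(x,\mu)-\tilde\varphi^{[1]}(x,\lambda)\tilde\varphi(x,\mu)}{\lambda-\mu}$, extended by continuity to $\mu=\lambda$ (the quasi-derivatives here are those of $\tilde{\mathcal L}$, formed with $\tilde\sigma$). For the first index $k$ of a block of $\{\lambda_{nj}\}_n$ and $0\le\nu<m_{kj}$ let $\tilde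 A_{k+\nu,j}(x,\lambda)$ be the coefficient of $(\mu-\lambda_{kj})^{-\nu-1}$ in the Laurent expansion at $\mu=\lambda_{kj}$ of $\tilde D(x,\lambda,\mu)M(\mu)$ if $j=0$ and of $\tilde D(x,\lambda,\mu)\tilde M(\mu)$ if $j=1$, that is, $$\tilde A_{k+\nu,j}(x,\lambda)=\sum_{p=0}^{m_{kj}-1-\nu}\alpha_{k+\nu+p,j}\,\frac1{p!}\frac{\partial^p\tilde D}{\partial\mu^p}(x,\lambda,\lambda_{kj}),$$ and, for all $k\ge1$ and $j\in\{0,1\}$, put $\tilde Q_{n+\nu,i;k,j}(x)=\frac1{\nu!}\frac{\partial^\nu\tilde A_{k,j}}{\partial\lambda^\nu}(x,\lambda_{ni})$ for the first index $n$ of a block of $\{\lambda_{li}\}_l$ and $0\le\nu<m_{ni}$. Let $\xi_n=|\rho_n-\tilde\rho_n|+|\alpha_n-\tilde\alpha_n|$, and $\chi_n=\xi_n^{-1}$ if $\xi_n\ne0$, $\chi_n=0$ if $\xi_n=0$. Define $$\begin{pmatrix}\psi_{n0}\\\psi_{n1}\end{pmatrix}=\begin{pmatrix}\chi_n&-\chi_n\\0&1\end{pmatrix}\begin{pmatrix}\varphi_{n,0}\\\varphi_{n,1}\end{pmatrix},\qquad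 \begin{pmatrix}\tilde\psi_{n0}\\\tilde\psi_{n1}\end{pmatrix}=\begin{pmatrix}\chi_n&-\chi_n\\0&1\end{pmatrix}\begin{pmatrix}\tilde\varphi_{n,0}\\\tilde\varphi_{n,1}\end{pmatrix},$$ $$\begin{pmatrix}\tilde H_{n0,k0}&\tilde H_{n0,k1}\\\tilde H_{n1,k0}&\tilde H_{n1,k1}\end{pmatrix}=\begin{pmatrix}\chi_n&-\chi_n\\0&1\end{pmatrix}\begin{pmatrix}\tilde Q_{n,0;k,0}&\tilde Q_{n,0;k,1}\\\tilde Q_{n,1;k,0}&\tilde Q_{n,1;k,1}\end{pmatrix}\begin{pmatrix}\xi_k&1\\0&-1\end{pmatrix}.$$ Let $m$ be the Banach space of bounded complex sequences $a=(a_v)_{v\in V}$, $V=\{(n,i):n\ge1,\ i=0,1\}$, with the sup norm. **Theorem.** For each fixed $x\in[0,\pi]$: 1. For all $n\ge1$, $i\in\{0,1\}$, $$\tilde\varphi_{n,i}(x)=\varphi_{n,i}(x)+\sum_{k=1}^\infty\bigl(\tilde Q_{n,i;k,0}(x)\varphi_{k,0}(x)-\tilde Q_{n,i;k,1}(x)\varphi_{k,1}(x)\bigr),$$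 where the series of bracketed terms converges absolutely. 2. $\psi(x)=(\psi_v(x))_{v\in V}$ and $\tilde\psi(x)=(\tilde\psi_v(x))_{v\in V}$ belong to $m$; the matrix $(\tilde H_{u,v}(x))_{u,v\in V}$ defines a bounded linear operator $\tilde H(x)$ on $m$ by $(\tilde H(x)a)_u=\sum_{v}\tilde H_{u,v}(x)a_v$ (absolutely convergent series); and $$\tilde\psi(x)=(E+\tilde H(x))\,\psi(x)\quad\text{in } m,$$ where $E$ is the identity operator. -/

import Mathlib

open MeasureTheory Set Filter Topology
open scoped ENNReal Polynomial Nat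

noncomputable section

namespace SturmLiouville

/-- Data of the boundary value problem `ℒ(σ, r₁, r₂)`:
`-(y^{[1]})' - σ y^{[1]} - σ² y = λ y` on `(0, π)`, where `y^{[1]} = y' - σ y`,
`y^{[1]}(0) = 0`, `r₁(λ) y^{[1]}(π) + r₂(λ) y(π) = 0`. -/
structure Problem where
  σ : ℝ → ℂ
  r₁ : ℂ[X]
  r₂ : ℂ[X]

/-- `σ ∈ L₂(0, π)`, `r₁` is monic of degree `M` and `deg r₂ ≤ M`
(the normalisation in the case `deg r₁ ≥ deg r₂`). -/
def Problem.IsNormalized (L : Problem) (M : ℕ) : Prop :=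
  MemLp L.σ 2 (volume.restrict (Ioo 0 Real.pi)) ∧
    L.r₁.Monic ∧ L.r₁.natDegree = M ∧ L.r₂.natDegree ≤ M

/-- `Y = (y, y^{[1]})` solves the equation with spectral parameter `l` on `[0, π]` and
`Y(a) = c`. The equation is written as the integrated first-order system
`y' = σ y + y^{[1]}`, `(y^{[1]})' = -σ y^{[1]} - σ² y - l y`; equivalently, `y` and `y^{[1]}` are
absolutely continuous and the system holds almost everywhere. -/
def IsSolution (σ : ℝ → ℂ) (l : ℂ) (a : ℝ) (c : ℂ × ℂ) (Y : ℝ → ℂ × ℂ) : Prop :=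
  ContinuousOn Y (Icc 0 Real.pi) ∧
    ∀ x ∈ Icc 0 Real.pi,
      (Y x).1 = c.1 + ∫ t in a..x, (σ t * (Y t).1 + (Y t).2) ∧
      (Y x).2 = c.2 + ∫ t in a..x, (-σ t * (Y t).2 - σ t ^ 2 * (Y t).1 - l * (Y t).1)

/-- The solution of the Cauchy problem `Y(a) = c` (unique on `[0, π]`; only its values there are
used). -/
def solution (σ : ℝ → ℂ) (l : ℂ) (a : ℝ) (c : ℂ × ℂ) : ℝ → ℂ × ℂ :=
  Classical.epsilon (IsSolution σ l a c)

namespace Problem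

variable (L : Problem)

/-- `φ(x, l)`, with `φ(0, l) = 1`, `φ^{[1]}(0, l) = 0`. -/
def phi (x : ℝ) (l : ℂ) : ℂ := (solution L.σ l 0 (1, 0) x).1

/-- The quasi-derivative `φ^{[1]}(x, l)`. -/
def phiQ (x : ℝ) (l : ℂ) : ℂ := (solution L.σ l 0 (1, 0) x).2

/-- `ψ(x, l)`, with `ψ(π, l) = r₁(l)`, `ψ^{[1]}(π, l) = -r₂(l)`. -/
def psi (x : ℝ) (l : ℂ) : ℂ := (solution L.σ l Real.pi (L.r₁.eval l, -L.r₂.eval l) x).1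

/-- The quasi-derivative `ψ^{[1]}(x, l)`. -/
def psiQ (x : ℝ) (l : ℂ) : ℂ := (solution L.σ l Real.pi (L.r₁.eval l, -L.r₂.eval l) x).2

/-- The characteristic function `Δ(l)`; the eigenvalues are its zeros. -/
def charFun (l : ℂ) : ℂ := L.r₁.eval l * L.phiQ Real.pi l + L.r₂.eval l * L.phi Real.pi l

/-- The Weyl function `M(l) = Φ(0, l) = ψ(0, l) / ψ^{[1]}(0, l)`, where `Φ` is the solution with
`Φ^{[1]}(0, l) = 1`, `r₁(l) Φ^{[1]}(π, l) + r₂(l) Φ(π, l) = 0`. -/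
def weyl (l : ℂ) : ℂ := L.psi 0 l / L.psiQ 0 l

end Problem

/-- The square root with argument in `[-π/2, π/2)`. Mathlib's principal root has argument in
`(-π/2, π/2]`, which differs exactly on the negative half-axis. -/
def sqrtBranch (z : ℂ) : ℂ :=
  if z.arg = Real.pi then -(z ^ (1 / 2 : ℂ)) else z ^ (1 / 2 : ℂ)

/-- Two sequences `λ`, `α`. Indices start at `0`: `lam n` and `alpha n` stand for `λ_{n+1}` and
`α_{n+1}` in a numbering by `1, 2, 3, …`. -/
structure SpectralSeq where
  lam : ℕ → ℂ
  alpha : ℕ → ℂ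

namespace SpectralSeq

variable (S : SpectralSeq)

/-- The number of occurrences of `λ_n` in the sequence. -/
def mult (n : ℕ) : ℕ := {k : ℕ | S.lam k = S.lam n}.ncard

/-- The position `0, 1, …, mult n - 1` of the index `n` in the block of indices that carry the
value `λ_n`. -/
def pos (n : ℕ) : ℕ := {k : ℕ | k < n ∧ S.lam k = S.lam n}.ncard

/-- `ρ_n = √λ_n`. -/
def rho (n : ℕ) : ℂ := sqrtBranch (S.lam n)

end SpectralSeq

/-- `S` is the spectral data of `L`, where `M = deg r₁ ≥ deg r₂`. The sequence `λ` lists the zeros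
of `Δ`, each as often as its multiplicity, with equal ones consecutive, in a numbering with
`ρ_n = n - M - 1 + o(1)` for indices starting at `1`. The `α`'s of a block are the coefficients of
the principal part of the Weyl function at the corresponding eigenvalue. -/
structure IsSpectralData (L : Problem) (S : SpectralSeq) : Prop where
  encard_eq : ∀ z : ℂ, {n : ℕ | S.lam n = z}.encard = analyticOrderAt L.charFun z
  consecutive : ∀ i j k : ℕ, i ≤ j → j ≤ k → S.lam i = S.lam k → S.lam j = S.lam i
  numbering : Tendsto (fun n : ℕ => S.rho n - ((n : ℂ) - (L.r₁.natDegree : ℂ))) atTop (𝓝 0)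
  principal_part : ∀ n : ℕ, S.pos n = 0 → ∃ g : ℂ → ℂ, AnalyticAt ℂ g (S.lam n) ∧
    ∀ᶠ z in 𝓝[≠] (S.lam n), L.weyl z =
      ∑ j ∈ Finset.range (S.mult n), S.alpha (n + j) / (z - S.lam n) ^ (j + 1) + g z

/-- `φ_{n+j}(x) = (1/j!) ∂^j φ/∂λ^j (x, λ_n)` for the first index `n` of a block of `S` and
`0 ≤ j < mult n`; here written through the position of the index in its block. -/
def phiVal (L : Problem) (S : SpectralSeq) (x : ℝ) (n : ℕ) : ℂ :=
  iteratedDeriv (S.pos n) (fun l => L.phi x l) (S.lam n) / ((S.pos n)! : ℂ)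

/-- `⟨φ(x, l), φ(x, μ)⟩ = φ(x, l) φ'(x, μ) - φ'(x, l) φ(x, μ)`. Replacing the derivatives by the
quasi-derivatives `φ' - σ φ` does not change the value. -/
def wronskian (L : Problem) (x : ℝ) (l μ : ℂ) : ℂ :=
  L.phi x l * L.phiQ x μ - L.phiQ x l * L.phi x μ

/-- `D(x, l, μ) = ⟨φ(x, l), φ(x, μ)⟩ / (l - μ)`, extended by continuity to `μ = l`. -/
def kernelD (L : Problem) (x : ℝ) (l μ : ℂ) : ℂ :=
  if l = μ then limUnder (𝓝[≠] l) (fun ν => wronskian L x l ν / (l - ν))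
  else wronskian L x l μ / (l - μ)

/-- `A_{k+ν}(x, l)` for `k` the first index of a block of `S`: the coefficient of
`(μ - λ_k)^{-(ν+1)}` in the Laurent expansion at `μ = λ_k` of the product of `D(x, l, μ)` and
`∑_{j < mult k} α_{k+j} / (μ - λ_k)^{j+1}`, that is,
`∑_{p < mult k - ν} α_{k+ν+p} (1/p!) ∂^p D/∂μ^p (x, l, λ_k)`. -/
def coeffA (L : Problem) (S : SpectralSeq) (x : ℝ) (l : ℂ) (k : ℕ) : ℂ :=
  ∑ p ∈ Finset.range (S.mult k - S.pos k),
    S.alpha (k + p) * (iteratedDeriv p (fun μ => kernelD L x l μ) (S.lam k) / (p ! : ℂ))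

/-- `Q_{n+ν,i;k,j}(x) = (1/ν!) ∂^ν A_{k,j}/∂λ^ν (x, λ_{n,i})` for `n` the first index of a block of
`S i` and `0 ≤ ν < mult n`. Here `L` is the model problem, `S 0` is the spectral data of the
problem under study, and `S 1` that of the model problem. -/
def matQ (L : Problem) (S : Fin 2 → SpectralSeq) (x : ℝ) (u v : ℕ × Fin 2) : ℂ :=
  iteratedDeriv ((S u.2).pos u.1) (fun l => coeffA L (S v.2) x l v.1) ((S u.2).lam u.1) /
    (((S u.2).pos u.1)! : ℂ)

/-- `ξ_n = |ρ_n - ρ̃_n| + |α_n - α̃_n|`. -/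
def xi (S : Fin 2 → SpectralSeq) (n : ℕ) : ℝ :=
  ‖(S 0).rho n - (S 1).rho n‖ + ‖(S 0).alpha n - (S 1).alpha n‖

/-- `χ_n = 1 / ξ_n` if `ξ_n ≠ 0`, and `χ_n = 0` otherwise. -/
def chi (S : Fin 2 → SpectralSeq) (n : ℕ) : ℝ := if xi S n = 0 then 0 else (xi S n)⁻¹

/-- The matrix with rows `(χ_n, -χ_n)` and `(0, 1)`. -/
def matT (S : Fin 2 → SpectralSeq) (n : ℕ) : Matrix (Fin 2) (Fin 2) ℂ :=
  !![(chi S n : ℂ), -(chi S n : ℂ); 0, 1]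

/-- The matrix with rows `(ξ_k, 1)` and `(0, -1)`. -/
def matR (S : Fin 2 → SpectralSeq) (k : ℕ) : Matrix (Fin 2) (Fin 2) ℂ :=
  !![(xi S k : ℂ), 1; 0, -1]

/-- The vector with entries `(ψ_{n0}(x), ψ_{n1}(x)) = T_n (φ_{n,0}(x), φ_{n,1}(x))`, built from the
function `φ` of `L`. -/
def psiVec (L : Problem) (S : Fin 2 → SpectralSeq) (x : ℝ) (v : ℕ × Fin 2) : ℂ :=
  (matT S v.1).mulVec (fun i => phiVal L (S i) x v.1) v.2

/-- The infinite matrix with `2 × 2` blocks `T_n Q_{n;k}(x) R_k`, built from the model problem `L`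
and the spectral data. -/
def matH (L : Problem) (S : Fin 2 → SpectralSeq) (x : ℝ) (u v : ℕ × Fin 2) : ℂ :=
  (matT S u.1 * Matrix.of (fun i j => matQ L S x (u.1, i) (v.1, j)) * matR S v.1) u.2 v.2

/-- The Banach space `m` of bounded sequences indexed by pairs `(n, i)`, with the sup norm. -/
abbrev BddSeq : Type := lp (fun _ : ℕ × Fin 2 => ℂ) ∞

end SturmLiouville

end

/-! The argument is the spectral mapping method, that is, contour integration in the spectral
parameter.

Let Φ = ψ/ψ^{[1]}(0) be the Weyl solution and S the sine-type solution with Cauchy data (0, 1) at 0,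
so that Φ = S + Mφ. Form P₁₁ = φΦ̃^{[1]} − Φφ̃^{[1]} and P₁₂ = Φφ̃ − φΦ̃, all at the point μ. Both
problems have the same leading asymptotics, so P₁₁ → 1 and P₁₂ → 0 on the circles |μ| = (N + 1/2)²
(`exists_norm_spectralMap_sub_le`). Inserting Φ = S + Mφ shows that (φ̃(l)P₁₁(μ) +
φ̃^{[1]}(l)P₁₂(μ))/(μ − l) equals φ(μ)D̃(l, μ)(M − M̃)(μ) plus a term whose only singularity is a
simple pole at μ = l with residue φ(l) (`spectralMap_div_eq`). The residue theorem over the circle,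
with the Leibniz rule on each block of equal eigenvalues, yields φ̃(l) = φ(l) + (partial sum) +
o(1), uniformly for l in compact sets (`exists_norm_partialSum_sub_le`). Cauchy estimates transfer
this to the Taylor coefficients at the points λ_{ni}.

This gives convergence only along partial sums. Absolute convergence and boundedness on m come from
two further facts. First, D̃ is the integral of a product of two solutions, and the Lagrange
identity gives it the decay 1/(1 + |n − k|) off the diagonal (`exists_norm_kernelD_le`). Second, ξ_n
is square summable (`summable_sq_xi`). The columns multiplied by R_k gain a factor comparable to
ξ_k, up to finitely many k, while the rows multiplied by T_n stay bounded (`exists_jet_bounds`), so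
the row sums of H̃ are dominated by a convolution of two ℓ₂ sequences, uniformly in the row. The
factors R_k and T_k cancel when ξ_k ≠ 0; when ξ_k = 0 the compatibility of the numberings makes the
two jets equal (`res_mul_jet_sub_eq`).

Square summability of ξ_n rests on an asymptotic formula for solutions with σ only in L₂. After
diagonalising the leading part of the system, a Grönwall argument bounds the error by oscillatory
integrals of σ (`exists_norm_solution_sub_le_err`). These are square summable along frequencies at
bounded distance from the integers, by a Bessel inequality proved through a power series in the
perturbation (`exists_sum_sq_err_le`). -/

noncomputable section

namespace SturmLiouville

/-! ### Primitives of integrable functions: product rule and Grönwall's inequality. -/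

section ProductRule

variable {𝕜 : Type*} [RCLike 𝕜] {F G : ℝ → 𝕜} {a b : ℝ}

/-- Increments of the primitive are dominated by those of the primitive of the norm, which reduces
the claim to real-valued integrands. -/
theorem absolutelyContinuousOnInterval_integral (hF : IntervalIntegrable F volume a b) :
    AbsolutelyContinuousOnInterval (fun x => ∫ t in a..x, F t) a b := by
  have h := hF.norm.absolutelyContinuousOnInterval_intervalIntegral (left_mem_uIcc)
  unfold AbsolutelyContinuousOnInterval at h ⊢
  refine squeeze_zero' (Eventually.of_forall fun _ => Finset.sum_nonneg fun _ _ => dist_nonneg)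
    ?_ h
  have hmem : ∀ᶠ E in AbsolutelyContinuousOnInterval.totalLengthFilter ⊓
      𝓟 (AbsolutelyContinuousOnInterval.disjWithin a b),
      E ∈ AbsolutelyContinuousOnInterval.disjWithin a b :=
    mem_inf_of_right (mem_principal_self _)
  filter_upwards [hmem] with E hE
  refine Finset.sum_le_sum fun i hi => ?_
  obtain ⟨h1, h2⟩ := hE.1 i hi
  have hi1 : ∀ c ∈ uIcc a b, IntervalIntegrable F volume a c := fun c hc =>
    hF.mono_set (uIcc_subset_uIcc left_mem_uIcc hc)
  rw [dist_eq_norm, dist_eq_norm, intervalIntegral.integral_interval_sub_left (hi1 _ h1) (hi1 _ h2),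
    intervalIntegral.integral_interval_sub_left (hi1 _ h1).norm (hi1 _ h2).norm]
  exact intervalIntegral.norm_integral_le_abs_integral_norm

/-- The difference of the two sides, as functions of the upper limit, is absolutely continuous with
derivative zero almost everywhere, hence constant. Mere integrability suffices, which is all that σ
and σ² provide. -/
theorem integral_mul_integral (hF : IntervalIntegrable F volume a b)
    (hG : IntervalIntegrable G volume a b) (c d : 𝕜) :
    (c + ∫ t in a..b, F t) * (d + ∫ t in a..b, G t) =
      c * d + ∫ t in a..b, (F t * (d + ∫ s in a..t, G s) + (c + ∫ s in a..t, F s) * G t) := by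
  have hcF : ContinuousOn (fun x => c + ∫ t in a..x, F t) (uIcc a b) :=
    continuousOn_const.add (intervalIntegral.continuousOn_primitive_interval' hF left_mem_uIcc)
  have hcG : ContinuousOn (fun x => d + ∫ t in a..x, G t) (uIcc a b) :=
    continuousOn_const.add (intervalIntegral.continuousOn_primitive_interval' hG left_mem_uIcc)
  have hI : IntervalIntegrable
      (fun t => F t * (d + ∫ s in a..t, G s) + (c + ∫ s in a..t, F s) * G t) volume a b :=
    (hF.mul_continuousOn hcG).add (hG.continuousOn_mul hcF)
  have hconst : ∀ e : 𝕜, AbsolutelyContinuousOnInterval (fun _ => e) a b := fun e =>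
    (LipschitzWith.const e).lipschitzOnWith.absolutelyContinuousOnInterval
  have hac := (((hconst c).add (absolutelyContinuousOnInterval_integral hF)).smul
    ((hconst d).add (absolutelyContinuousOnInterval_integral hG))).sub
    (absolutelyContinuousOnInterval_integral hI)
  obtain ⟨C, hC⟩ := hac.const_of_ae_hasDerivAt_zero (by
    filter_upwards [hF.ae_hasDerivAt_integral, hG.ae_hasDerivAt_integral,
      hI.ae_hasDerivAt_integral] with x h1 h2 h3 hx
    have h := (((h1 hx a left_mem_uIcc).const_add c).mul ((h2 hx a left_mem_uIcc).const_add d)).sub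
      (h3 hx a left_mem_uIcc)
    rw [sub_self] at h
    exact h)
  have h1 := hC a left_mem_uIcc
  have h2 := hC b right_mem_uIcc
  simp only [Pi.sub_apply, smul_eq_mul, Pi.mul_apply, Pi.add_apply, intervalIntegral.integral_same,
    add_zero, sub_zero] at h1 h2
  rw [h1]
  linear_combination h2

theorem integral_mul_pow_primitive {k : ℝ → ℝ} (hk : IntervalIntegrable k volume a b) (n : ℕ) :
    ∫ t in a..b, k t * (∫ s in a..t, k s) ^ n = (∫ t in a..b, k t) ^ (n + 1) / (n + 1) := by
  induction n generalizing b with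
  | zero => simp
  | succ n ih =>
    have hcont : ContinuousOn (fun x => ∫ t in a..x, k t) (uIcc a b) :=
      intervalIntegral.continuousOn_primitive_interval' hk left_mem_uIcc
    have hkn : IntervalIntegrable (fun t => k t * (∫ s in a..t, k s) ^ n) volume a b :=
      hk.mul_continuousOn (hcont.pow n)
    -- The product rule is applied to the primitives of k and of k(∫k)ⁿ. By induction the second is
    -- (∫k)ⁿ⁺¹/(n+1), so both resulting terms are multiples of the integral sought.
    have h := integral_mul_integral hk hkn 0 0
    simp only [zero_add, mul_zero] at h
    rw [ih hk] at h
    have h2 : ∫ t in a..b, (k t * (∫ s in a..t, k s * (∫ r in a..s, k r) ^ n) +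
        (∫ s in a..t, k s) * (k t * (∫ s in a..t, k s) ^ n)) =
        ∫ t in a..b, (1 / (n + 1 : ℝ) + 1) * (k t * (∫ s in a..t, k s) ^ (n + 1)) := by
      refine intervalIntegral.integral_congr fun t ht => ?_
      rw [ih (hk.mono_set (uIcc_subset_uIcc left_mem_uIcc ht))]
      ring
    rw [h2, intervalIntegral.integral_const_mul] at h
    have hn : (n : ℝ) + 1 ≠ 0 := by positivity
    have hn2 : (n : ℝ) + 1 + 1 ≠ 0 := by positivity
    push_cast
    field_simp at h ⊢
    linear_combination -h

end ProductRule

/-- Grönwall's inequality for an integrable coefficient. -/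
theorem gronwall_integrable {k e : ℝ → ℝ} {H b : ℝ} (hb : 0 ≤ b)
    (hk : IntervalIntegrable k volume 0 b) (hk0 : ∀ t, 0 ≤ k t) (he : ContinuousOn e (Icc 0 b))
    (hle : ∀ x ∈ Icc 0 b, e x ≤ H + ∫ t in 0..x, k t * e t) :
    ∀ x ∈ Icc 0 b, e x ≤ H * Real.exp (∫ t in 0..x, k t) := by
  obtain ⟨B, hB⟩ := (isCompact_Icc.image_of_continuousOn he).bddAbove
  have hB' : ∀ x ∈ Icc 0 b, e x ≤ B := fun x hx => hB (mem_image_of_mem _ hx)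
  have hkx : ∀ x ∈ Icc 0 b, IntervalIntegrable k volume 0 x := fun x hx =>
    hk.mono_set (by rw [uIcc_of_le hx.1, uIcc_of_le hb]; exact Icc_subset_Icc_right hx.2)
  have hcont : ∀ x ∈ Icc 0 b, ContinuousOn (fun x => ∫ t in 0..x, k t) (uIcc 0 x) := fun x hx =>
    intervalIntegral.continuousOn_primitive_interval' (hkx x hx) left_mem_uIcc
  -- Iterating the hypothesis n times produces a partial sum of the exponential series and a
  -- remainder with a factorial in the denominator.
  have hn : ∀ n : ℕ, ∀ x ∈ Icc 0 b, e x ≤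
      H * (∑ j ∈ Finset.range n, (∫ t in 0..x, k t) ^ j / (j ! : ℝ)) +
        B * ((∫ t in 0..x, k t) ^ n / (n ! : ℝ)) := by
    intro n
    induction n with
    | zero => intro x hx; simpa using hB' x hx
    | succ n ih =>
      intro x hx
      have hsub : Icc 0 x ⊆ Icc 0 b := Icc_subset_Icc_right hx.2
      have hint : ∀ j : ℕ, IntervalIntegrable
          (fun t => k t * ((∫ s in 0..t, k s) ^ j / (j ! : ℝ))) volume 0 x := fun j =>
        (hkx x hx).mul_continuousOn (((hcont x hx).pow j).div_const _)
      have hval : ∀ j : ℕ, ∫ t in 0..x, k t * ((∫ s in 0..t, k s) ^ j / (j ! : ℝ)) =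
          (∫ t in 0..x, k t) ^ (j + 1) / ((j + 1)! : ℝ) := by
        intro j
        have := integral_mul_pow_primitive (hkx x hx) j
        simp_rw [← mul_div_assoc]
        rw [intervalIntegral.integral_div, this, Nat.factorial_succ]
        push_cast
        field_simp
      have hI1 : IntervalIntegrable (fun t => k t * e t) volume 0 x :=
        (hkx x hx).mul_continuousOn (by rw [uIcc_of_le hx.1]; exact he.mono hsub)
      have hS : IntervalIntegrable (fun t => ∑ j ∈ Finset.range n,
          k t * ((∫ s in 0..t, k s) ^ j / (j ! : ℝ))) volume 0 x := by
        have := IntervalIntegrable.sum (μ := volume) (a := 0) (b := x) (Finset.range n)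
          (f := fun j t => k t * ((∫ s in 0..t, k s) ^ j / (j ! : ℝ))) (fun j _ => hint j)
        rwa [Finset.sum_fn] at this
      have hI2 := (hS.const_mul H).add ((hint n).const_mul B)
      have hmono : ∫ t in 0..x, k t * e t ≤ ∫ t in 0..x,
          (H * (∑ j ∈ Finset.range n, k t * ((∫ s in 0..t, k s) ^ j / (j ! : ℝ))) +
            B * (k t * ((∫ s in 0..t, k s) ^ n / (n ! : ℝ)))) := by
        refine intervalIntegral.integral_mono_on hx.1 hI1 hI2 fun t ht => ?_
        have := mul_le_mul_of_nonneg_left (ih t (hsub ht)) (hk0 t)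
        refine this.trans (le_of_eq ?_)
        rw [← Finset.mul_sum]
        ring
      rw [intervalIntegral.integral_add (hS.const_mul H) ((hint n).const_mul B),
        intervalIntegral.integral_const_mul, intervalIntegral.integral_const_mul, hval n,
        intervalIntegral.integral_finsetSum (fun j _ => hint j),
        Finset.sum_congr rfl (fun j _ => hval j)] at hmono
      refine (hle x hx).trans ?_
      rw [Finset.sum_range_succ', pow_zero, Nat.factorial_zero, Nat.cast_one, div_one]
      linarith
  intro x hx
  set w := ∫ t in 0..x, k t
  have h1 : Tendsto (fun n : ℕ => ∑ j ∈ Finset.range n, w ^ j / (j ! : ℝ)) atTop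
      (𝓝 (Real.exp w)) := by
    rw [Real.exp_eq_exp_ℝ]
    exact (NormedSpace.expSeries_div_hasSum_exp w).tendsto_sum_nat
  have h2 : Tendsto (fun n : ℕ => w ^ n / (n ! : ℝ)) atTop (𝓝 0) :=
    FloorSemiring.tendsto_pow_div_factorial_atTop w
  have h3 := (h1.const_mul H).add (h2.const_mul B)
  rw [mul_zero, add_zero] at h3
  exact ge_of_tendsto' h3 fun n => hn n x hx

end SturmLiouville

end

/-! ### Volterra operators and analytic dependence on the spectral parameter. -/

noncomputable section

namespace SturmLiouville

section Volterra

variable {V : Type*} [NormedAddCommGroup V] [NormedSpace ℂ V] {b : ℝ}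

theorem intervalIntegrable_clm_apply {A : ℝ → V →L[ℂ] V} {x : ℝ}
    (hA : IntervalIntegrable A volume 0 x) {Y : ℝ → V} (hY : Continuous Y) :
    IntervalIntegrable (fun t => A t (Y t)) volume 0 x := by
  obtain ⟨B, hB⟩ := (isCompact_uIcc.image (f := fun t => ‖Y t‖) (by fun_prop) :
    IsCompact ((fun t => ‖Y t‖) '' uIcc 0 x)).bddAbove
  refine (hA.norm.mul_const B).mono_fun ?_ ?_
  · exact isBoundedBilinearMap_apply.continuous.comp_aestronglyMeasurable
      (hA.aestronglyMeasurable_restrict_uIoc.prodMk hY.aestronglyMeasurable.restrict)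
  · rw [EventuallyLE, ae_restrict_iff' measurableSet_uIoc]
    refine Eventually.of_forall fun t ht => ?_
    have h1 : ‖Y t‖ ≤ B := hB (mem_image_of_mem _ (uIoc_subset_uIcc ht))
    have h2 : 0 ≤ B := (norm_nonneg _).trans h1
    rw [Real.norm_of_nonneg (by positivity)]
    exact ((A t).le_opNorm _).trans (by gcongr)

theorem continuous_integral_clm_apply (hb : 0 ≤ b) {A : ℝ → V →L[ℂ] V}
    (hA : IntervalIntegrable A volume 0 b) (Y : C(Icc 0 b, V)) :
    Continuous (fun x : Icc 0 b => ∫ t in 0..(x : ℝ), A t (IccExtend hb Y t)) := by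
  have h := intervalIntegral.continuousOn_primitive_interval'
    (intervalIntegrable_clm_apply hA (Y.continuous.Icc_extend' (h := hb))) left_mem_uIcc
  rw [uIcc_of_le hb] at h
  exact h.comp_continuous continuous_subtype_val fun x => x.2

/-- The operator `(K Y)(x) = ∫₀ˣ A(t) Y(t) dt` on continuous functions on `[0, b]`. -/
def volterra (hb : 0 ≤ b) (A : ℝ → V →L[ℂ] V) (hA : IntervalIntegrable A volume 0 b) :
    C(Icc 0 b, V) →L[ℂ] C(Icc 0 b, V) :=
  LinearMap.mkContinuous
    { toFun := fun Y =>
        { toFun := fun x => ∫ t in 0..(x : ℝ), A t (IccExtend hb Y t)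
          continuous_toFun := continuous_integral_clm_apply hb hA Y }
      map_add' := fun Y Z => by
        ext x
        have hx : IntervalIntegrable A volume 0 x := hA.mono_set (by
          rw [uIcc_of_le hb, uIcc_of_le x.2.1]; exact Icc_subset_Icc_right x.2.2)
        change ∫ t in 0..(x : ℝ), A t (IccExtend hb (Y + Z) t) =
          (∫ t in 0..(x : ℝ), A t (IccExtend hb Y t)) + ∫ t in 0..(x : ℝ), A t (IccExtend hb Z t)
        rw [← intervalIntegral.integral_add
          (intervalIntegrable_clm_apply hx (Y.continuous.Icc_extend' (h := hb)))
          (intervalIntegrable_clm_apply hx (Z.continuous.Icc_extend' (h := hb)))]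
        refine intervalIntegral.integral_congr fun t _ => ?_
        simp [IccExtend]
      map_smul' := fun c Y => by
        ext x
        change ∫ t in 0..(x : ℝ), A t (IccExtend hb (c • Y) t) =
          c • ∫ t in 0..(x : ℝ), A t (IccExtend hb Y t)
        rw [← intervalIntegral.integral_smul]
        refine intervalIntegral.integral_congr fun t _ => ?_
        simp [IccExtend] }
    (∫ t in 0..b, ‖A t‖) (fun Y => by
      have h0 : 0 ≤ ∫ t in 0..b, ‖A t‖ :=
        intervalIntegral.integral_nonneg hb fun _ _ => norm_nonneg _
      refine (ContinuousMap.norm_le _ (by positivity)).2 fun x => ?_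
      have hsub : uIcc 0 (x : ℝ) ⊆ uIcc 0 b := by
        rw [uIcc_of_le hb, uIcc_of_le x.2.1]; exact Icc_subset_Icc_right x.2.2
      refine (intervalIntegral.norm_integral_le_of_norm_le (g := fun t => ‖A t‖ * ‖Y‖) x.2.1
        (Eventually.of_forall fun t _ => ?_) ((hA.mono_set hsub).norm.mul_const _)).trans ?_
      · exact ((A t).le_opNorm _).trans (by gcongr; exact Y.norm_coe_le_norm _)
      · rw [intervalIntegral.integral_mul_const]
        gcongr
        refine intervalIntegral.integral_mono_interval le_rfl x.2.1 x.2.2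
          (Eventually.of_forall fun _ => norm_nonneg _) hA.norm)

theorem volterra_apply (hb : 0 ≤ b) {A : ℝ → V →L[ℂ] V} (hA : IntervalIntegrable A volume 0 b)
    (Y : C(Icc 0 b, V)) (x : Icc 0 b) :
    volterra hb A hA Y x = ∫ t in 0..(x : ℝ), A t (IccExtend hb Y t) := rfl

/-- Keeping the upper limit x in the bound is what makes the induction work: a power of a primitive
integrated against its own density produces the factorial. No smallness of A is then needed for the
Neumann series. -/
theorem norm_volterra_pow_apply_le (hb : 0 ≤ b) {A : ℝ → V →L[ℂ] V}
    (hA : IntervalIntegrable A volume 0 b) (n : ℕ) (Y : C(Icc 0 b, V)) (x : Icc 0 b) :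
    ‖(volterra hb A hA ^ n) Y x‖ ≤ (∫ t in 0..(x : ℝ), ‖A t‖) ^ n / (n ! : ℝ) * ‖Y‖ := by
  induction n generalizing x with
  | zero => simpa using Y.norm_coe_le_norm x
  | succ n ih =>
    have hsub : uIcc 0 (x : ℝ) ⊆ uIcc 0 b := by
      rw [uIcc_of_le hb, uIcc_of_le x.2.1]; exact Icc_subset_Icc_right x.2.2
    have hAx := (hA.mono_set hsub).norm
    have hcont : ContinuousOn (fun x => ∫ t in 0..x, ‖A t‖) (uIcc 0 (x : ℝ)) :=
      intervalIntegral.continuousOn_primitive_interval' hAx left_mem_uIcc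
    rw [pow_succ', mul_apply_eq_comp, volterra_apply]
    have hval : ∫ t in 0..(x : ℝ), ‖A t‖ * (((∫ s in 0..t, ‖A s‖) ^ n / (n ! : ℝ)) * ‖Y‖) =
        (∫ t in 0..(x : ℝ), ‖A t‖) ^ (n + 1) / ((n + 1)! : ℝ) * ‖Y‖ := by
      have := integral_mul_pow_primitive hAx n
      simp_rw [← mul_assoc, ← mul_div_assoc]
      rw [intervalIntegral.integral_mul_const, intervalIntegral.integral_div, this,
        Nat.factorial_succ]
      push_cast
      field_simp
    rw [← hval]
    refine intervalIntegral.norm_integral_le_of_norm_le x.2.1 ((ae_of_all _) fun t ht => ?_)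
      (hAx.mul_continuousOn (((hcont.pow n).div_const _).mul continuousOn_const))
    have htI : t ∈ Icc 0 b := ⟨ht.1.le, ht.2.trans x.2.2⟩
    refine ((A t).le_opNorm _).trans ?_
    gcongr
    rw [IccExtend_of_mem hb _ htI]
    exact ih ⟨t, htI⟩

theorem isUnit_one_sub_of_summable {E : Type*} [NormedAddCommGroup E] [NormedSpace ℂ E]
    [CompleteSpace E] {T : E →L[ℂ] E} {u : ℕ → ℝ} (hu : Summable u) (h : ∀ n, ‖T ^ n‖ ≤ u n) :
    IsUnit (1 - T) := by
  have hs : Summable (fun n : ℕ => T ^ n) := Summable.of_norm_bounded hu h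
  exact ⟨⟨_, _, hs.one_sub_mul_tsum_pow, hs.tsum_pow_mul_one_sub⟩, rfl⟩

theorem norm_volterra_pow_le (hb : 0 ≤ b) {A : ℝ → V →L[ℂ] V}
    (hA : IntervalIntegrable A volume 0 b) (n : ℕ) :
    ‖volterra hb A hA ^ n‖ ≤ (∫ t in 0..b, ‖A t‖) ^ n / (n ! : ℝ) := by
  have hw : 0 ≤ ∫ t in 0..b, ‖A t‖ := intervalIntegral.integral_nonneg hb fun _ _ => norm_nonneg _
  refine ContinuousLinearMap.opNorm_le_bound _ (by positivity) fun Y => ?_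
  refine (ContinuousMap.norm_le _ (by positivity)).2 fun x => ?_
  refine (norm_volterra_pow_apply_le hb hA n Y x).trans ?_
  have h0 : 0 ≤ ∫ t in 0..(x : ℝ), ‖A t‖ :=
    intervalIntegral.integral_nonneg x.2.1 fun _ _ => norm_nonneg _
  have h1 : ∫ t in 0..(x : ℝ), ‖A t‖ ≤ ∫ t in 0..b, ‖A t‖ :=
    intervalIntegral.integral_mono_interval le_rfl x.2.1 x.2.2
      (Eventually.of_forall fun _ => norm_nonneg _) hA.norm
  gcongr

theorem isUnit_one_sub_volterra [CompleteSpace V] (hb : 0 ≤ b) {A : ℝ → V →L[ℂ] V}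
    (hA : IntervalIntegrable A volume 0 b) : IsUnit (1 - volterra hb A hA) :=
  isUnit_one_sub_of_summable (Real.summable_pow_div_factorial _) (norm_volterra_pow_le hb hA)

end Volterra

theorem memLp_Ioc {σ : ℝ → ℂ} (hσ : MemLp σ 2 (volume.restrict (Ioo 0 Real.pi))) :
    MemLp σ 2 (volume.restrict (Ioc 0 Real.pi)) := by
  rwa [restrict_Ioo_eq_restrict_Ioc] at hσ

theorem intervalIntegrable_sigma {σ : ℝ → ℂ} (hσ : MemLp σ 2 (volume.restrict (Ioo 0 Real.pi))) :
    IntervalIntegrable σ volume 0 Real.pi := by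
  rw [intervalIntegrable_iff_integrableOn_Ioc_of_le Real.pi_nonneg]
  exact (memLp_Ioc hσ).integrable (by norm_num)

theorem intervalIntegrable_sigma_sq {σ : ℝ → ℂ}
    (hσ : MemLp σ 2 (volume.restrict (Ioo 0 Real.pi))) :
    IntervalIntegrable (fun t => σ t ^ 2) volume 0 Real.pi := by
  rw [intervalIntegrable_iff_integrableOn_Ioc_of_le Real.pi_nonneg]
  have := (memLp_Ioc hσ).integrable_mul (memLp_Ioc hσ)
  simpa [IntegrableOn, sq, Pi.mul_def] using this

theorem intervalIntegrable_norm_sigma_sq {σ : ℝ → ℂ}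
    (hσ : MemLp σ 2 (volume.restrict (Ioo 0 Real.pi))) :
    IntervalIntegrable (fun t => ‖σ t‖ ^ 2) volume 0 Real.pi := by
  simpa using (intervalIntegrable_sigma_sq hσ).norm

/-- The coefficient matrix at `l = 0` of the first-order system. -/
def systemMatrix (σ : ℝ → ℂ) (t : ℝ) : (ℂ × ℂ) →L[ℂ] (ℂ × ℂ) :=
  (ContinuousLinearMap.snd ℂ ℂ ℂ).prod 0 +
    σ t • (ContinuousLinearMap.fst ℂ ℂ ℂ).prod (-ContinuousLinearMap.snd ℂ ℂ ℂ) -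
    σ t ^ 2 • (0 : (ℂ × ℂ) →L[ℂ] ℂ).prod (ContinuousLinearMap.fst ℂ ℂ ℂ)

/-- The coefficient matrix of the spectral parameter in the first-order system. -/
def paramMatrix (_ : ℝ) : (ℂ × ℂ) →L[ℂ] (ℂ × ℂ) :=
  -(0 : (ℂ × ℂ) →L[ℂ] ℂ).prod (ContinuousLinearMap.fst ℂ ℂ ℂ)

theorem intervalIntegrable_systemMatrix {σ : ℝ → ℂ}
    (hσ : MemLp σ 2 (volume.restrict (Ioo 0 Real.pi))) :
    IntervalIntegrable (systemMatrix σ) volume 0 Real.pi := by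
  have h1 := intervalIntegrable_sigma hσ
  have h2 := intervalIntegrable_sigma_sq hσ
  refine (intervalIntegrable_const.add ⟨h1.1.smul_const _, h1.2.smul_const _⟩).sub
    ⟨h2.1.smul_const _, h2.2.smul_const _⟩

theorem intervalIntegrable_paramMatrix : IntervalIntegrable paramMatrix volume 0 Real.pi :=
  intervalIntegrable_const

/-- The operator is kept in a form affine in l, so that analyticity in l can be read off;
invertibility comes from viewing it as a single Volterra operator. -/
theorem isUnit_one_sub_system {σ : ℝ → ℂ} (hσ : MemLp σ 2 (volume.restrict (Ioo 0 Real.pi)))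
    (l : ℂ) :
    IsUnit (1 - (volterra Real.pi_nonneg _ (intervalIntegrable_systemMatrix hσ) +
      l • volterra Real.pi_nonneg _ intervalIntegrable_paramMatrix)) := by
  have hA : IntervalIntegrable (fun t => systemMatrix σ t + l • paramMatrix t) volume 0 Real.pi :=
    (intervalIntegrable_systemMatrix hσ).add (intervalIntegrable_paramMatrix.smul l)
  convert isUnit_one_sub_volterra Real.pi_nonneg hA using 2
  ext1 Y
  ext1 x
  have hsub : uIcc 0 (x : ℝ) ⊆ uIcc 0 Real.pi := by
    rw [uIcc_of_le Real.pi_nonneg, uIcc_of_le x.2.1]; exact Icc_subset_Icc_right x.2.2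
  have hY := Y.continuous.Icc_extend' (h := Real.pi_nonneg)
  simp only [add_apply, smul_apply, ContinuousMap.add_apply,
    ContinuousMap.smul_apply, volterra_apply]
  rw [← intervalIntegral.integral_smul, ← intervalIntegral.integral_add
    (intervalIntegrable_clm_apply ((intervalIntegrable_systemMatrix hσ).mono_set hsub) hY)
    (show IntervalIntegrable (fun t => l • paramMatrix t (IccExtend Real.pi_nonneg Y t)) volume 0 x
      from (intervalIntegrable_clm_apply (intervalIntegrable_paramMatrix.mono_set hsub) hY).smul l)]

/-- The continuous vector function solving the Cauchy problem at `0`. -/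
def solutionMap {σ : ℝ → ℂ} (hσ : MemLp σ 2 (volume.restrict (Ioo 0 Real.pi))) (c : ℂ × ℂ) (l : ℂ) :
    C(Icc 0 Real.pi, ℂ × ℂ) :=
  Ring.inverse (1 - (volterra Real.pi_nonneg _ (intervalIntegrable_systemMatrix hσ) +
      l • volterra Real.pi_nonneg _ intervalIntegrable_paramMatrix)) (ContinuousMap.const _ c)

/-- Inversion is differentiable at units. Consequently solutions are entire in l as functions with
values in the space of continuous functions, not just pointwise in x. -/
theorem differentiableAt_inverse_one_sub_add_smul {R : Type*} [NormedRing R] [NormedAlgebra ℂ R]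
    [HasSummableGeomSeries R] {S T : R} {l : ℂ} (h : IsUnit (1 - (S + l • T))) :
    DifferentiableAt ℂ (fun l : ℂ => Ring.inverse (1 - (S + l • T))) l :=
  DifferentiableAt.fun_comp' (g := Ring.inverse) l (differentiableAt_inverse h) (by fun_prop)

theorem differentiable_solutionMap {σ : ℝ → ℂ}
    (hσ : MemLp σ 2 (volume.restrict (Ioo 0 Real.pi))) (c : ℂ × ℂ) :
    Differentiable ℂ (solutionMap hσ c) := by
  intro l
  exact (differentiableAt_inverse_one_sub_add_smul (isUnit_one_sub_system hσ l)).clm_apply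
    (differentiableAt_const _)

theorem solutionMap_unique {σ : ℝ → ℂ} (hσ : MemLp σ 2 (volume.restrict (Ioo 0 Real.pi)))
    {c : ℂ × ℂ} {l : ℂ} {Y : C(Icc 0 Real.pi, ℂ × ℂ)} :
    Y = solutionMap hσ c l ↔ ∀ x, Y x = c + (volterra Real.pi_nonneg _
      (intervalIntegrable_systemMatrix hσ) Y x +
      l • volterra Real.pi_nonneg _ intervalIntegrable_paramMatrix Y x) := by
  have hu := isUnit_one_sub_system hσ l
  have h1 : Y = solutionMap hσ c l ↔
      (1 - (volterra Real.pi_nonneg _ (intervalIntegrable_systemMatrix hσ) +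
      l • volterra Real.pi_nonneg _ intervalIntegrable_paramMatrix)) Y =
        ContinuousMap.const _ c := by
    constructor
    · rintro rfl
      rw [solutionMap, ← mul_apply_eq_comp, Ring.mul_inverse_cancel _ hu,
        one_apply_eq_self]
    · intro h
      rw [solutionMap, ← h, ← mul_apply_eq_comp, Ring.inverse_mul_cancel _ hu,
        one_apply_eq_self]
  rw [h1, ContinuousMap.ext_iff]
  refine forall_congr' fun x => ?_
  simp only [sub_apply, one_apply_eq_self,
    add_apply, smul_apply, ContinuousMap.sub_apply,
    ContinuousMap.add_apply, ContinuousMap.smul_apply, ContinuousMap.const_apply]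
  rw [sub_eq_iff_eq_add]

end SturmLiouville

end

/-! ### The Cauchy problem, the Lagrange identity and the reflection of the interval. -/

noncomputable section

namespace SturmLiouville

theorem systemMatrix_apply (σ : ℝ → ℂ) (t : ℝ) (v : ℂ × ℂ) :
    systemMatrix σ t v = (v.2 + σ t * v.1, -(σ t * v.2) - σ t ^ 2 * v.1) := by
  ext <;> simp [systemMatrix]

theorem paramMatrix_apply (t : ℝ) (v : ℂ × ℂ) : paramMatrix t v = (0, -v.1) := by
  ext <;> simp [paramMatrix]

theorem fst_intervalIntegral {f : ℝ → ℂ × ℂ} {a b : ℝ} (hf : IntervalIntegrable f volume a b) :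
    (∫ t in a..b, f t).1 = ∫ t in a..b, (f t).1 :=
  ((ContinuousLinearMap.fst ℂ ℂ ℂ).intervalIntegral_comp_comm hf).symm

theorem snd_intervalIntegral {f : ℝ → ℂ × ℂ} {a b : ℝ} (hf : IntervalIntegrable f volume a b) :
    (∫ t in a..b, f t).2 = ∫ t in a..b, (f t).2 :=
  ((ContinuousLinearMap.snd ℂ ℂ ℂ).intervalIntegral_comp_comm hf).symm

theorem uIcc_subset_Icc_pi {a x : ℝ} (ha : a ∈ Icc 0 Real.pi) (hx : x ∈ Icc 0 Real.pi) :
    uIcc a x ⊆ Icc 0 Real.pi := by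
  rw [← uIcc_of_le Real.pi_nonneg] at ha hx ⊢
  exact uIcc_subset_uIcc ha hx

theorem intervalIntegrable_of_pi {F : Type*} [NormedAddCommGroup F] {f : ℝ → F}
    (hf : IntervalIntegrable f volume 0 Real.pi) {a x : ℝ} (ha : a ∈ Icc 0 Real.pi)
    (hx : x ∈ Icc 0 Real.pi) : IntervalIntegrable f volume a x :=
  hf.mono_set (by rw [uIcc_of_le Real.pi_nonneg]; exact uIcc_subset_Icc_pi ha hx)

variable {σ : ℝ → ℂ} {l m : ℂ} {a : ℝ} {c d : ℂ × ℂ} {Y Z : ℝ → ℂ × ℂ}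

/-- The right-hand side `σ y + y^{[1]}` of the first equation. -/
def rhs₁ (σ : ℝ → ℂ) (Y : ℝ → ℂ × ℂ) (t : ℝ) : ℂ := σ t * (Y t).1 + (Y t).2

/-- The right-hand side `-σ y^{[1]} - σ² y - l y` of the second equation. -/
def rhs₂ (σ : ℝ → ℂ) (l : ℂ) (Y : ℝ → ℂ × ℂ) (t : ℝ) : ℂ :=
  -σ t * (Y t).2 - σ t ^ 2 * (Y t).1 - l * (Y t).1

theorem intervalIntegrable_rhs₁ (hσ : MemLp σ 2 (volume.restrict (Ioo 0 Real.pi)))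
    (hY : ContinuousOn Y (Icc 0 Real.pi)) : IntervalIntegrable (rhs₁ σ Y) volume 0 Real.pi := by
  rw [← uIcc_of_le Real.pi_nonneg] at hY
  exact ((intervalIntegrable_sigma hσ).mul_continuousOn hY.fst).add hY.snd.intervalIntegrable

theorem intervalIntegrable_rhs₂ (hσ : MemLp σ 2 (volume.restrict (Ioo 0 Real.pi)))
    (hY : ContinuousOn Y (Icc 0 Real.pi)) : IntervalIntegrable (rhs₂ σ l Y) volume 0 Real.pi := by
  rw [← uIcc_of_le Real.pi_nonneg] at hY
  exact (((intervalIntegrable_sigma hσ).neg.mul_continuousOn hY.snd).sub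
    ((intervalIntegrable_sigma_sq hσ).mul_continuousOn hY.fst)).sub
    ((hY.fst.intervalIntegrable).const_mul l)

theorem forall_eq_volterra_iff (hσ : MemLp σ 2 (volume.restrict (Ioo 0 Real.pi)))
    (Y : C(Icc 0 Real.pi, ℂ × ℂ)) (x : Icc 0 Real.pi) :
    c + (volterra Real.pi_nonneg _ (intervalIntegrable_systemMatrix hσ) Y x +
      l • volterra Real.pi_nonneg _ intervalIntegrable_paramMatrix Y x) =
    (c.1 + ∫ t in 0..(x : ℝ), rhs₁ σ (IccExtend Real.pi_nonneg Y) t,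
      c.2 + ∫ t in 0..(x : ℝ), rhs₂ σ l (IccExtend Real.pi_nonneg Y) t) := by
  have hY := Y.continuous.Icc_extend' (h := Real.pi_nonneg)
  have h1 := intervalIntegrable_clm_apply (intervalIntegrable_of_pi
    (intervalIntegrable_systemMatrix hσ) ⟨le_rfl, Real.pi_nonneg⟩ x.2) hY
  have h2 := intervalIntegrable_clm_apply (intervalIntegrable_of_pi
    intervalIntegrable_paramMatrix ⟨le_rfl, Real.pi_nonneg⟩ x.2) hY
  have h2' : IntervalIntegrable (fun t => l • paramMatrix t (IccExtend Real.pi_nonneg Y t))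
      volume 0 x := h2.smul l
  have h3 : IntervalIntegrable (fun t => systemMatrix σ t (IccExtend Real.pi_nonneg Y t) +
      l • paramMatrix t (IccExtend Real.pi_nonneg Y t)) volume 0 x := h1.add h2'
  have h4 : volterra Real.pi_nonneg _ (intervalIntegrable_systemMatrix hσ) Y x +
      l • volterra Real.pi_nonneg _ intervalIntegrable_paramMatrix Y x =
      ∫ t in 0..(x : ℝ), (systemMatrix σ t (IccExtend Real.pi_nonneg Y t) +
      l • paramMatrix t (IccExtend Real.pi_nonneg Y t)) := by
    rw [intervalIntegral.integral_add h1 h2', volterra_apply, volterra_apply]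
    congr 1
    exact (intervalIntegral.integral_smul l _).symm
  rw [h4]
  ext
  · rw [Prod.fst_add, fst_intervalIntegral h3]
    congr 1
    refine intervalIntegral.integral_congr fun t _ => ?_
    simp only [systemMatrix_apply, paramMatrix_apply, Prod.fst_add, Prod.smul_fst, rhs₁]
    simp [add_comm]
  · rw [Prod.snd_add, snd_intervalIntegral h3]
    congr 1
    refine intervalIntegral.integral_congr fun t _ => ?_
    simp only [systemMatrix_apply, paramMatrix_apply, Prod.snd_add, Prod.smul_snd, rhs₂]
    simp only [smul_eq_mul]
    ring

theorem isSolution_solutionMap (hσ : MemLp σ 2 (volume.restrict (Ioo 0 Real.pi))) :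
    IsSolution σ l 0 c (IccExtend Real.pi_nonneg (solutionMap hσ c l)) := by
  refine ⟨((solutionMap hσ c l).continuous.Icc_extend' (h := Real.pi_nonneg)).continuousOn,
    fun x hx => ?_⟩
  have h := (solutionMap_unique hσ).1 (rfl : solutionMap hσ c l = solutionMap hσ c l) ⟨x, hx⟩
  rw [forall_eq_volterra_iff hσ] at h
  rw [IccExtend_of_mem _ _ hx]
  exact ⟨congrArg Prod.fst h, congrArg Prod.snd h⟩

theorem IsSolution.eq_solutionMap (hσ : MemLp σ 2 (volume.restrict (Ioo 0 Real.pi)))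
    (hY : IsSolution σ l 0 c Y) (x : Icc 0 Real.pi) : Y x = solutionMap hσ c l x := by
  have h : (⟨fun x => Y x, hY.1.comp_continuous continuous_subtype_val fun x => x.2⟩ :
      C(Icc 0 Real.pi, ℂ × ℂ)) = solutionMap hσ c l := by
    rw [solutionMap_unique hσ]
    intro x
    rw [forall_eq_volterra_iff hσ]
    obtain ⟨h1, h2⟩ := hY.2 x x.2
    have hcongr : ∀ t ∈ uIcc 0 (x : ℝ), IccExtend Real.pi_nonneg (fun x : Icc 0 Real.pi => Y x) t =
        Y t := fun t ht => by
      rw [IccExtend_of_mem _ _ (uIcc_subset_Icc_pi ⟨le_rfl, Real.pi_nonneg⟩ x.2 ht)]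
    ext
    · change (Y x).1 = _
      rw [h1]
      congr 1
      refine intervalIntegral.integral_congr fun t ht => ?_
      simp only [rhs₁, ContinuousMap.coe_mk, hcongr t ht]
    · change (Y x).2 = _
      rw [h2]
      congr 1
      refine intervalIntegral.integral_congr fun t ht => ?_
      simp only [rhs₂, ContinuousMap.coe_mk, hcongr t ht]
  rw [← h]
  rfl

theorem IsSolution.apply_base (ha : a ∈ Icc 0 Real.pi) (hY : IsSolution σ l a c Y) : Y a = c := by
  have := hY.2 a ha
  simp only [intervalIntegral.integral_same, add_zero] at this
  exact Prod.ext this.1 this.2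

theorem IsSolution.change_base (hσ : MemLp σ 2 (volume.restrict (Ioo 0 Real.pi)))
    (ha : a ∈ Icc 0 Real.pi) (hY : IsSolution σ l a c Y) {b : ℝ} (hb : b ∈ Icc 0 Real.pi) :
    IsSolution σ l b (Y b) Y := by
  refine ⟨hY.1, fun x hx => ?_⟩
  have h1 := intervalIntegrable_rhs₁ hσ hY.1
  have h2 := intervalIntegrable_rhs₂ (l := l) hσ hY.1
  obtain ⟨hx1, hx2⟩ := hY.2 x hx
  obtain ⟨hb1, hb2⟩ := hY.2 b hb
  constructor
  · rw [hx1, hb1, add_assoc]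
    congr 1
    exact (intervalIntegral.integral_add_adjacent_intervals (intervalIntegrable_of_pi h1 ha hb)
      (intervalIntegrable_of_pi h1 hb hx)).symm
  · rw [hx2, hb2, add_assoc]
    congr 1
    exact (intervalIntegral.integral_add_adjacent_intervals (intervalIntegrable_of_pi h2 ha hb)
      (intervalIntegrable_of_pi h2 hb hx)).symm

theorem IsSolution.linear_comb (hσ : MemLp σ 2 (volume.restrict (Ioo 0 Real.pi)))
    (ha : a ∈ Icc 0 Real.pi) (hY : IsSolution σ l a c Y) (hZ : IsSolution σ l a d Z) (p q : ℂ) :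
    IsSolution σ l a (p • c + q • d) (fun x => p • Y x + q • Z x) := by
  refine ⟨(hY.1.const_smul p).add (hZ.1.const_smul q), fun x hx => ?_⟩
  obtain ⟨hY1, hY2⟩ := hY.2 x hx
  obtain ⟨hZ1, hZ2⟩ := hZ.2 x hx
  constructor
  · simp only [Prod.fst_add, Prod.smul_fst, smul_eq_mul, hY1, hZ1]
    have h := intervalIntegral.integral_add
      ((intervalIntegrable_of_pi (intervalIntegrable_rhs₁ hσ hY.1) ha hx).const_mul p)
      ((intervalIntegrable_of_pi (intervalIntegrable_rhs₁ hσ hZ.1) ha hx).const_mul q)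
    rw [intervalIntegral.integral_const_mul, intervalIntegral.integral_const_mul] at h
    simp only [rhs₁] at h
    rw [show ∀ A B C D : ℂ, p * (A + B) + q * (C + D) = p * A + q * C + (p * B + q * D) by
      intros; ring, ← h]
    congr 1
    refine intervalIntegral.integral_congr fun t _ => ?_
    simp only [Prod.snd_add, Prod.smul_snd, smul_eq_mul]
    ring
  · simp only [Prod.snd_add, Prod.smul_snd, smul_eq_mul, hY2, hZ2]
    have h := intervalIntegral.integral_add
      ((intervalIntegrable_of_pi (intervalIntegrable_rhs₂ (l := l) hσ hY.1) ha hx).const_mul p)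
      ((intervalIntegrable_of_pi (intervalIntegrable_rhs₂ (l := l) hσ hZ.1) ha hx).const_mul q)
    rw [intervalIntegral.integral_const_mul, intervalIntegral.integral_const_mul] at h
    simp only [rhs₂] at h
    rw [show ∀ A B C D : ℂ, p * (A + B) + q * (C + D) = p * A + q * C + (p * B + q * D) by
      intros; ring, ← h]
    congr 1
    refine intervalIntegral.integral_congr fun t _ => ?_
    simp only [Prod.fst_add, Prod.smul_fst, smul_eq_mul]
    ring

/-- The Lagrange identity. -/
theorem IsSolution.wronskian_eq (hσ : MemLp σ 2 (volume.restrict (Ioo 0 Real.pi)))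
    (hY : IsSolution σ l 0 c Y) (hZ : IsSolution σ m 0 d Z) {x : ℝ} (hx : x ∈ Icc 0 Real.pi) :
    (Y x).1 * (Z x).2 - (Y x).2 * (Z x).1 =
      c.1 * d.2 - c.2 * d.1 + (l - m) * ∫ t in 0..x, (Y t).1 * (Z t).1 := by
  have h0 : (0 : ℝ) ∈ Icc 0 Real.pi := ⟨le_rfl, Real.pi_nonneg⟩
  have hY1 := intervalIntegrable_of_pi (intervalIntegrable_rhs₁ hσ hY.1) h0 hx
  have hY2 := intervalIntegrable_of_pi (intervalIntegrable_rhs₂ (l := l) hσ hY.1) h0 hx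
  have hZ1 := intervalIntegrable_of_pi (intervalIntegrable_rhs₁ hσ hZ.1) h0 hx
  have hZ2 := intervalIntegrable_of_pi (intervalIntegrable_rhs₂ (l := m) hσ hZ.1) h0 hx
  have hsub := uIcc_subset_Icc_pi h0 hx
  have e1 := integral_mul_integral hY1 hZ2 c.1 d.2
  have e2 := integral_mul_integral hY2 hZ1 c.2 d.1
  have f1 : ∀ t ∈ Icc 0 Real.pi, c.1 + ∫ s in 0..t, rhs₁ σ Y s = (Y t).1 := fun t ht =>
    (hY.2 t ht).1.symm
  have f2 : ∀ t ∈ Icc 0 Real.pi, c.2 + ∫ s in 0..t, rhs₂ σ l Y s = (Y t).2 := fun t ht =>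
    (hY.2 t ht).2.symm
  have f3 : ∀ t ∈ Icc 0 Real.pi, d.1 + ∫ s in 0..t, rhs₁ σ Z s = (Z t).1 := fun t ht =>
    (hZ.2 t ht).1.symm
  have f4 : ∀ t ∈ Icc 0 Real.pi, d.2 + ∫ s in 0..t, rhs₂ σ m Z s = (Z t).2 := fun t ht =>
    (hZ.2 t ht).2.symm
  rw [f1 x hx, f4 x hx] at e1
  rw [f2 x hx, f3 x hx] at e2
  -- In the difference of the two product rules all terms with σ and σ² cancel, as do the products
  -- of quasi-derivatives; only the two spectral parameters survive.
  rw [e1, e2, add_sub_add_comm, ← intervalIntegral.integral_sub, ← intervalIntegral.integral_const_mul]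
  · congr 1
    refine intervalIntegral.integral_congr fun t ht => ?_
    have ht' := hsub ht
    simp only [f1 t ht', f2 t ht', f3 t ht', f4 t ht']
    simp only [rhs₁, rhs₂]
    ring
  · refine (hY1.mul_continuousOn ?_).add (hZ2.continuousOn_mul ?_)
    · exact (hZ.1.snd.mono hsub).congr fun t ht => f4 t (hsub ht)
    · exact (hY.1.fst.mono hsub).congr fun t ht => f1 t (hsub ht)
  · refine (hY2.mul_continuousOn ?_).add (hZ1.continuousOn_mul ?_)
    · exact (hZ.1.fst.mono hsub).congr fun t ht => f3 t (hsub ht)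
    · exact (hY.1.snd.mono hsub).congr fun t ht => f2 t (hsub ht)

/-- The two fundamental solutions based at 0 have Wronskian 1 at every point, so Cramer's rule at a
gives the combination with the prescribed data. -/
theorem exists_isSolution (hσ : MemLp σ 2 (volume.restrict (Ioo 0 Real.pi)))
    (ha : a ∈ Icc 0 Real.pi) (l : ℂ) (c : ℂ × ℂ) : ∃ Y, IsSolution σ l a c Y := by
  have h0 : (0 : ℝ) ∈ Icc 0 Real.pi := ⟨le_rfl, Real.pi_nonneg⟩
  have h1 := isSolution_solutionMap (l := l) (c := (1, 0)) hσ
  have h2 := isSolution_solutionMap (l := l) (c := (0, 1)) hσ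
  have hw := h1.wronskian_eq hσ h2 ha
  set Y₁ := IccExtend Real.pi_nonneg (solutionMap hσ (1, 0) l)
  set Y₂ := IccExtend Real.pi_nonneg (solutionMap hσ (0, 1) l)
  have h := (h1.linear_comb hσ h0 h2 (c.1 * (Y₂ a).2 - c.2 * (Y₂ a).1)
    ((Y₁ a).1 * c.2 - (Y₁ a).2 * c.1)).change_base hσ h0 ha
  simp only [sub_self, zero_mul, mul_one, sub_zero, add_zero] at hw
  have hc : (c.1 * (Y₂ a).2 - c.2 * (Y₂ a).1) • Y₁ a +
      ((Y₁ a).1 * c.2 - (Y₁ a).2 * c.1) • Y₂ a = c := by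
    ext
    · simp only [Prod.fst_add, Prod.smul_fst, smul_eq_mul]
      linear_combination c.1 * hw
    · simp only [Prod.snd_add, Prod.smul_snd, smul_eq_mul]
      linear_combination c.2 * hw
  rw [hc] at h
  exact ⟨_, h⟩

/-- The difference of two solutions vanishes at a, so its constant Wronskians with the fundamental
solutions vanish. Evaluated at 0 they are the Cauchy data there, up to sign, and uniqueness at 0
applies. -/
theorem IsSolution.eqOn (hσ : MemLp σ 2 (volume.restrict (Ioo 0 Real.pi)))
    (ha : a ∈ Icc 0 Real.pi) (hY : IsSolution σ l a c Y) (hZ : IsSolution σ l a c Z) :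
    EqOn Y Z (Icc 0 Real.pi) := by
  have h0 : (0 : ℝ) ∈ Icc 0 Real.pi := ⟨le_rfl, Real.pi_nonneg⟩
  have hD := (hY.change_base hσ ha h0).linear_comb hσ h0 (hZ.change_base hσ ha h0) 1 (-1)
  have e1 := hD.wronskian_eq hσ (isSolution_solutionMap (l := l) (c := (1, 0)) hσ) ha
  have e2 := hD.wronskian_eq hσ (isSolution_solutionMap (l := l) (c := (0, 1)) hσ) ha
  rw [hY.apply_base ha, hZ.apply_base ha] at e1 e2
  simp only [one_smul, neg_smul, add_neg_cancel, Prod.fst_zero, Prod.snd_zero, zero_mul, sub_self,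
    mul_zero, mul_one, add_zero, zero_sub, sub_zero, Prod.fst_add, Prod.snd_add, Prod.fst_neg,
    Prod.snd_neg] at e1 e2
  have h00 : Y 0 = Z 0 := by
    ext
    · linear_combination -e2
    · linear_combination e1
  have hY' := hY.change_base hσ ha h0
  have hZ' := hZ.change_base hσ ha h0
  rw [← h00] at hZ'
  intro x hx
  rw [hY'.eq_solutionMap hσ ⟨x, hx⟩, hZ'.eq_solutionMap hσ ⟨x, hx⟩]

theorem isSolution_solution (hσ : MemLp σ 2 (volume.restrict (Ioo 0 Real.pi)))
    (ha : a ∈ Icc 0 Real.pi) (l : ℂ) (c : ℂ × ℂ) : IsSolution σ l a c (solution σ l a c) :=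
  Classical.epsilon_spec (exists_isSolution hσ ha l c)

theorem IsSolution.solution_eq (hσ : MemLp σ 2 (volume.restrict (Ioo 0 Real.pi)))
    (ha : a ∈ Icc 0 Real.pi) (hY : IsSolution σ l a c Y) {x : ℝ} (hx : x ∈ Icc 0 Real.pi) :
    solution σ l a c x = Y x :=
  (isSolution_solution hσ ha l c).eqOn hσ ha hY hx

theorem solutionMap_apply (hσ : MemLp σ 2 (volume.restrict (Ioo 0 Real.pi))) (c : ℂ × ℂ) (l : ℂ)
    (x : Icc 0 Real.pi) : solutionMap hσ c l x = solution σ l 0 c x :=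
  ((isSolution_solution hσ ⟨le_rfl, Real.pi_nonneg⟩ l c).eq_solutionMap hσ x).symm

/-- Reflection of the interval maps the potential `σ` to `-σ(π - x)`. -/
theorem IsSolution.reflect (hY : IsSolution σ l Real.pi c Y) :
    IsSolution (fun x => -σ (Real.pi - x)) l 0 (c.1, -c.2)
      (fun x => ((Y (Real.pi - x)).1, -(Y (Real.pi - x)).2)) := by
  have hmaps : MapsTo (fun x => Real.pi - x) (Icc 0 Real.pi) (Icc 0 Real.pi) := fun x hx =>
    ⟨by linarith [hx.2], by linarith [hx.1]⟩
  have hc : ContinuousOn (fun x => Y (Real.pi - x)) (Icc 0 Real.pi) :=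
    hY.1.comp (by fun_prop) hmaps
  refine ⟨hc.fst.prodMk hc.snd.neg, fun x hx => ?_⟩
  obtain ⟨h1, h2⟩ := hY.2 _ (hmaps hx)
  constructor
  · simp only [h1]
    congr 1
    rw [intervalIntegral.integral_symm]
    have := intervalIntegral.integral_comp_sub_left (a := 0) (b := x) (rhs₁ σ Y) Real.pi
    rw [sub_zero] at this
    simp only [rhs₁] at this
    rw [← this, ← intervalIntegral.integral_neg]
    refine intervalIntegral.integral_congr fun t _ => ?_
    ring
  · simp only [h2]
    rw [neg_add]
    congr 1
    rw [intervalIntegral.integral_symm, neg_neg]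
    have := intervalIntegral.integral_comp_sub_left (a := 0) (b := x) (rhs₂ σ l Y) Real.pi
    rw [sub_zero] at this
    simp only [rhs₂] at this
    rw [← this]
    refine intervalIntegral.integral_congr fun t _ => ?_
    ring

theorem memLp_reflect (hσ : MemLp σ 2 (volume.restrict (Ioo 0 Real.pi))) :
    MemLp (fun x => -σ (Real.pi - x)) 2 (volume.restrict (Ioo 0 Real.pi)) := by
  have hmp : MeasurePreserving (fun x : ℝ => Real.pi - x) (volume.restrict (Ioo 0 Real.pi))
      (volume.restrict (Ioo 0 Real.pi)) := by
    have := (volume.measurePreserving_sub_left Real.pi).restrict_preimage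
      (measurableSet_Ioo (a := (0 : ℝ)) (b := Real.pi))
    simpa using this
  exact (hσ.comp_measurePreserving hmp).neg

end SturmLiouville

end

/-! ### Amplitudes that diagonalise the leading part of the system. -/

noncomputable section

namespace SturmLiouville

open Complex (I)

theorem zero_mem_Icc_pi : (0 : ℝ) ∈ Icc 0 Real.pi := ⟨le_rfl, Real.pi_nonneg⟩

theorem pi_mem_Icc_pi : Real.pi ∈ Icc 0 Real.pi := ⟨Real.pi_nonneg, le_rfl⟩

variable {σ : ℝ → ℂ} {ρ : ℂ} {c : ℂ × ℂ} {Y : ℝ → ℂ × ℂ}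

/-- Multiplication by an integrating factor, in integrated form. -/
theorem exp_mul_primitive {F : ℝ → ℂ} {x : ℝ} (hF : IntervalIntegrable F volume 0 x) (κ f₀ : ℂ) :
    Complex.exp (κ * x) * (f₀ + ∫ t in 0..x, F t) =
      f₀ + ∫ t in 0..x, Complex.exp (κ * t) * (κ * (f₀ + ∫ s in 0..t, F s) + F t) := by
  have hderiv : ∀ x : ℝ, HasDerivAt (fun t : ℝ => Complex.exp (κ * t))
      (κ * Complex.exp (κ * x)) x := fun x => by
    have h := ((hasDerivAt_id (x : ℂ)).const_mul κ).cexp.comp_ofReal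
    simpa [mul_comm] using h
  have hE : ∀ x : ℝ, 1 + ∫ t in 0..x, κ * Complex.exp (κ * t) = Complex.exp (κ * x) := fun x => by
    rw [intervalIntegral.integral_eq_sub_of_hasDerivAt (fun t _ => hderiv t)
      (Continuous.intervalIntegrable (by fun_prop) _ _)]
    simp
  have h := integral_mul_integral (F := fun t : ℝ => κ * Complex.exp (κ * t))
    (Continuous.intervalIntegrable (by fun_prop) 0 x) hF 1 f₀
  simp_rw [hE] at h
  rw [h, one_mul]
  congr 1
  refine intervalIntegral.integral_congr fun t _ => ?_
  ring

/-- The amplitude `e^{iρx} (y + i y^{[1]} / ρ)`. -/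
def ampV (ρ : ℂ) (Y : ℝ → ℂ × ℂ) (x : ℝ) : ℂ :=
  Complex.exp (I * ρ * x) * ((Y x).1 + I * (Y x).2 / ρ)

/-- The amplitude `e^{iρx} (y - i y^{[1]} / ρ)`. -/
def ampU (ρ : ℂ) (Y : ℝ → ℂ × ℂ) (x : ℝ) : ℂ :=
  Complex.exp (I * ρ * x) * ((Y x).1 - I * (Y x).2 / ρ)

theorem continuousOn_ampV {s : Set ℝ} (hY : ContinuousOn Y s) : ContinuousOn (ampV ρ Y) s :=
  ContinuousOn.mul (Continuous.continuousOn (by fun_prop))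
    (hY.fst.add ((continuousOn_const.mul hY.snd).div_const _))

theorem continuousOn_ampU {s : Set ℝ} (hY : ContinuousOn Y s) : ContinuousOn (ampU ρ Y) s :=
  ContinuousOn.mul (Continuous.continuousOn (by fun_prop))
    (hY.fst.sub ((continuousOn_const.mul hY.snd).div_const _))

/-- The combination y + iy^{[1]}/ρ satisfies v′ = −iρv + σ(y − iy^{[1]}/ρ) − iσ²y/ρ, and the
exponential removes the term −iρv. The term with σ² carries a factor 1/ρ, so only the term linear in
σ is of leading order. -/
theorem ampV_eq (hσ : MemLp σ 2 (volume.restrict (Ioo 0 Real.pi)))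
    (hY : IsSolution σ (ρ ^ 2) 0 c Y) (hρ : ρ ≠ 0) {x : ℝ} (hx : x ∈ Icc 0 Real.pi) :
    ampV ρ Y x = (c.1 + I * c.2 / ρ) + ∫ t in 0..x,
      (σ t * ampU ρ Y t - I * σ t ^ 2 * (ampU ρ Y t + ampV ρ Y t) / (2 * ρ)) := by
  have h1 := intervalIntegrable_rhs₁ hσ hY.1
  have h2 := (intervalIntegrable_rhs₂ (l := ρ ^ 2) hσ hY.1).const_mul (I / ρ)
  have hv : ∀ t ∈ Icc 0 Real.pi, (c.1 + I * c.2 / ρ) + ∫ s in 0..t,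
      (rhs₁ σ Y s + I / ρ * rhs₂ σ (ρ ^ 2) Y s) = (Y t).1 + I * (Y t).2 / ρ := fun t ht => by
    rw [intervalIntegral.integral_add (intervalIntegrable_of_pi h1 zero_mem_Icc_pi ht)
      (intervalIntegrable_of_pi h2 zero_mem_Icc_pi ht), intervalIntegral.integral_const_mul,
      (hY.2 t ht).1, (hY.2 t ht).2]
    simp only [rhs₁, rhs₂]
    ring
  have h := exp_mul_primitive (intervalIntegrable_of_pi (h1.add h2) zero_mem_Icc_pi hx) (I * ρ)
    (c.1 + I * c.2 / ρ)
  rw [hv x hx] at h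
  rw [ampV, h]
  congr 1
  refine intervalIntegral.integral_congr fun t ht => ?_
  simp only [hv t (uIcc_subset_Icc_pi zero_mem_Icc_pi hx ht)]
  simp only [rhs₁, rhs₂, ampU, ampV]
  field_simp
  linear_combination (2 * ρ ^ 2 * (Y t).2) * Complex.I_sq

/-- The natural integrating factor is e^{−iρx}; multiplying afterwards by e^{2iρx} puts both
amplitudes on the same scale. The kernel e^{2iρ(x−t)} is bounded by 1 for t ≤ x in the closed upper
half-plane. -/
theorem ampU_eq (hσ : MemLp σ 2 (volume.restrict (Ioo 0 Real.pi)))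
    (hY : IsSolution σ (ρ ^ 2) 0 c Y) (hρ : ρ ≠ 0) {x : ℝ} (hx : x ∈ Icc 0 Real.pi) :
    ampU ρ Y x = Complex.exp (2 * I * ρ * x) * (c.1 - I * c.2 / ρ) + ∫ t in 0..x,
      Complex.exp (2 * I * ρ * (x - t)) *
      (σ t * ampV ρ Y t + I * σ t ^ 2 * (ampU ρ Y t + ampV ρ Y t) / (2 * ρ)) := by
  have h1 := intervalIntegrable_rhs₁ hσ hY.1
  have h2 := (intervalIntegrable_rhs₂ (l := ρ ^ 2) hσ hY.1).const_mul (-I / ρ)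
  have hv : ∀ t ∈ Icc 0 Real.pi, (c.1 - I * c.2 / ρ) + ∫ s in 0..t,
      (rhs₁ σ Y s + -I / ρ * rhs₂ σ (ρ ^ 2) Y s) = (Y t).1 - I * (Y t).2 / ρ := fun t ht => by
    rw [intervalIntegral.integral_add (intervalIntegrable_of_pi h1 zero_mem_Icc_pi ht)
      (intervalIntegrable_of_pi h2 zero_mem_Icc_pi ht), intervalIntegral.integral_const_mul,
      (hY.2 t ht).1, (hY.2 t ht).2]
    simp only [rhs₁, rhs₂]
    ring
  have h := exp_mul_primitive (intervalIntegrable_of_pi (h1.add h2) zero_mem_Icc_pi hx) (-(I * ρ))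
    (c.1 - I * c.2 / ρ)
  rw [hv x hx] at h
  have hexp : ∀ t : ℝ, Complex.exp (2 * I * ρ * t) * Complex.exp (-(I * ρ) * t) =
      Complex.exp (I * ρ * t) := fun t => by
    rw [← Complex.exp_add]; ring_nf
  rw [ampU, ← hexp, mul_assoc, h, mul_add, ← intervalIntegral.integral_const_mul]
  congr 1
  refine intervalIntegral.integral_congr fun t ht => ?_
  have hexp2 : Complex.exp (2 * I * ρ * x) * Complex.exp (-(I * ρ) * t) =
      Complex.exp (2 * I * ρ * (x - t)) * Complex.exp (I * ρ * t) := by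
    rw [← Complex.exp_add, ← Complex.exp_add]; ring_nf
  simp only [hv t (uIcc_subset_Icc_pi zero_mem_Icc_pi hx ht)]
  rw [← mul_assoc, hexp2, mul_assoc]
  congr 1
  simp only [rhs₁, rhs₂, ampU, ampV]
  field_simp
  linear_combination (2 * ρ ^ 2 * (Y t).2) * Complex.I_sq

theorem norm_exp_two_I_mul_le_one (hρ : 0 ≤ ρ.im) {x : ℝ} (hx : 0 ≤ x) :
    ‖Complex.exp (2 * I * ρ * x)‖ ≤ 1 := by
  rw [Complex.norm_exp, Real.exp_le_one_iff]
  simp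
  positivity

end SturmLiouville

end

/-! ### Exponential bounds and first-order asymptotics of solutions. -/

noncomputable section

namespace SturmLiouville

open Complex (I)

variable {σ : ℝ → ℂ} {ρ : ℂ} {c : ℂ × ℂ} {Y : ℝ → ℂ × ℂ}

/-- The integral equations have kernels bounded by |σ| + |σ|² when |ρ| ≥ 1 and Im ρ ≥ 0, so
Grönwall's inequality applies to the sum of the two moduli. -/
theorem norm_ampU_add_norm_ampV_le (hσ : MemLp σ 2 (volume.restrict (Ioo 0 Real.pi)))
    (hY : IsSolution σ (ρ ^ 2) 0 c Y) (hρ : 1 ≤ ‖ρ‖) (hρi : 0 ≤ ρ.im) {x : ℝ}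
    (hx : x ∈ Icc 0 Real.pi) :
    ‖ampU ρ Y x‖ + ‖ampV ρ Y x‖ ≤ 2 * (‖c.1‖ + ‖c.2‖ / ‖ρ‖) *
      Real.exp (∫ t in 0..Real.pi, (‖σ t‖ + ‖σ t‖ ^ 2)) := by
  have hρ0 : ρ ≠ 0 := norm_pos_iff.1 (by linarith)
  have hk : IntervalIntegrable (fun t => ‖σ t‖ + ‖σ t‖ ^ 2) volume 0 Real.pi :=
    (intervalIntegrable_sigma hσ).norm.add (intervalIntegrable_norm_sigma_sq hσ)
  have hU := (continuousOn_ampU (ρ := ρ) hY.1).norm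
  have hV := (continuousOn_ampV (ρ := ρ) hY.1).norm
  have hH : ‖c.1 - I * c.2 / ρ‖ + ‖c.1 + I * c.2 / ρ‖ ≤ 2 * (‖c.1‖ + ‖c.2‖ / ‖ρ‖) := by
    have h1 := norm_sub_le c.1 (I * c.2 / ρ)
    have h2 := norm_add_le c.1 (I * c.2 / ρ)
    have h3 : ‖I * c.2 / ρ‖ = ‖c.2‖ / ‖ρ‖ := by simp
    rw [h3] at h1 h2
    linarith
  have hg := gronwall_integrable Real.pi_nonneg hk (fun t => by positivity) (hU.add hV)
    (H := 2 * (‖c.1‖ + ‖c.2‖ / ‖ρ‖)) (fun x hx => by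
      have hsub := uIcc_subset_Icc_pi zero_mem_Icc_pi hx
      have i1 := intervalIntegrable_of_pi (intervalIntegrable_sigma hσ).norm zero_mem_Icc_pi hx
      have i2 := intervalIntegrable_of_pi (intervalIntegrable_norm_sigma_sq hσ) zero_mem_Icc_pi hx
      have hUx := hU.mono hsub
      have hVx := hV.mono hsub
      have gV : IntervalIntegrable (fun t => ‖σ t‖ * ‖ampU ρ Y t‖ +
          ‖σ t‖ ^ 2 * ((‖ampU ρ Y t‖ + ‖ampV ρ Y t‖) / 2)) volume 0 x :=
        (i1.mul_continuousOn hUx).add (i2.mul_continuousOn ((hUx.add hVx).div_const 2))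
      have gU : IntervalIntegrable (fun t => ‖σ t‖ * ‖ampV ρ Y t‖ +
          ‖σ t‖ ^ 2 * ((‖ampU ρ Y t‖ + ‖ampV ρ Y t‖) / 2)) volume 0 x :=
        (i1.mul_continuousOn hVx).add (i2.mul_continuousOn ((hUx.add hVx).div_const 2))
      have hQ : ∀ t, ‖I * σ t ^ 2 * (ampU ρ Y t + ampV ρ Y t) / (2 * ρ)‖ ≤
          ‖σ t‖ ^ 2 * ((‖ampU ρ Y t‖ + ‖ampV ρ Y t‖) / 2) := fun t => by
        have h1 : ‖I * σ t ^ 2 * (ampU ρ Y t + ampV ρ Y t) / (2 * ρ)‖ =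
            ‖σ t‖ ^ 2 * (‖ampU ρ Y t + ampV ρ Y t‖ / (2 * ‖ρ‖)) := by
          simp; ring
        rw [h1]
        have := norm_add_le (ampU ρ Y t) (ampV ρ Y t)
        gcongr
        linarith
      have bV := intervalIntegral.norm_integral_le_of_norm_le (μ := volume) hx.1
        (f := fun t => σ t * ampU ρ Y t - I * σ t ^ 2 * (ampU ρ Y t + ampV ρ Y t) / (2 * ρ))
        (ae_of_all _ fun t _ => (norm_sub_le _ _).trans
          (add_le_add (norm_mul_le _ _) (hQ t))) gV
      have bU := intervalIntegral.norm_integral_le_of_norm_le (μ := volume) hx.1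
        (f := fun t => Complex.exp (2 * I * ρ * (x - t)) *
          (σ t * ampV ρ Y t + I * σ t ^ 2 * (ampU ρ Y t + ampV ρ Y t) / (2 * ρ)))
        (ae_of_all _ fun t ht => by
          have he := norm_exp_two_I_mul_le_one hρi (sub_nonneg.2 ht.2)
          push_cast at he
          rw [norm_mul]
          refine (mul_le_of_le_one_left (norm_nonneg _) he).trans ((norm_add_le _ _).trans
            (add_le_add (norm_mul_le _ _) (hQ t)))) gU
      have eV := ampV_eq hσ hY hρ0 hx
      have eU := ampU_eq hσ hY hρ0 hx
      have hsum := intervalIntegral.integral_add gU gV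
      have heq : ∫ t in 0..x, ((‖σ t‖ * ‖ampV ρ Y t‖ +
          ‖σ t‖ ^ 2 * ((‖ampU ρ Y t‖ + ‖ampV ρ Y t‖) / 2)) + (‖σ t‖ * ‖ampU ρ Y t‖ +
          ‖σ t‖ ^ 2 * ((‖ampU ρ Y t‖ + ‖ampV ρ Y t‖) / 2))) =
          ∫ t in 0..x, (‖σ t‖ + ‖σ t‖ ^ 2) * (‖ampU ρ Y t‖ + ‖ampV ρ Y t‖) := by
        refine intervalIntegral.integral_congr fun t _ => ?_
        ring
      have nV := norm_add_le (c.1 + I * c.2 / ρ) (∫ t in 0..x,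
        (σ t * ampU ρ Y t - I * σ t ^ 2 * (ampU ρ Y t + ampV ρ Y t) / (2 * ρ)))
      have nU := norm_add_le (Complex.exp (2 * I * ρ * x) * (c.1 - I * c.2 / ρ)) (∫ t in 0..x,
        Complex.exp (2 * I * ρ * (x - t)) *
          (σ t * ampV ρ Y t + I * σ t ^ 2 * (ampU ρ Y t + ampV ρ Y t) / (2 * ρ)))
      have nU2 : ‖Complex.exp (2 * I * ρ * x) * (c.1 - I * c.2 / ρ)‖ ≤ ‖c.1 - I * c.2 / ρ‖ := by
        rw [norm_mul]
        exact mul_le_of_le_one_left (norm_nonneg _) (norm_exp_two_I_mul_le_one hρi hx.1)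
      rw [← eV] at nV
      rw [← eU] at nU
      simp only [Pi.add_apply]
      linarith) x hx
  refine hg.trans ?_
  gcongr
  exact intervalIntegral.integral_mono_interval le_rfl hx.1 hx.2
    (Eventually.of_forall fun _ => by positivity) hk

theorem norm_exp_I_mul (ρ : ℂ) (x : ℝ) :
    ‖Complex.exp (-(I * ρ * x))‖ = Real.exp (ρ.im * x) := by
  rw [Complex.norm_exp]; simp

theorem fst_eq_amp (hρ : ρ ≠ 0) (Y : ℝ → ℂ × ℂ) (x : ℝ) :
    (Y x).1 = Complex.exp (-(I * ρ * x)) * ((ampU ρ Y x + ampV ρ Y x) / 2) := by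
  have h := Complex.exp_ne_zero (I * ρ * x)
  rw [ampU, ampV, Complex.exp_neg]
  field_simp
  ring

theorem snd_eq_amp (hρ : ρ ≠ 0) (Y : ℝ → ℂ × ℂ) (x : ℝ) :
    (Y x).2 = ρ * (Complex.exp (-(I * ρ * x)) * (I * (ampU ρ Y x - ampV ρ Y x) / 2)) := by
  have h := Complex.exp_ne_zero (I * ρ * x)
  rw [ampU, ampV, Complex.exp_neg]
  field_simp
  linear_combination (2 * (Y x).2) * Complex.I_sq

/-- Exponential bound for solutions of the Cauchy problem. -/
theorem exists_norm_solution_le (hσ : MemLp σ 2 (volume.restrict (Ioo 0 Real.pi))) :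
    ∃ C : ℝ, 0 < C ∧ ∀ (ρ : ℂ), 1 ≤ ‖ρ‖ → ∀ (c : ℂ × ℂ), ∀ x ∈ Icc 0 Real.pi,
      ‖(solution σ (ρ ^ 2) 0 c x).1‖ ≤
        C * Real.exp (|ρ.im| * x) * (‖c.1‖ + ‖c.2‖ / ‖ρ‖) ∧
      ‖(solution σ (ρ ^ 2) 0 c x).2‖ ≤
        C * ‖ρ‖ * Real.exp (|ρ.im| * x) * (‖c.1‖ + ‖c.2‖ / ‖ρ‖) := by
  refine ⟨Real.exp (∫ t in 0..Real.pi, (‖σ t‖ + ‖σ t‖ ^ 2)), Real.exp_pos _, fun ρ hρ c x hx => ?_⟩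
  -- The claim depends on ρ only through ρ², |ρ| and |Im ρ|, so ρ may be replaced by −ρ.
  wlog hρi : 0 ≤ ρ.im generalizing ρ
  · have := this (-ρ) (by simpa using hρ) (by simp; linarith)
    simpa using this
  have hρ0 : ρ ≠ 0 := norm_pos_iff.1 (by linarith)
  have hY := isSolution_solution hσ zero_mem_Icc_pi (ρ ^ 2) c
  have h := norm_ampU_add_norm_ampV_le hσ hY hρ hρi hx
  rw [abs_of_nonneg hρi]
  set E := Real.exp (∫ t in 0..Real.pi, (‖σ t‖ + ‖σ t‖ ^ 2))
  constructor
  · rw [fst_eq_amp hρ0 _ x, norm_mul, norm_exp_I_mul, norm_div, Complex.norm_ofNat]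
    have h1 := norm_add_le (ampU ρ (solution σ (ρ ^ 2) 0 c) x) (ampV ρ (solution σ (ρ ^ 2) 0 c) x)
    calc _ ≤ Real.exp (ρ.im * x) * (2 * (‖c.1‖ + ‖c.2‖ / ‖ρ‖) * E / 2) := by
          gcongr; linarith
      _ = _ := by ring
  · rw [snd_eq_amp hρ0 _ x, norm_mul, norm_mul, norm_exp_I_mul, norm_div, Complex.norm_ofNat,
      norm_mul, Complex.norm_I, one_mul]
    have h1 := norm_sub_le (ampU ρ (solution σ (ρ ^ 2) 0 c) x) (ampV ρ (solution σ (ρ ^ 2) 0 c) x)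
    calc _ ≤ ‖ρ‖ * (Real.exp (ρ.im * x) * (2 * (‖c.1‖ + ‖c.2‖ / ‖ρ‖) * E / 2)) := by
          gcongr; linarith
      _ = _ := by ring

/-- The size of the oscillatory integrals that govern the first-order perturbation. -/
def osc (σ : ℝ → ℂ) (ρ : ℂ) (x : ℝ) : ℝ :=
  ‖∫ t in 0..x, σ t * Complex.exp (2 * I * ρ * t)‖ +
    ‖∫ t in 0..x, Complex.exp (2 * I * ρ * (x - t)) * σ t‖

theorem integral_exp_sub_mul (σ : ℝ → ℂ) (ρ : ℂ) (x : ℝ) :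
    ∫ t in 0..x, Complex.exp (2 * I * ρ * (x - t)) * σ t =
      Complex.exp (2 * I * ρ * x) * ∫ t in 0..x, σ t * Complex.exp (2 * I * (-ρ) * t) := by
  rw [← intervalIntegral.integral_const_mul]
  refine intervalIntegral.integral_congr fun t _ => ?_
  rw [mul_left_comm, ← Complex.exp_add, mul_comm]
  ring_nf

theorem continuousOn_osc (hσ : MemLp σ 2 (volume.restrict (Ioo 0 Real.pi))) (ρ : ℂ) :
    ContinuousOn (osc σ ρ) (Icc 0 Real.pi) := by
  have h : ∀ ρ : ℂ, ContinuousOn (fun x => ∫ t in 0..x, σ t * Complex.exp (2 * I * ρ * t))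
      (Icc 0 Real.pi) := fun ρ => by
    rw [← uIcc_of_le Real.pi_nonneg]
    exact intervalIntegral.continuousOn_primitive_interval' ((intervalIntegrable_sigma hσ).mul_continuousOn
      (Continuous.continuousOn (by fun_prop))) left_mem_uIcc
  have : osc σ ρ = fun x => ‖∫ t in 0..x, σ t * Complex.exp (2 * I * ρ * t)‖ +
      ‖Complex.exp (2 * I * ρ * x) * ∫ t in 0..x, σ t * Complex.exp (2 * I * (-ρ) * t)‖ := by
    ext x; rw [osc, integral_exp_sub_mul]
  rw [this]
  exact (h ρ).norm.add (ContinuousOn.mul (Continuous.continuousOn (by fun_prop)) (h (-ρ))).norm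

theorem osc_nonneg (σ : ℝ → ℂ) (ρ : ℂ) (x : ℝ) : 0 ≤ osc σ ρ x := by unfold osc; positivity

/-- For σ = 0 the amplitudes are e^{2iρx} and 1. Subtracting them leaves the first iterate, which is
an oscillatory integral of σ, a term of order 1/|ρ| from σ², and a term linear in the deviation. -/
theorem norm_amp_sub_le (hσ : MemLp σ 2 (volume.restrict (Ioo 0 Real.pi)))
    (hY : IsSolution σ (ρ ^ 2) 0 (1, 0) Y) (hρ : 1 ≤ ‖ρ‖) (hρi : 0 ≤ ρ.im) {x : ℝ}
    (hx : x ∈ Icc 0 Real.pi) :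
    ‖ampU ρ Y x - Complex.exp (2 * I * ρ * x)‖ + ‖ampV ρ Y x - 1‖ ≤
      osc σ ρ x + (∫ t in 0..Real.pi, ‖σ t‖ ^ 2) *
        (2 * Real.exp (∫ t in 0..Real.pi, (‖σ t‖ + ‖σ t‖ ^ 2))) / ‖ρ‖ +
      ∫ t in 0..x, ‖σ t‖ *
        (‖ampU ρ Y t - Complex.exp (2 * I * ρ * t)‖ + ‖ampV ρ Y t - 1‖) := by
  have hρ0 : ρ ≠ 0 := norm_pos_iff.1 (by linarith)
  set B := 2 * Real.exp (∫ t in 0..Real.pi, (‖σ t‖ + ‖σ t‖ ^ 2)) with hB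
  have hsub := uIcc_subset_Icc_pi zero_mem_Icc_pi hx
  have i0 := intervalIntegrable_of_pi (intervalIntegrable_sigma hσ) zero_mem_Icc_pi hx
  have i1 := i0.norm
  have i2 := intervalIntegrable_of_pi (intervalIntegrable_norm_sigma_sq hσ) zero_mem_Icc_pi hx
  have i3 := intervalIntegrable_of_pi (intervalIntegrable_sigma_sq hσ) zero_mem_Icc_pi hx
  have hU := (continuousOn_ampU (ρ := ρ) hY.1).mono hsub
  have hV := (continuousOn_ampV (ρ := ρ) hY.1).mono hsub
  have hE : ∀ κ : ℂ, Continuous fun t : ℝ => Complex.exp (2 * I * κ * t) := fun κ => by fun_prop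
  have hE2 : Continuous fun t : ℝ => Complex.exp (2 * I * ρ * (x - t)) := by fun_prop
  have hUs : ContinuousOn (fun t : ℝ => ampU ρ Y t - Complex.exp (2 * I * ρ * t)) (uIcc 0 x) :=
    hU.sub (hE ρ).continuousOn
  have hVs : ContinuousOn (fun t : ℝ => ampV ρ Y t - 1) (uIcc 0 x) := hV.sub continuousOn_const
  have hBle : ∀ t ∈ Icc 0 Real.pi, ‖ampU ρ Y t‖ + ‖ampV ρ Y t‖ ≤ B := fun t ht => by
    simpa [hB] using norm_ampU_add_norm_ampV_le hσ hY hρ hρi ht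
  have hQ : ∀ t ∈ Icc 0 Real.pi, ‖I * σ t ^ 2 * (ampU ρ Y t + ampV ρ Y t) / (2 * ρ)‖ ≤
      ‖σ t‖ ^ 2 * (B / (2 * ‖ρ‖)) := fun t ht => by
    have h1 : ‖I * σ t ^ 2 * (ampU ρ Y t + ampV ρ Y t) / (2 * ρ)‖ =
        ‖σ t‖ ^ 2 * (‖ampU ρ Y t + ampV ρ Y t‖ / (2 * ‖ρ‖)) := by
      simp; ring
    rw [h1]
    gcongr
    exact (norm_add_le _ _).trans (hBle t ht)
  have iQ : IntervalIntegrable (fun t => I * σ t ^ 2 * (ampU ρ Y t + ampV ρ Y t) / (2 * ρ))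
      volume 0 x := ((i3.const_mul I).mul_continuousOn (hU.add hV)).div_const _
  have gV : IntervalIntegrable (fun t => ‖σ t‖ * ‖ampU ρ Y t - Complex.exp (2 * I * ρ * t)‖ +
      ‖σ t‖ ^ 2 * (B / (2 * ‖ρ‖))) volume 0 x :=
    (i1.mul_continuousOn hUs.norm).add (i2.mul_const _)
  have gU : IntervalIntegrable (fun t => ‖σ t‖ * ‖ampV ρ Y t - 1‖ +
      ‖σ t‖ ^ 2 * (B / (2 * ‖ρ‖))) volume 0 x :=
    (i1.mul_continuousOn hVs.norm).add (i2.mul_const _)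
  have bV := intervalIntegral.norm_integral_le_of_norm_le (μ := volume) hx.1
    (f := fun t => σ t * (ampU ρ Y t - Complex.exp (2 * I * ρ * t)) -
      I * σ t ^ 2 * (ampU ρ Y t + ampV ρ Y t) / (2 * ρ))
    (ae_of_all _ fun t ht => (norm_sub_le _ _).trans
      (add_le_add (norm_mul_le _ _) (hQ t ⟨ht.1.le, ht.2.trans hx.2⟩))) gV
  have bU := intervalIntegral.norm_integral_le_of_norm_le (μ := volume) hx.1
    (f := fun t => Complex.exp (2 * I * ρ * (x - t)) *
      (σ t * (ampV ρ Y t - 1) + I * σ t ^ 2 * (ampU ρ Y t + ampV ρ Y t) / (2 * ρ)))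
    (ae_of_all _ fun t ht => by
      have he := norm_exp_two_I_mul_le_one hρi (sub_nonneg.2 ht.2)
      push_cast at he
      rw [norm_mul]
      refine (mul_le_of_le_one_left (norm_nonneg _) he).trans ((norm_add_le _ _).trans
        (add_le_add (norm_mul_le _ _) (hQ t ⟨ht.1.le, ht.2.trans hx.2⟩)))) gU
  have eV : ampV ρ Y x - 1 = (∫ t in 0..x, σ t * Complex.exp (2 * I * ρ * t)) +
      ∫ t in 0..x, (σ t * (ampU ρ Y t - Complex.exp (2 * I * ρ * t)) -
        I * σ t ^ 2 * (ampU ρ Y t + ampV ρ Y t) / (2 * ρ)) := by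
    rw [ampV_eq hσ hY hρ0 hx, ← intervalIntegral.integral_add
      (i0.mul_continuousOn (hE ρ).continuousOn)
      ((i0.mul_continuousOn hUs).sub iQ)]
    simp only [mul_zero, zero_div, add_zero, add_sub_cancel_left]
    refine intervalIntegral.integral_congr fun t _ => ?_
    ring
  have eU : ampU ρ Y x - Complex.exp (2 * I * ρ * x) =
      (∫ t in 0..x, Complex.exp (2 * I * ρ * (x - t)) * σ t) +
      ∫ t in 0..x, Complex.exp (2 * I * ρ * (x - t)) * (σ t * (ampV ρ Y t - 1) +
        I * σ t ^ 2 * (ampU ρ Y t + ampV ρ Y t) / (2 * ρ)) := by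
    rw [ampU_eq hσ hY hρ0 hx, ← intervalIntegral.integral_add
      (i0.continuousOn_mul hE2.continuousOn)
      (((i0.mul_continuousOn hVs).add iQ).continuousOn_mul
        hE2.continuousOn)]
    simp only [mul_zero, zero_div, sub_zero, mul_one, add_sub_cancel_left]
    refine intervalIntegral.integral_congr fun t _ => ?_
    ring
  have hsum := intervalIntegral.integral_add gU gV
  have heq : ∫ t in 0..x, ((‖σ t‖ * ‖ampV ρ Y t - 1‖ + ‖σ t‖ ^ 2 * (B / (2 * ‖ρ‖))) +
      (‖σ t‖ * ‖ampU ρ Y t - Complex.exp (2 * I * ρ * t)‖ + ‖σ t‖ ^ 2 * (B / (2 * ‖ρ‖)))) =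
      (∫ t in 0..x, ‖σ t‖ * (‖ampU ρ Y t - Complex.exp (2 * I * ρ * t)‖ + ‖ampV ρ Y t - 1‖)) +
        (∫ t in 0..x, ‖σ t‖ ^ 2) * B / ‖ρ‖ := by
    have hUV : ContinuousOn (fun t : ℝ => ‖ampU ρ Y t - Complex.exp (2 * I * ρ * t)‖ +
        ‖ampV ρ Y t - 1‖) (uIcc 0 x) := hUs.norm.add hVs.norm
    rw [mul_div_assoc (∫ t in 0..x, ‖σ t‖ ^ 2), ← intervalIntegral.integral_mul_const,
      ← intervalIntegral.integral_add (i1.mul_continuousOn hUV) (i2.mul_const _)]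
    refine intervalIntegral.integral_congr fun t _ => ?_
    ring
  have hS : (∫ t in 0..x, ‖σ t‖ ^ 2) * B / ‖ρ‖ ≤ (∫ t in 0..Real.pi, ‖σ t‖ ^ 2) * B / ‖ρ‖ := by
    gcongr
    exact intervalIntegral.integral_mono_interval le_rfl hx.1 hx.2
      (Eventually.of_forall fun _ => by positivity) (intervalIntegrable_norm_sigma_sq hσ)
  have nV := norm_add_le (∫ t in 0..x, σ t * Complex.exp (2 * I * ρ * t))
    (∫ t in 0..x, (σ t * (ampU ρ Y t - Complex.exp (2 * I * ρ * t)) -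
        I * σ t ^ 2 * (ampU ρ Y t + ampV ρ Y t) / (2 * ρ)))
  have nU := norm_add_le (∫ t in 0..x, Complex.exp (2 * I * ρ * (x - t)) * σ t)
    (∫ t in 0..x, Complex.exp (2 * I * ρ * (x - t)) * (σ t * (ampV ρ Y t - 1) +
        I * σ t ^ 2 * (ampU ρ Y t + ampV ρ Y t) / (2 * ρ)))
  rw [← eV] at nV
  rw [← eU] at nU
  simp only [osc]
  linarith

/-- First-order asymptotics of the solution with Cauchy data `(1, 0)`. -/
theorem exists_norm_solution_sub_le (hσ : MemLp σ 2 (volume.restrict (Ioo 0 Real.pi))) :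
    ∃ C : ℝ, 0 < C ∧ ∀ (ρ : ℂ), 1 ≤ ‖ρ‖ → 0 ≤ ρ.im → ∀ x ∈ Icc 0 Real.pi,
      ‖(solution σ (ρ ^ 2) 0 (1, 0) x).1 - Complex.cos (ρ * x)‖ ≤ Real.exp (ρ.im * x) *
        (C * (osc σ ρ x + 1 / ‖ρ‖ + ∫ t in 0..Real.pi, ‖σ t‖ * osc σ ρ t)) ∧
      ‖(solution σ (ρ ^ 2) 0 (1, 0) x).2 + ρ * Complex.sin (ρ * x)‖ ≤ ‖ρ‖ * (Real.exp (ρ.im * x) *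
        (C * (osc σ ρ x + 1 / ‖ρ‖ + ∫ t in 0..Real.pi, ‖σ t‖ * osc σ ρ t))) := by
  set S₁ := ∫ t in 0..Real.pi, ‖σ t‖ with hS₁
  set B := (∫ t in 0..Real.pi, ‖σ t‖ ^ 2) *
        (2 * Real.exp (∫ t in 0..Real.pi, (‖σ t‖ + ‖σ t‖ ^ 2))) with hB
  have hS0 : 0 ≤ S₁ := intervalIntegral.integral_nonneg Real.pi_nonneg fun _ _ => norm_nonneg _
  have hB0 : 0 ≤ B := mul_nonneg
    (intervalIntegral.integral_nonneg Real.pi_nonneg fun _ _ => by positivity) (by positivity)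
  refine ⟨1 + B + Real.exp S₁ + Real.exp S₁ * (S₁ * B), by positivity, fun ρ hρ hρi x hx => ?_⟩
  have hρ0 : ρ ≠ 0 := norm_pos_iff.1 (by linarith)
  have hY := isSolution_solution hσ zero_mem_Icc_pi (ρ ^ 2) (1, 0)
  set Y := solution σ (ρ ^ 2) 0 (1, 0)
  have hI := intervalIntegrable_sigma hσ
  have hosc := continuousOn_osc hσ ρ
  set d : ℝ → ℝ := fun t => ‖ampU ρ Y t - Complex.exp (2 * I * ρ * t)‖ + ‖ampV ρ Y t - 1‖ with hd
  have hdc : ContinuousOn d (Icc 0 Real.pi) :=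
    ((continuousOn_ampU hY.1).sub (Continuous.continuousOn (by fun_prop))).norm.add
      ((continuousOn_ampV hY.1).sub continuousOn_const).norm
  have hle : ∀ t ∈ Icc 0 Real.pi, d t ≤ osc σ ρ t + B / ‖ρ‖ + ∫ s in 0..t, ‖σ s‖ * d s :=
    fun t ht => norm_amp_sub_le hσ hY hρ hρi ht
  have hJ : IntervalIntegrable (fun t => ‖σ t‖ * osc σ ρ t) volume 0 Real.pi :=
    hI.norm.mul_continuousOn (by rwa [uIcc_of_le Real.pi_nonneg])
  have hσd : IntervalIntegrable (fun t => ‖σ t‖ * d t) volume 0 Real.pi :=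
    hI.norm.mul_continuousOn (by rwa [uIcc_of_le Real.pi_nonneg])
  set J := ∫ t in 0..Real.pi, ‖σ t‖ * osc σ ρ t with hJd
  have hJ0 : 0 ≤ J := intervalIntegral.integral_nonneg Real.pi_nonneg fun t _ =>
    mul_nonneg (norm_nonneg _) (osc_nonneg _ _ _)
  have hDc : ContinuousOn (fun t => ∫ s in 0..t, ‖σ s‖ * d s) (Icc 0 Real.pi) := by
    rw [← uIcc_of_le Real.pi_nonneg]
    exact intervalIntegral.continuousOn_primitive_interval' hσd left_mem_uIcc
  -- Grönwall's inequality is applied to the integral of ‖σ‖d rather than to d. This keeps `osc` at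
  -- the point x itself in the final bound, with only an integrated contribution from other points,
  -- as square summability at fixed x requires.
  have hg := gronwall_integrable Real.pi_nonneg hI.norm (fun t => norm_nonneg _) hDc
    (H := J + S₁ * (B / ‖ρ‖)) (fun t ht => by
      have hsub := uIcc_subset_Icc_pi zero_mem_Icc_pi ht
      have hR : IntervalIntegrable (fun s => ‖σ s‖ * osc σ ρ s + ‖σ s‖ * (B / ‖ρ‖)) volume 0
        Real.pi := hJ.add (hI.norm.mul_const _)
      have hσD : IntervalIntegrable (fun s => ‖σ s‖ * ∫ r in 0..s, ‖σ r‖ * d r) volume 0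
        Real.pi := hI.norm.mul_continuousOn (by rwa [uIcc_of_le Real.pi_nonneg])
      have h0 := zero_mem_Icc_pi
      have h1 : ∫ s in 0..t, ‖σ s‖ * d s ≤ ∫ s in 0..t, ((‖σ s‖ * osc σ ρ s +
          ‖σ s‖ * (B / ‖ρ‖)) + ‖σ s‖ * ∫ r in 0..s, ‖σ r‖ * d r) := by
        refine intervalIntegral.integral_mono_on ht.1 (intervalIntegrable_of_pi hσd h0 ht)
          (intervalIntegrable_of_pi (hR.add hσD) h0 ht) fun s hs => ?_
        have := mul_le_mul_of_nonneg_left (hle s ⟨hs.1, hs.2.trans ht.2⟩) (norm_nonneg (σ s))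
        linarith
      rw [intervalIntegral.integral_add (intervalIntegrable_of_pi hR h0 ht)
        (intervalIntegrable_of_pi hσD h0 ht)] at h1
      have h2 : ∫ s in 0..t, (‖σ s‖ * osc σ ρ s + ‖σ s‖ * (B / ‖ρ‖)) ≤
          ∫ s in 0..Real.pi, (‖σ s‖ * osc σ ρ s + ‖σ s‖ * (B / ‖ρ‖)) :=
        intervalIntegral.integral_mono_interval le_rfl ht.1 ht.2
          (Eventually.of_forall fun s => by
            have := osc_nonneg σ ρ s
            simp only [Pi.zero_apply]
            positivity) hR
      rw [intervalIntegral.integral_add hJ (hI.norm.mul_const _),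
        intervalIntegral.integral_mul_const] at h2
      linarith) x hx
  have hexp : Real.exp (∫ t in 0..x, ‖σ t‖) ≤ Real.exp S₁ := by
    rw [Real.exp_le_exp]
    exact intervalIntegral.integral_mono_interval le_rfl hx.1 hx.2
      (Eventually.of_forall fun _ => norm_nonneg _) hI.norm
  have ho := osc_nonneg σ ρ x
  have hr : 0 ≤ 1 / ‖ρ‖ := by positivity
  have hdx : d x ≤ (1 + B + Real.exp S₁ + Real.exp S₁ * (S₁ * B)) *
      (osc σ ρ x + 1 / ‖ρ‖ + J) := by
    have h1 := hle x hx
    have h2 : (J + S₁ * (B / ‖ρ‖)) * Real.exp (∫ t in 0..x, ‖σ t‖) ≤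
      (J + S₁ * (B / ‖ρ‖)) * Real.exp S₁ := by gcongr
    have hE := (Real.exp_pos S₁).le
    have e1 : B / ‖ρ‖ = B * (1 / ‖ρ‖) := by ring
    rw [e1] at h1 h2 hg
    have p1 := mul_nonneg hE ho
    have p2 := mul_nonneg hB0 ho
    have p3 := mul_nonneg (mul_nonneg hE (mul_nonneg hS0 hB0)) ho
    have p4 := mul_nonneg hB0 hJ0
    have p5 := mul_nonneg (mul_nonneg hE (mul_nonneg hS0 hB0)) hJ0
    have p6 := mul_nonneg hE hr
    nlinarith
  have hcos : Complex.cos (ρ * x) =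
      Complex.exp (-(I * ρ * x)) * ((Complex.exp (2 * I * ρ * x) + 1) / 2) := by
    rw [Complex.cos, ← mul_div_assoc, mul_add, ← Complex.exp_add]
    ring_nf
  have hsin : ρ * Complex.sin (ρ * x) = -(ρ * (Complex.exp (-(I * ρ * x)) *
      (I * (Complex.exp (2 * I * ρ * x) - 1) / 2))) := by
    have : Complex.exp (-(I * ρ * x)) * (I * (Complex.exp (2 * I * ρ * x) - 1) / 2) =
        I * (Complex.exp (-(I * ρ * x)) * Complex.exp (2 * I * ρ * x) -
          Complex.exp (-(I * ρ * x))) / 2 := by ring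
    rw [this, Complex.sin, ← Complex.exp_add]
    ring_nf
  have h1 := norm_add_le (ampU ρ Y x - Complex.exp (2 * I * ρ * x)) (ampV ρ Y x - 1)
  have h2 := norm_sub_le (ampU ρ Y x - Complex.exp (2 * I * ρ * x)) (ampV ρ Y x - 1)
  have hd0 : 0 ≤ d x := by positivity
  have hd' : d x = ‖ampU ρ Y x - Complex.exp (2 * I * ρ * x)‖ + ‖ampV ρ Y x - 1‖ := rfl
  constructor
  · have : (Y x).1 - Complex.cos (ρ * x) = Complex.exp (-(I * ρ * x)) *
        (((ampU ρ Y x - Complex.exp (2 * I * ρ * x)) + (ampV ρ Y x - 1)) / 2) := by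
      rw [hcos, fst_eq_amp hρ0 Y x]
      ring
    rw [this, norm_mul, norm_exp_I_mul, norm_div, Complex.norm_ofNat]
    gcongr
    linarith
  · have : (Y x).2 + ρ * Complex.sin (ρ * x) = ρ * (Complex.exp (-(I * ρ * x)) *
        (I * ((ampU ρ Y x - Complex.exp (2 * I * ρ * x)) - (ampV ρ Y x - 1)) / 2)) := by
      rw [hsin, snd_eq_amp hρ0 Y x]
      ring
    rw [this, norm_mul, norm_mul, norm_exp_I_mul, norm_div, Complex.norm_ofNat, norm_mul,
      Complex.norm_I, one_mul]
    gcongr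
    linarith

end SturmLiouville

end

/-! ### A uniform Riemann–Lebesgue lemma and Bessel's inequality. -/

noncomputable section

namespace SturmLiouville

open Complex (I)

variable {σ : ℝ → ℂ} {ρ : ℂ}

/-- Approximate σ in L₁ by a smooth function and integrate by parts; the bound on the exponential
makes both estimates uniform. The shift κ₀ admits the kernel e^{2iρ(x−t)} as well as e^{2iρt}. -/
theorem exists_norm_integral_mul_exp_le (hσ : IntervalIntegrable σ volume 0 Real.pi) {ε : ℝ}
    (hε : 0 < ε) :
    ∃ R : ℝ, 0 < R ∧ ∀ x ∈ Icc 0 Real.pi, ∀ κ κ₀ : ℂ, R ≤ ‖κ‖ →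
      (∀ t ∈ Icc 0 x, ‖Complex.exp (κ * t + κ₀)‖ ≤ 1) →
      ‖∫ t in 0..x, σ t * Complex.exp (κ * t + κ₀)‖ ≤ ε := by
  have hσ' := hσ
  rw [intervalIntegrable_iff_integrableOn_Ioc_of_le Real.pi_nonneg] at hσ'
  obtain ⟨g, hg1, hg2, hg3⟩ := (memLp_one_iff_integrable.2 hσ').exist_eLpNorm_sub_le
    ENNReal.one_ne_top le_rfl (half_pos hε)
  have hgc : Continuous g := hg2.continuous
  have hg' : Continuous (deriv g) := hg2.continuous_deriv (by simp)
  have hdiff : ∫ t in 0..Real.pi, ‖σ t - g t‖ ≤ ε / 2 := by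
    have hi : Integrable (σ - g) (volume.restrict (Ioc 0 Real.pi)) :=
      hσ'.sub (hgc.integrableOn_Ioc)
    have h := ofReal_integral_norm_eq_lintegral_enorm hi
    rw [← eLpNorm_one_eq_lintegral_enorm] at h
    rw [← h, ENNReal.ofReal_le_ofReal_iff (half_pos hε).le] at hg3
    rw [intervalIntegral.integral_of_le Real.pi_nonneg]
    exact hg3
  obtain ⟨G, hG⟩ := (isCompact_Icc.image (s := Icc 0 Real.pi) hgc.norm).bddAbove
  obtain ⟨G', hG'⟩ := (isCompact_Icc.image (s := Icc 0 Real.pi) hg'.norm).bddAbove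
  have hGt : ∀ t ∈ Icc 0 Real.pi, ‖g t‖ ≤ G := fun t ht => hG (mem_image_of_mem _ ht)
  have hGt' : ∀ t ∈ Icc 0 Real.pi, ‖deriv g t‖ ≤ G' := fun t ht => hG' (mem_image_of_mem _ ht)
  have hG0 : 0 ≤ G := (norm_nonneg _).trans (hGt 0 zero_mem_Icc_pi)
  have hG0' : 0 ≤ G' := (norm_nonneg _).trans (hGt' 0 zero_mem_Icc_pi)
  -- Integration by parts bounds the smooth part by (2G + πG′)/‖κ‖, which has to be at most ε/2. The
  -- summand 1 keeps the threshold positive.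
  refine ⟨(2 * G + Real.pi * G' + 1) / (ε / 2), by positivity, fun x hx κ κ₀ hκ hexp => ?_⟩
  have hκpos : 0 < ‖κ‖ := lt_of_lt_of_le (by positivity) hκ
  have hκ0 : κ ≠ 0 := norm_pos_iff.1 hκpos
  have hE : Continuous fun t : ℝ => Complex.exp (κ * t + κ₀) := by fun_prop
  have hsx := intervalIntegrable_of_pi hσ zero_mem_Icc_pi hx
  have hsplit : ∫ t in 0..x, σ t * Complex.exp (κ * t + κ₀) =
      (∫ t in 0..x, (σ t - g t) * Complex.exp (κ * t + κ₀)) +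
        ∫ t in 0..x, g t * Complex.exp (κ * t + κ₀) := by
    rw [← intervalIntegral.integral_add ((hsx.sub (hgc.intervalIntegrable _ _)).mul_continuousOn
      hE.continuousOn) ((hgc.fun_mul hE).intervalIntegrable _ _)]
    refine intervalIntegral.integral_congr fun t _ => ?_
    ring
  have h1 : ‖∫ t in 0..x, (σ t - g t) * Complex.exp (κ * t + κ₀)‖ ≤ ε / 2 := by
    refine (intervalIntegral.norm_integral_le_of_norm_le (g := fun t => ‖σ t - g t‖) hx.1
      (ae_of_all _ fun t ht => ?_) ((hsx.sub (hgc.intervalIntegrable _ _)).norm)).trans ?_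
    · rw [norm_mul]
      exact mul_le_of_le_one_right (norm_nonneg _) (hexp t ⟨ht.1.le, ht.2⟩)
    · exact (intervalIntegral.integral_mono_interval le_rfl hx.1 hx.2
        (Eventually.of_forall fun _ => norm_nonneg _)
        ((hσ.sub (hgc.intervalIntegrable _ _)).norm)).trans hdiff
  have h2 : ‖∫ t in 0..x, g t * Complex.exp (κ * t + κ₀)‖ ≤ ε / 2 := by
    have hparts := intervalIntegral.integral_mul_deriv_eq_deriv_mul_of_hasDerivAt
      (a := 0) (b := x) (u := g) (v := fun t : ℝ => Complex.exp (κ * t + κ₀) / κ) (u' := deriv g)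
      (v' := fun t : ℝ => Complex.exp (κ * t + κ₀)) hgc.continuousOn (hE.div_const _).continuousOn
      (fun t _ => (hg2.differentiable (by simp) t).hasDerivAt)
      (fun t _ => by
        have h := ((((hasDerivAt_id (t : ℂ)).const_mul κ).add_const κ₀).cexp.comp_ofReal).div_const κ
        simpa [hκ0] using h)
      (hg'.intervalIntegrable _ _) (hE.intervalIntegrable _ _)
    rw [hparts]
    have hb : ∀ t ∈ Icc 0 x, ‖g t * (Complex.exp (κ * t + κ₀) / κ)‖ ≤ G / ‖κ‖ := fun t ht => by
      rw [norm_mul, norm_div, ← mul_div_assoc]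
      gcongr
      exact (mul_le_of_le_one_right (norm_nonneg _) (hexp t ht)).trans
        (hGt t ⟨ht.1, ht.2.trans hx.2⟩)
    have hi : ‖∫ t in 0..x, deriv g t * (Complex.exp (κ * t + κ₀) / κ)‖ ≤
        Real.pi * (G' / ‖κ‖) := by
      have := intervalIntegral.norm_integral_le_of_norm_le_const (a := 0) (b := x)
        (f := fun t => deriv g t * (Complex.exp (κ * t + κ₀) / κ)) (C := G' / ‖κ‖) (fun t ht => by
          rw [uIoc_of_le hx.1] at ht
          rw [norm_mul, norm_div, ← mul_div_assoc]
          gcongr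
          exact (mul_le_of_le_one_right (norm_nonneg _) (hexp t ⟨ht.1.le, ht.2⟩)).trans
            (hGt' t ⟨ht.1.le, ht.2.trans hx.2⟩))
      refine this.trans ?_
      rw [sub_zero, abs_of_nonneg hx.1, mul_comm]
      gcongr
      exact hx.2
    have n1 := hb x ⟨hx.1, le_rfl⟩
    have n2 := hb 0 ⟨le_rfl, hx.1⟩
    refine (norm_sub_le _ _).trans ((add_le_add ((norm_sub_le _ _).trans (add_le_add n1 n2))
      hi).trans ?_)
    rw [div_le_iff₀ (half_pos hε)] at hκ
    rw [show G / ‖κ‖ + G / ‖κ‖ + Real.pi * (G' / ‖κ‖) = (2 * G + Real.pi * G') / ‖κ‖ by ring,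
      div_le_iff₀ hκpos]
    linarith
  rw [hsplit]
  exact (norm_add_le _ _).trans (by linarith)

theorem exists_osc_le (hσ : MemLp σ 2 (volume.restrict (Ioo 0 Real.pi))) {ε : ℝ} (hε : 0 < ε) :
    ∃ R : ℝ, 0 < R ∧ ∀ ρ : ℂ, R ≤ ‖ρ‖ → 0 ≤ ρ.im → ∀ x ∈ Icc 0 Real.pi, osc σ ρ x ≤ ε := by
  obtain ⟨R, hR, h⟩ := exists_norm_integral_mul_exp_le (intervalIntegrable_sigma hσ) (half_pos hε)
  refine ⟨R, hR, fun ρ hρ hρi x hx => ?_⟩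
  have h1 := h x hx (2 * I * ρ) 0 (by simp; linarith [norm_nonneg ρ]) fun t ht => by
    rw [add_zero]; exact norm_exp_two_I_mul_le_one hρi ht.1
  have h2 := h x hx (-(2 * I * ρ)) (2 * I * ρ * x) (by simp; linarith [norm_nonneg ρ])
    fun t ht => by
      have := norm_exp_two_I_mul_le_one hρi (sub_nonneg.2 ht.2)
      convert this using 3
      push_cast
      ring
  simp only [add_zero] at h1
  have h3 : ∫ t in 0..x, Complex.exp (2 * I * ρ * (x - t)) * σ t =
      ∫ t in 0..x, σ t * Complex.exp (-(2 * I * ρ) * t + 2 * I * ρ * x) := by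
    refine intervalIntegral.integral_congr fun t _ => ?_
    rw [mul_comm]
    ring_nf
  rw [osc, h3]
  linarith

theorem sum_sq_norm_integral_mul_exp_le {f : ℝ → ℂ} (hf : MemLp f 2 (volume.restrict (Ioc 0 Real.pi)))
    (F : Finset ℤ) :
    ∑ n ∈ F, ‖∫ t in 0..Real.pi, f t * Complex.exp (2 * I * n * t)‖ ^ 2 ≤
      Real.pi * ∫ t in 0..Real.pi, ‖f t‖ ^ 2 := by
  have h := hasSum_sq_fourierCoeffOn Real.pi_pos hf
  have h1 : ∀ n : ℤ, ‖∫ t in 0..Real.pi, f t * Complex.exp (2 * I * n * t)‖ ^ 2 =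
      Real.pi ^ 2 * ‖fourierCoeffOn Real.pi_pos f (-n)‖ ^ 2 := fun n => by
    rw [fourierCoeffOn_eq_integral, norm_smul, mul_pow, ← mul_assoc]
    have hp : Real.pi ^ 2 * ‖1 / (Real.pi - 0)‖ ^ 2 = 1 := by
      rw [sub_zero, norm_div, norm_one, Real.norm_of_nonneg Real.pi_nonneg]
      field_simp
    rw [hp, one_mul]
    congr 2
    refine intervalIntegral.integral_congr fun t _ => ?_
    simp only [neg_neg, fourier_coe_apply, smul_eq_mul]
    rw [mul_comm]
    congr 2
    have : (Real.pi : ℂ) ≠ 0 := by exact_mod_cast Real.pi_ne_zero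
    push_cast
    rw [sub_zero]
    field_simp
  simp_rw [h1]
  rw [← Finset.mul_sum]
  have h2 : ∑ n ∈ F, ‖fourierCoeffOn Real.pi_pos f (-n)‖ ^ 2 ≤
      (Real.pi - 0)⁻¹ • ∫ x in 0..Real.pi, ‖f x‖ ^ 2 := by
    rw [← h.tsum_eq]
    have hneg := (Equiv.neg ℤ).summable_iff.2 h.summable
    have hts := (Equiv.neg ℤ).tsum_eq (fun i => ‖fourierCoeffOn Real.pi_pos f i‖ ^ 2)
    rw [← hts]
    exact hneg.sum_le_tsum F fun _ _ => by positivity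
  rw [smul_eq_mul, sub_zero] at h2
  calc _ ≤ Real.pi ^ 2 * (Real.pi⁻¹ * ∫ x in 0..Real.pi, ‖f x‖ ^ 2) := by gcongr
    _ = _ := by field_simp

end SturmLiouville

end

/-! ### Bessel's inequality for perturbed frequencies. -/

noncomputable section

namespace SturmLiouville

open Complex (I)

variable {σ : ℝ → ℂ} {ρ : ℂ}

/-- Expands e^{2iδt} in powers of δ. The variable is normalised to t/π ∈ [0, 1], so that multiplying
f by its powers does not increase the L₂ norm. -/
theorem hasSum_integral_mul_exp {f : ℝ → ℂ} (hf : IntervalIntegrable f volume 0 Real.pi)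
    (n δ : ℂ) :
    HasSum (fun j : ℕ => (2 * I * δ * Real.pi) ^ j / (j ! : ℂ) *
        ∫ t in 0..Real.pi, f t * ((t / Real.pi : ℝ) : ℂ) ^ j * Complex.exp (2 * I * n * t))
      (∫ t in 0..Real.pi, f t * Complex.exp (2 * I * (n + δ) * t)) := by
  have hE : Continuous fun t : ℝ => Complex.exp (2 * I * n * t) := by fun_prop
  have hfE : IntervalIntegrable (fun t => f t * Complex.exp (2 * I * n * t)) volume 0 Real.pi :=
    hf.mul_continuousOn hE.continuousOn
  have hpi : (Real.pi : ℂ) ≠ 0 := by exact_mod_cast Real.pi_ne_zero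
  have hs : ∀ t : ℝ, HasSum (fun j : ℕ => f t * Complex.exp (2 * I * n * t) *
      ((2 * I * δ * t) ^ j / (j ! : ℂ))) (f t * Complex.exp (2 * I * (n + δ) * t)) := fun t => by
    have h := (NormedSpace.expSeries_div_hasSum_exp (𝔸 := ℂ) (2 * I * δ * t)).mul_left
      (f t * Complex.exp (2 * I * n * t))
    rw [← Complex.exp_eq_exp_ℂ, mul_assoc (f t), ← Complex.exp_add,
      show 2 * I * n * (t : ℂ) + 2 * I * δ * t = 2 * I * (n + δ) * t by ring] at h
    exact h
  have h := intervalIntegral.hasSum_integral_of_dominated_convergence (μ := volume) (a := 0)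
    (b := Real.pi) (F := fun (j : ℕ) t => f t * Complex.exp (2 * I * n * t) *
      ((2 * I * δ * t) ^ j / (j ! : ℂ)))
    (f := fun t => f t * Complex.exp (2 * I * (n + δ) * t))
    (fun j t => ‖f t * Complex.exp (2 * I * n * t)‖ * ((2 * ‖δ‖ * Real.pi) ^ j / (j ! : ℝ)))
    (fun j => (hfE.mul_continuousOn (Continuous.continuousOn
      (by fun_prop))).aestronglyMeasurable_restrict_uIoc)
    (fun j => ae_of_all _ fun t ht => by
      rw [uIoc_of_le Real.pi_nonneg] at ht
      rw [norm_mul, norm_div, norm_pow]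
      have : ‖2 * I * δ * (t : ℂ)‖ ≤ 2 * ‖δ‖ * Real.pi := by
        simp only [norm_mul, Complex.norm_ofNat, Complex.norm_I, mul_one, Complex.norm_real,
          Real.norm_of_nonneg ht.1.le]
        gcongr
        exact ht.2
      simp only [Complex.norm_natCast]
      gcongr)
    (ae_of_all _ fun t _ => (Real.summable_pow_div_factorial _).mul_left _)
    (by
      simp_rw [tsum_mul_left]
      exact hfE.norm.mul_const _)
    (ae_of_all _ fun t _ => hs t)
  have heq : (fun j : ℕ => (2 * I * δ * Real.pi) ^ j / (j ! : ℂ) *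
        ∫ t in 0..Real.pi, f t * ((t / Real.pi : ℝ) : ℂ) ^ j * Complex.exp (2 * I * n * t)) =
      fun j : ℕ => ∫ t in 0..Real.pi, f t * Complex.exp (2 * I * n * t) *
        ((2 * I * δ * t) ^ j / (j ! : ℂ)) := by
    funext j
    rw [← intervalIntegral.integral_const_mul]
    refine intervalIntegral.integral_congr fun t _ => ?_
    push_cast
    rw [div_pow, mul_pow (2 * I * δ) (t : ℂ), mul_pow (2 * I * δ) (Real.pi : ℂ)]
    field_simp
  rw [heq]
  exact h

/-- Bessel's inequality for exponentials whose frequencies are a bounded perturbation of the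
integers. -/
theorem sum_sq_norm_integral_mul_exp_add_le {f : ℝ → ℂ}
    (hf : MemLp f 2 (volume.restrict (Ioc 0 Real.pi))) {B : ℝ} (F : Finset ℤ)
    (δ : ℤ → ℂ) (hδ : ∀ n ∈ F, ‖δ n‖ ≤ B) :
    ∑ n ∈ F, ‖∫ t in 0..Real.pi, f t * Complex.exp (2 * I * (n + δ n) * t)‖ ^ 2 ≤
      Real.exp (2 * B * Real.pi) ^ 2 * (Real.pi * ∫ t in 0..Real.pi, ‖f t‖ ^ 2) := by
  rcases F.eq_empty_or_nonempty with rfl | ⟨n₀, hn₀⟩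
  · have : 0 ≤ ∫ t in 0..Real.pi, ‖f t‖ ^ 2 :=
      intervalIntegral.integral_nonneg Real.pi_nonneg fun _ _ => by positivity
    simp only [Finset.sum_empty]
    positivity
  have hB : 0 ≤ B := (norm_nonneg _).trans (hδ n₀ hn₀)
  set S := ∫ t in 0..Real.pi, ‖f t‖ ^ 2 with hS
  have hS0 : 0 ≤ S := intervalIntegral.integral_nonneg Real.pi_nonneg fun _ _ => by positivity
  have hfi : IntervalIntegrable f volume 0 Real.pi := by
    rw [intervalIntegrable_iff_integrableOn_Ioc_of_le Real.pi_nonneg]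
    exact hf.integrable (by norm_num)
  -- The j-th term of the power series, regarded as a vector indexed by the frequencies. Bessel's
  -- inequality for integer frequencies bounds each vector, and the triangle inequality in ℓ₂ sums
  -- the bounds to the factor exp(2Bπ).
  set v : ℕ → EuclideanSpace ℂ F := fun j => WithLp.toLp 2 fun n =>
    (2 * I * δ n * Real.pi) ^ j / (j ! : ℂ) *
        ∫ t in 0..Real.pi, f t * ((t / Real.pi : ℝ) : ℂ) ^ j *
          Complex.exp (2 * I * ((n : ℤ) : ℂ) * t) with hv
  set G : EuclideanSpace ℂ F := WithLp.toLp 2 fun n =>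
    ∫ t in 0..Real.pi, f t * Complex.exp (2 * I * (((n : ℤ) : ℂ) + δ n) * t) with hG
  have hsum : HasSum v G := by
    have h : HasSum (fun j => WithLp.ofLp (v j)) (WithLp.ofLp G) :=
      Pi.hasSum.2 fun n => hasSum_integral_mul_exp hfi _ _
    exact h.mapL ((PiLp.continuousLinearEquiv 2 ℂ (fun _ : F => ℂ)).symm :
      (F → ℂ) →L[ℂ] EuclideanSpace ℂ F)
  have hvj : ∀ j, ‖v j‖ ≤ (2 * B * Real.pi) ^ j / (j ! : ℝ) * √(Real.pi * S) := by
    intro j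
    have hfj : MemLp (fun t => f t * ((t / Real.pi : ℝ) : ℂ) ^ j) 2
        (volume.restrict (Ioc 0 Real.pi)) := by
      refine hf.mono (hf.1.mul (Continuous.aestronglyMeasurable (by fun_prop))) ?_
      rw [ae_restrict_iff' measurableSet_Ioc]
      refine Eventually.of_forall fun t ht => ?_
      rw [norm_mul, norm_pow, Complex.norm_real, Real.norm_of_nonneg (by have := ht.1; positivity)]
      exact mul_le_of_le_one_right (norm_nonneg _) (pow_le_one₀ (by have := ht.1; positivity)
        ((div_le_one Real.pi_pos).2 ht.2))
    have hb := sum_sq_norm_integral_mul_exp_le hfj F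
    have hle : ∫ t in 0..Real.pi, ‖f t * ((t / Real.pi : ℝ) : ℂ) ^ j‖ ^ 2 ≤ S := by
      rw [hS, intervalIntegral.integral_of_le Real.pi_nonneg,
        intervalIntegral.integral_of_le Real.pi_nonneg]
      refine setIntegral_mono_on hfj.integrable_norm_pow' hf.integrable_norm_pow' measurableSet_Ioc
        fun t ht => ?_
      gcongr
      rw [norm_mul, norm_pow, Complex.norm_real, Real.norm_of_nonneg (by have := ht.1; positivity)]
      exact mul_le_of_le_one_right (norm_nonneg _) (pow_le_one₀ (by have := ht.1; positivity)
        ((div_le_one Real.pi_pos).2 ht.2))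
    refine (sq_le_sq₀ (norm_nonneg _) (by positivity)).1 ?_
    rw [mul_pow, Real.sq_sqrt (by positivity), EuclideanSpace.norm_sq_eq]
    calc ∑ i, ‖(v j).ofLp i‖ ^ 2 ≤ ∑ i : F, ((2 * B * Real.pi) ^ j / (j ! : ℝ)) ^ 2 *
          ‖∫ t in 0..Real.pi, f t * ((t / Real.pi : ℝ) : ℂ) ^ j *
            Complex.exp (2 * I * ((i : ℤ) : ℂ) * t)‖ ^ 2 := by
          refine Finset.sum_le_sum fun i _ => ?_
          simp only [hv]
          rw [norm_mul, mul_pow, norm_div, norm_pow]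
          have := hδ i i.2
          have : ‖2 * I * δ i * (Real.pi : ℂ)‖ ≤ 2 * B * Real.pi := by
            simp only [norm_mul, Complex.norm_ofNat, Complex.norm_I, mul_one, Complex.norm_real,
              Real.norm_of_nonneg Real.pi_nonneg]
            gcongr
          simp only [Complex.norm_natCast]
          gcongr
      _ = ((2 * B * Real.pi) ^ j / (j ! : ℝ)) ^ 2 * ∑ i ∈ F,
          ‖∫ t in 0..Real.pi, f t * ((t / Real.pi : ℝ) : ℂ) ^ j *
            Complex.exp (2 * I * (i : ℂ) * t)‖ ^ 2 := by
          rw [← Finset.mul_sum, ← Finset.sum_coe_sort F]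
      _ ≤ ((2 * B * Real.pi) ^ j / (j ! : ℝ)) ^ 2 * (Real.pi * S) := by
          gcongr
          exact hb.trans (by gcongr)
  have hexp : HasSum (fun j : ℕ => (2 * B * Real.pi) ^ j / (j ! : ℝ) * √(Real.pi * S))
      (Real.exp (2 * B * Real.pi) * √(Real.pi * S)) := by
    rw [Real.exp_eq_exp_ℝ]
    exact (NormedSpace.expSeries_div_hasSum_exp (2 * B * Real.pi)).mul_right _
  have hn := hsum.norm_le_of_bounded hexp hvj
  have hsq := pow_le_pow_left₀ (norm_nonneg _) hn 2
  rw [mul_pow, Real.sq_sqrt (by positivity), EuclideanSpace.norm_sq_eq] at hsq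
  refine le_trans (le_of_eq ?_) hsq
  rw [← Finset.sum_coe_sort F]

theorem integral_eq_integral_indicator {f g : ℝ → ℂ} {x : ℝ} (hx : x ∈ Icc 0 Real.pi) :
    ∫ t in 0..x, f t * g t = ∫ t in 0..Real.pi, (Ioc 0 x).indicator f t * g t := by
  rw [intervalIntegral.integral_of_le hx.1, intervalIntegral.integral_of_le Real.pi_nonneg]
  simp_rw [← indicator_mul_left]
  rw [setIntegral_indicator measurableSet_Ioc]
  congr 2
  exact (inter_eq_self_of_subset_right (Ioc_subset_Ioc_right hx.2)).symm

/-- The frequency-symmetric majorant of `osc`. -/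
def oscSym (σ : ℝ → ℂ) (ρ : ℂ) (x : ℝ) : ℝ :=
  ‖∫ t in 0..x, σ t * Complex.exp (2 * I * ρ * t)‖ +
    ‖∫ t in 0..x, σ t * Complex.exp (2 * I * (-ρ) * t)‖

theorem oscSym_neg (σ : ℝ → ℂ) (ρ : ℂ) (x : ℝ) : oscSym σ (-ρ) x = oscSym σ ρ x := by
  rw [oscSym, oscSym, neg_neg, add_comm]

theorem osc_le_oscSym {x : ℝ} (hx : 0 ≤ x) (hρ : 0 ≤ ρ.im) : osc σ ρ x ≤ oscSym σ ρ x := by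
  rw [osc, oscSym, integral_exp_sub_mul, norm_mul]
  gcongr
  exact mul_le_of_le_one_left (norm_nonneg _) (norm_exp_two_I_mul_le_one hρ hx)

/-- Square summability of the oscillatory integrals, uniformly in `x` and in the frequencies. -/
theorem exists_sum_sq_oscSym_le (hσ : MemLp σ 2 (volume.restrict (Ioo 0 Real.pi))) (B : ℝ) :
    ∃ C : ℝ, 0 < C ∧ ∀ (F : Finset ℕ) (ρ : ℕ → ℂ), (∀ n ∈ F, ‖ρ n - n‖ ≤ B) →
      ∀ x ∈ Icc 0 Real.pi, ∑ n ∈ F, oscSym σ (ρ n) x ^ 2 ≤ C := by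
  have hσ' := memLp_Ioc hσ
  set S := ∫ t in 0..Real.pi, ‖σ t‖ ^ 2 with hS
  have hS0 : 0 ≤ S := intervalIntegral.integral_nonneg Real.pi_nonneg fun _ _ => by positivity
  refine ⟨4 * (Real.exp (2 * B * Real.pi) ^ 2 * (Real.pi * S)) + 1, by positivity,
    fun F ρ hρ x hx => ?_⟩
  have hf : MemLp ((Ioc 0 x).indicator σ) 2 (volume.restrict (Ioc 0 Real.pi)) :=
    hσ'.indicator measurableSet_Ioc
  have hfS : ∫ t in 0..Real.pi, ‖(Ioc 0 x).indicator σ t‖ ^ 2 ≤ S := by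
    rw [hS, intervalIntegral.integral_of_le Real.pi_nonneg,
        intervalIntegral.integral_of_le Real.pi_nonneg]
    refine integral_mono hf.integrable_norm_pow' hσ'.integrable_norm_pow' fun t => ?_
    beta_reduce
    gcongr
    exact norm_indicator_le_norm_self _ _
  -- Both signs of the frequency are treated at once: sρ_n is close to the integer sn, and n is
  -- recovered from k = sn as sk because s² = 1. Truncating σ to (0, x] turns the integral to x into
  -- one over the whole interval.
  have key : ∀ s : ℤ, s = 1 ∨ s = -1 → ∑ n ∈ F, ‖∫ t in 0..x, σ t *
      Complex.exp (2 * I * (s * ρ n) * t)‖ ^ 2 ≤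
        Real.exp (2 * B * Real.pi) ^ 2 * (Real.pi * S) := by
    intro s hs
    have hs2 : s * s = 1 := by rcases hs with rfl | rfl <;> norm_num
    have hs2' : (s : ℂ) * s = 1 := by exact_mod_cast hs2
    have hsn : ‖(s : ℂ)‖ = 1 := by rcases hs with rfl | rfl <;> norm_num
    have hinj : Function.Injective (fun n : ℕ => s * (n : ℤ)) := fun a b hab => by
      have := congrArg (fun z => s * z) hab
      simp only [← mul_assoc, hs2, one_mul] at this
      exact_mod_cast this
    have h := sum_sq_norm_integral_mul_exp_add_le hf (B := B) (F.map ⟨_, hinj⟩)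
      (fun k => s * (ρ (s * k).toNat - (s * k).toNat)) (by
        intro n hn
        obtain ⟨m, hm, rfl⟩ := Finset.mem_map.1 hn
        simp only [Function.Embedding.coeFn_mk, ← mul_assoc, hs2, one_mul, Int.toNat_natCast,
          norm_mul, hsn]
        exact hρ m hm)
    rw [Finset.sum_map] at h
    refine le_trans (le_of_eq ?_) (h.trans (by gcongr))
    refine Finset.sum_congr rfl fun n _ => ?_
    rw [integral_eq_integral_indicator hx]
    congr 2
    refine intervalIntegral.integral_congr fun t _ => ?_
    simp only [Function.Embedding.coeFn_mk, ← mul_assoc, hs2, one_mul, Int.toNat_natCast]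
    congr 2
    push_cast
    ring
  have k1 := key 1 (Or.inl rfl)
  have k2 := key (-1) (Or.inr rfl)
  simp only [Int.cast_one, one_mul, Int.cast_neg, neg_mul] at k1 k2
  have hterm : ∀ n ∈ F, oscSym σ (ρ n) x ^ 2 ≤
      2 * ‖∫ t in 0..x, σ t * Complex.exp (2 * I * ρ n * t)‖ ^ 2 +
      2 * ‖∫ t in 0..x, σ t * Complex.exp (2 * I * -ρ n * t)‖ ^ 2 := fun n _ => by
    rw [oscSym]
    nlinarith [sq_nonneg (‖∫ t in 0..x, σ t * Complex.exp (2 * I * ρ n * t)‖ -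
      ‖∫ t in 0..x, σ t * Complex.exp (2 * I * -ρ n * t)‖)]
  refine (Finset.sum_le_sum hterm).trans ?_
  rw [Finset.sum_add_distrib, ← Finset.mul_sum, ← Finset.mul_sum]
  linarith

end SturmLiouville

end

/-! ### The error term of the asymptotics and its square summability. -/

noncomputable section

namespace SturmLiouville

open Complex (I)

variable {σ : ℝ → ℂ} {ρ : ℂ}

/-- The weighted Cauchy–Schwarz inequality, from the nonnegativity of ∫a(o − m)² at m = J/(A + 1).
Using A + 1 in place of A spares the case of zero total mass. -/
theorem sq_integral_mul_le {a o : ℝ → ℝ} {b : ℝ} (hb : 0 ≤ b)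
    (ha : IntervalIntegrable a volume 0 b) (ha0 : ∀ t, 0 ≤ a t) (ho : ContinuousOn o (Icc 0 b)) :
    (∫ t in 0..b, a t * o t) ^ 2 ≤ ((∫ t in 0..b, a t) + 1) * ∫ t in 0..b, a t * o t ^ 2 := by
  rw [← uIcc_of_le hb] at ho
  set A := ∫ t in 0..b, a t
  set J := ∫ t in 0..b, a t * o t with hJ
  set K := ∫ t in 0..b, a t * o t ^ 2 with hK
  have hA : 0 ≤ A := intervalIntegral.integral_nonneg hb fun _ _ => ha0 _
  have h1 : IntervalIntegrable (fun t => a t * o t) volume 0 b := ha.mul_continuousOn ho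
  have h2 : IntervalIntegrable (fun t => a t * o t ^ 2) volume 0 b :=
    ha.mul_continuousOn (ho.pow 2)
  have hm : ∀ m : ℝ, 0 ≤ K - 2 * m * J + m ^ 2 * A := fun m => by
    have h0 : 0 ≤ ∫ t in 0..b, a t * (o t - m) ^ 2 :=
      intervalIntegral.integral_nonneg hb fun t _ => mul_nonneg (ha0 t) (sq_nonneg _)
    have : ∫ t in 0..b, a t * (o t - m) ^ 2 =
        ∫ t in 0..b, (a t * o t ^ 2 - 2 * m * (a t * o t) + m ^ 2 * a t) :=
      intervalIntegral.integral_congr fun t _ => by ring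
    rw [this, intervalIntegral.integral_add (h2.sub (h1.const_mul _)) (ha.const_mul _),
      intervalIntegral.integral_sub h2 (h1.const_mul _), intervalIntegral.integral_const_mul,
      intervalIntegral.integral_const_mul] at h0
    exact h0
  have h := hm (J / (A + 1))
  have hA1 : 0 < A + 1 := by linarith
  have h3 : K - 2 * (J / (A + 1)) * J + (J / (A + 1)) ^ 2 * A =
      (K * (A + 1) - J ^ 2) / (A + 1) - J ^ 2 / (A + 1) ^ 2 := by
    field_simp
    ring
  rw [h3] at h
  have h4 : 0 ≤ (K * (A + 1) - J ^ 2) / (A + 1) := by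
    have : 0 ≤ J ^ 2 / (A + 1) ^ 2 := by positivity
    linarith
  have h5 := mul_nonneg h4 hA1.le
  rw [div_mul_cancel₀ _ hA1.ne'] at h5
  linarith

/-- The representative of `±ρ` in the closed upper half-plane. -/
def upper (ρ : ℂ) : ℂ := if 0 ≤ ρ.im then ρ else -ρ

theorem upper_im (ρ : ℂ) : (upper ρ).im = |ρ.im| := by
  unfold upper
  split_ifs with h
  · rw [abs_of_nonneg h]
  · rw [abs_of_neg (not_le.1 h)]; simp

theorem upper_im_nonneg (ρ : ℂ) : 0 ≤ (upper ρ).im := by rw [upper_im]; positivity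

theorem norm_upper (ρ : ℂ) : ‖upper ρ‖ = ‖ρ‖ := by
  unfold upper; split_ifs <;> simp

theorem upper_eq_or (ρ : ℂ) : upper ρ = ρ ∨ upper ρ = -ρ := by
  unfold upper; split_ifs <;> simp

/-- The error term in the asymptotics of `φ(x, ρ²)`. -/
def err (σ : ℝ → ℂ) (ρ : ℂ) (x : ℝ) : ℝ :=
  osc σ (upper ρ) x + 1 / ‖ρ‖ + ∫ t in 0..Real.pi, ‖σ t‖ * osc σ (upper ρ) t

theorem integral_norm_mul_osc_nonneg (σ : ℝ → ℂ) (ρ : ℂ) :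
    0 ≤ ∫ t in 0..Real.pi, ‖σ t‖ * osc σ ρ t :=
  intervalIntegral.integral_nonneg Real.pi_nonneg fun _ _ =>
    mul_nonneg (norm_nonneg _) (osc_nonneg _ _ _)

theorem one_div_norm_le_err (σ : ℝ → ℂ) (ρ : ℂ) (x : ℝ) : 1 / ‖ρ‖ ≤ err σ ρ x := by
  have h1 := osc_nonneg σ (upper ρ) x
  have h2 := integral_norm_mul_osc_nonneg σ (upper ρ)
  unfold err; linarith

theorem err_nonneg (σ : ℝ → ℂ) (ρ : ℂ) (x : ℝ) : 0 ≤ err σ ρ x :=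
  le_trans (by positivity) (one_div_norm_le_err σ ρ x)

theorem exists_err_le (hσ : MemLp σ 2 (volume.restrict (Ioo 0 Real.pi))) {ε : ℝ} (hε : 0 < ε) :
    ∃ R : ℝ, 1 ≤ R ∧ ∀ ρ : ℂ, R ≤ ‖ρ‖ → ∀ x ∈ Icc 0 Real.pi, err σ ρ x ≤ ε := by
  set A := ∫ t in 0..Real.pi, ‖σ t‖
  have hA : 0 ≤ A := intervalIntegral.integral_nonneg Real.pi_nonneg fun _ _ => norm_nonneg _
  obtain ⟨R, hR, h⟩ := exists_osc_le hσ (ε := ε / (A + 2)) (by positivity)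
  refine ⟨max (max R 1) ((A + 2) / ε), le_max_of_le_left (le_max_right _ _), fun ρ hρ x hx => ?_⟩
  have hρ1 : 1 ≤ ‖ρ‖ := le_trans (le_max_of_le_left (le_max_right _ _)) hρ
  have ho : ∀ t ∈ Icc 0 Real.pi, osc σ (upper ρ) t ≤ ε / (A + 2) := fun t ht =>
    h _ (by rw [norm_upper]; exact le_trans (le_max_of_le_left (le_max_left _ _)) hρ)
      (upper_im_nonneg ρ) t ht
  have h1 : 1 / ‖ρ‖ ≤ ε / (A + 2) := by
    have := le_trans (le_max_right _ _) hρ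
    rw [div_le_div_iff₀ (by linarith) (by linarith)]
    rw [div_le_iff₀ hε] at this
    linarith
  have h2 : ∫ t in 0..Real.pi, ‖σ t‖ * osc σ (upper ρ) t ≤ A * (ε / (A + 2)) := by
    rw [← intervalIntegral.integral_mul_const]
    have hs := (intervalIntegrable_sigma hσ).norm
    refine intervalIntegral.integral_mono_on Real.pi_nonneg (hs.mul_continuousOn ?_)
      (hs.mul_const _) fun t ht => mul_le_mul_of_nonneg_left (ho t ht) (norm_nonneg _)
    rw [uIcc_of_le Real.pi_nonneg]
    exact continuousOn_osc hσ _
  have h3 : ε / (A + 2) + ε / (A + 2) + A * (ε / (A + 2)) = ε := by field_simp; ring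
  have h4 := ho x hx
  unfold err
  linarith

/-- Each of the three summands of `err` is square summable: `osc` by Bessel's inequality, 1/|ρ_n| by
comparison with 1/(n + 1), and the averaged term by Cauchy–Schwarz, since the Bessel bound is
uniform in the integration point. -/
theorem exists_sum_sq_err_le (hσ : MemLp σ 2 (volume.restrict (Ioo 0 Real.pi))) (B : ℝ) :
    ∃ C : ℝ, 0 < C ∧ ∀ (F : Finset ℕ) (ρ : ℕ → ℂ),
      (∀ n ∈ F, ‖ρ n - n‖ ≤ B ∧ 1 ≤ ‖ρ n‖) →
      ∀ x ∈ Icc 0 Real.pi, ∑ n ∈ F, err σ (ρ n) x ^ 2 ≤ C := by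
  obtain ⟨C, hC, h⟩ := exists_sum_sq_oscSym_le hσ B
  set A := ∫ t in 0..Real.pi, ‖σ t‖ with hAdef
  have hA : 0 ≤ A := intervalIntegral.integral_nonneg Real.pi_nonneg fun _ _ => norm_nonneg _
  have hsummable : Summable fun n : ℕ => 1 / ((n : ℝ) + 1) ^ 2 := by
    have := (summable_nat_add_iff 1).2 (Real.summable_one_div_nat_pow.2 (one_lt_two))
    simpa using this
  set T := ∑' n : ℕ, 1 / ((n : ℝ) + 1) ^ 2 with hT
  have hT0 : 0 ≤ T := tsum_nonneg fun n => by positivity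
  refine ⟨3 * (C + (B + 2) ^ 2 * T + (A + 1) * (A * C)) + 1, by positivity, fun F ρ hρ x hx => ?_⟩
  have hosc : ∀ t ∈ Icc 0 Real.pi, ∀ n, osc σ (upper (ρ n)) t ≤ oscSym σ (ρ n) t := fun t ht n => by
    refine (osc_le_oscSym ht.1 (upper_im_nonneg _)).trans (le_of_eq ?_)
    rcases upper_eq_or (ρ n) with h | h <;> rw [h]
    exact oscSym_neg _ _ _
  have hS : ∀ t ∈ Icc 0 Real.pi, ∑ n ∈ F, osc σ (upper (ρ n)) t ^ 2 ≤ C := fun t ht =>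
    (Finset.sum_le_sum fun n _ => pow_le_pow_left₀ (osc_nonneg _ _ _) (hosc t ht n) 2).trans
      (h F ρ (fun n hn => (hρ n hn).1) t ht)
  have h2 : ∑ n ∈ F, (1 / ‖ρ n‖) ^ 2 ≤ (B + 2) ^ 2 * T := by
    have hle : ∀ n ∈ F, (1 / ‖ρ n‖) ^ 2 ≤ (B + 2) ^ 2 * (1 / ((n : ℝ) + 1) ^ 2) := fun n hn => by
      obtain ⟨h1, h2⟩ := hρ n hn
      have hB := (norm_nonneg _).trans h1
      have h3 : (n : ℝ) ≤ ‖ρ n‖ + B := by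
        have := norm_sub_norm_le (n : ℂ) (ρ n)
        rw [Complex.norm_natCast, norm_sub_rev] at this
        linarith
      have h4 : (n : ℝ) + 1 ≤ (B + 2) * ‖ρ n‖ := by nlinarith
      rw [← one_div_pow, ← mul_pow]
      refine pow_le_pow_left₀ (by positivity) ?_ 2
      rw [mul_one_div, div_le_div_iff₀ (by linarith) (by positivity)]
      linarith
    refine (Finset.sum_le_sum hle).trans ?_
    rw [← Finset.mul_sum]
    gcongr
    exact hsummable.sum_le_tsum F fun n _ => by positivity
  have hs := (intervalIntegrable_sigma hσ).norm
  have hint : ∀ n, IntervalIntegrable (fun t => ‖σ t‖ * osc σ (upper (ρ n)) t ^ 2) volume 0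
      Real.pi := fun n => by
    refine hs.mul_continuousOn ?_
    rw [uIcc_of_le Real.pi_nonneg]
    exact (continuousOn_osc hσ _).pow 2
  have h3 : ∑ n ∈ F, (∫ t in 0..Real.pi, ‖σ t‖ * osc σ (upper (ρ n)) t) ^ 2 ≤
      (A + 1) * (A * C) := by
    refine (Finset.sum_le_sum fun n _ => sq_integral_mul_le Real.pi_nonneg hs
      (fun _ => norm_nonneg _) (continuousOn_osc hσ _)).trans ?_
    rw [← Finset.mul_sum]
    gcongr
    rw [← intervalIntegral.integral_finsetSum fun n _ => hint n, hAdef,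
      ← intervalIntegral.integral_mul_const]
    refine intervalIntegral.integral_mono_on Real.pi_nonneg ?_ (hs.mul_const _) fun t ht => ?_
    · have := IntervalIntegrable.sum F fun n _ => hint n
      exact this.congr (by intro t _; simp)
    · rw [← Finset.mul_sum]
      exact mul_le_mul_of_nonneg_left (hS t ht) (norm_nonneg _)
  have hterm : ∀ n ∈ F, err σ (ρ n) x ^ 2 ≤ 3 * osc σ (upper (ρ n)) x ^ 2 + 3 * (1 / ‖ρ n‖) ^ 2 +
      3 * (∫ t in 0..Real.pi, ‖σ t‖ * osc σ (upper (ρ n)) t) ^ 2 := fun n _ => by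
    unfold err
    nlinarith [sq_nonneg (osc σ (upper (ρ n)) x - 1 / ‖ρ n‖),
      sq_nonneg (osc σ (upper (ρ n)) x - ∫ t in 0..Real.pi, ‖σ t‖ * osc σ (upper (ρ n)) t),
      sq_nonneg (1 / ‖ρ n‖ - ∫ t in 0..Real.pi, ‖σ t‖ * osc σ (upper (ρ n)) t)]
  refine (Finset.sum_le_sum hterm).trans ?_
  rw [Finset.sum_add_distrib, Finset.sum_add_distrib, ← Finset.mul_sum, ← Finset.mul_sum,
    ← Finset.mul_sum]
  linarith [hS x hx]

/-- The solution, cos ρx and ρ sin ρx are even in ρ, so the estimate in the upper half-plane extends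
to all ρ through `upper`. -/
theorem exists_norm_solution_sub_le_err (hσ : MemLp σ 2 (volume.restrict (Ioo 0 Real.pi))) :
    ∃ C : ℝ, 0 < C ∧ ∀ (ρ : ℂ), 1 ≤ ‖ρ‖ → ∀ x ∈ Icc 0 Real.pi,
      ‖(solution σ (ρ ^ 2) 0 (1, 0) x).1 - Complex.cos (ρ * x)‖ ≤
        C * Real.exp (|ρ.im| * x) * err σ ρ x ∧
      ‖(solution σ (ρ ^ 2) 0 (1, 0) x).2 + ρ * Complex.sin (ρ * x)‖ ≤
        C * ‖ρ‖ * Real.exp (|ρ.im| * x) * err σ ρ x := by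
  obtain ⟨C, hC, h⟩ := exists_norm_solution_sub_le hσ
  refine ⟨C, hC, fun ρ hρ x hx => ?_⟩
  obtain ⟨h1, h2⟩ := h (upper ρ) (by rwa [norm_upper]) (upper_im_nonneg ρ) x hx
  rw [upper_im, norm_upper] at h1 h2
  have hsq : upper ρ ^ 2 = ρ ^ 2 := by rcases upper_eq_or ρ with h | h <;> rw [h]; ring
  have hcos : Complex.cos (upper ρ * x) = Complex.cos (ρ * x) := by
    rcases upper_eq_or ρ with h | h <;> rw [h]
    rw [neg_mul, Complex.cos_neg]
  have hsin : upper ρ * Complex.sin (upper ρ * x) = ρ * Complex.sin (ρ * x) := by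
    rcases upper_eq_or ρ with h | h <;> rw [h]
    rw [neg_mul ρ (x : ℂ), Complex.sin_neg, neg_mul_neg]
  rw [hsq, hcos] at h1
  rw [hsq, hsin] at h2
  unfold err
  exact ⟨h1.trans (le_of_eq (by ring)), h2.trans (le_of_eq (by ring))⟩

end SturmLiouville

end

/-! ### Bounds for sine and cosine; asymptotics of φ and ψ. -/

noncomputable section

namespace SturmLiouville

open Complex (I)

theorem sq_norm_sin (w : ℂ) :
    ‖Complex.sin w‖ ^ 2 = Real.sin w.re ^ 2 + Real.sinh w.im ^ 2 := by
  rw [← Complex.normSq_eq_norm_sq, Complex.normSq_apply, Complex.sin_eq]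
  simp only [← Complex.ofReal_sin, ← Complex.ofReal_cosh, ← Complex.ofReal_cos,
    ← Complex.ofReal_sinh, Complex.add_re, Complex.mul_re, Complex.ofReal_re, Complex.ofReal_im,
    Complex.add_im, Complex.mul_im, Complex.I_re, Complex.I_im]
  have h1 := Real.sin_sq_add_cos_sq w.re
  have h2 := Real.cosh_sq w.im
  ring_nf
  rw [h2]
  have : Real.cos w.re ^ 2 = 1 - Real.sin w.re ^ 2 := by linarith
  rw [this]
  ring

/-- Since |sin(a + ib)|² = sin²a + sinh²b, Jordan's inequality for the sine and sinh t ≥ t handle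
the two coordinates separately. -/
theorem two_mul_norm_le_norm_sin {z : ℂ} (hz : |z.re| ≤ 1 / 2) :
    2 * ‖z‖ ≤ ‖Complex.sin (Real.pi * z)‖ := by
  have hpi := Real.pi_gt_three
  refine (sq_le_sq₀ (by positivity) (norm_nonneg _)).1 ?_
  rw [sq_norm_sin, mul_pow, ← Complex.normSq_eq_norm_sq, Complex.normSq_apply, Complex.re_ofReal_mul,
    Complex.im_ofReal_mul]
  have h1 : 2 * |z.re| ≤ |Real.sin (Real.pi * z.re)| := by
    have h : ∀ t : ℝ, 0 ≤ t → t ≤ 1 / 2 → 2 * t ≤ |Real.sin (Real.pi * t)| := fun t ht ht2 => by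
      have := Real.mul_le_sin (x := Real.pi * t) (by positivity) (by nlinarith)
      refine le_trans (le_of_eq ?_) (this.trans (le_abs_self _))
      field_simp
    rcases le_total 0 z.re with h0 | h0
    · rw [abs_of_nonneg h0] at hz ⊢; exact h _ h0 hz
    · rw [abs_of_nonpos h0] at hz ⊢
      have := h _ (by linarith) hz
      rwa [mul_neg Real.pi, Real.sin_neg, abs_neg] at this
  have h2 : 2 * |z.im| ≤ |Real.sinh (Real.pi * z.im)| := by
    have h : ∀ t : ℝ, 0 ≤ t → 2 * t ≤ |Real.sinh (Real.pi * t)| := fun t ht => by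
      have := Real.self_le_sinh_iff.2 (show 0 ≤ Real.pi * t by positivity)
      refine le_trans ?_ (this.trans (le_abs_self _))
      nlinarith
    rcases le_total 0 z.im with h0 | h0
    · rw [abs_of_nonneg h0]; exact h _ h0
    · rw [abs_of_nonpos h0]
      have := h _ (neg_nonneg.2 h0)
      rwa [mul_neg Real.pi, Real.sinh_neg, abs_neg] at this
  have e1 := pow_le_pow_left₀ (by positivity) h1 2
  have e2 := pow_le_pow_left₀ (by positivity) h2 2
  rw [mul_pow, sq_abs, sq_abs] at e1 e2
  nlinarith

theorem norm_sin_pi_sub_int (z : ℂ) (k : ℤ) :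
    ‖Complex.sin (Real.pi * (z - k))‖ = ‖Complex.sin (Real.pi * z)‖ := by
  rw [mul_sub, mul_comm (Real.pi : ℂ) (k : ℂ), Complex.sin_antiperiodic.sub_int_mul_eq]
  rcases Int.even_or_odd k with h | h
  · rw [Int.negOnePow_even k h]; simp
  · rw [Int.negOnePow_odd k h]; simp

/-- Lower bound for the sine away from its zeros. -/
theorem exists_le_norm_sin : ∃ c : ℝ, 0 < c ∧ ∀ z : ℂ, (∀ k : ℤ, 1 / 4 ≤ ‖z - k‖) →
    c * Real.exp (Real.pi * |z.im|) ≤ ‖Complex.sin (Real.pi * z)‖ := by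
  have hpi := Real.pi_gt_three
  have hsinh : ∀ z : ℂ, Real.sinh (Real.pi * |z.im|) ≤ ‖Complex.sin (Real.pi * z)‖ := fun z => by
    refine (sq_le_sq₀ (Real.sinh_nonneg_iff.2 (by positivity)) (norm_nonneg _)).1 ?_
    rw [sq_norm_sin, Complex.im_ofReal_mul]
    have : Real.sinh (Real.pi * |z.im|) ^ 2 = Real.sinh (Real.pi * z.im) ^ 2 := by
      rcases le_total 0 z.im with h0 | h0
      · rw [abs_of_nonneg h0]
      · rw [abs_of_nonpos h0, mul_neg, Real.sinh_neg, neg_sq]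
    rw [this]
    nlinarith [sq_nonneg (Real.sin ((Real.pi : ℂ) * z).re)]
  -- For |Im z| ≥ 1 the hyperbolic sine alone gives the growth. For |Im z| ≤ 1 the distance to the
  -- nearest integer gives at least 1/2, while the exponential is at most e^π.
  refine ⟨Real.exp (-Real.pi) / 4, by positivity, fun z hz => ?_⟩
  rcases le_total 1 |z.im| with h | h
  · refine le_trans ?_ (hsinh z)
    rw [Real.sinh_eq]
    have h1 : Real.exp (-(Real.pi * |z.im|)) ≤ 1 / 4 * Real.exp (Real.pi * |z.im|) := by
      rw [Real.exp_neg]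
      have h2 : 4 ≤ Real.exp (Real.pi * |z.im|) := by
        have := Real.add_one_le_exp (Real.pi * |z.im|)
        nlinarith
      rw [inv_le_comm₀ (Real.exp_pos _) (by positivity)]
      have h3 : (1 / 4 * Real.exp (Real.pi * |z.im|))⁻¹ ≤ 1 := inv_le_one_of_one_le₀ (by linarith)
      linarith
    have h2 : Real.exp (-Real.pi) ≤ 1 := Real.exp_le_one_iff.2 (by linarith)
    have h3 := mul_le_mul_of_nonneg_right h2 (Real.exp_pos (Real.pi * |z.im|)).le
    rw [div_mul_eq_mul_div]
    linarith [Real.exp_pos (Real.pi * |z.im|)]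
  · have h1 := hz (round z.re)
    have h2 : |(z - (round z.re : ℤ)).re| ≤ 1 / 2 := by simpa using abs_sub_round z.re
    have h3 := two_mul_norm_le_norm_sin h2
    rw [norm_sin_pi_sub_int] at h3
    have h4 : Real.exp (-Real.pi) * Real.exp (Real.pi * |z.im|) ≤ 1 := by
      rw [← Real.exp_add, Real.exp_le_one_iff]
      nlinarith
    linarith

theorem norm_cos_mul_le (ρ : ℂ) {x : ℝ} (hx : 0 ≤ x) :
    ‖Complex.cos (ρ * x)‖ ≤ Real.exp (|ρ.im| * x) := by
  have h : ∀ w : ℂ, ‖Complex.exp w‖ ≤ Real.exp |w.re| := fun w => by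
    rw [Complex.norm_exp]; exact Real.exp_le_exp.2 (le_abs_self _)
  have h1 := h (ρ * x * I)
  have h2 := h (-(ρ * x) * I)
  have e : ∀ s : ℝ, |s| = |ρ.im| * x → Real.exp |s| = Real.exp (|ρ.im| * x) := fun s hs => by rw [hs]
  rw [e _ (by simp [abs_mul, abs_of_nonneg hx])] at h1 h2
  rw [Complex.cos, norm_div, Complex.norm_ofNat]
  linarith [norm_add_le (Complex.exp (ρ * x * I)) (Complex.exp (-(ρ * x) * I))]

theorem norm_sin_mul_le (ρ : ℂ) {x : ℝ} (hx : 0 ≤ x) :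
    ‖Complex.sin (ρ * x)‖ ≤ Real.exp (|ρ.im| * x) := by
  have h : ∀ w : ℂ, ‖Complex.exp w‖ ≤ Real.exp |w.re| := fun w => by
    rw [Complex.norm_exp]; exact Real.exp_le_exp.2 (le_abs_self _)
  have h1 := h (ρ * x * I)
  have h2 := h (-(ρ * x) * I)
  have e : ∀ s : ℝ, |s| = |ρ.im| * x → Real.exp |s| = Real.exp (|ρ.im| * x) := fun s hs => by rw [hs]
  rw [e _ (by simp [abs_mul, abs_of_nonneg hx])] at h1 h2
  rw [Complex.sin, norm_div, norm_mul, Complex.norm_I, mul_one, Complex.norm_ofNat]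
  linarith [norm_sub_le (Complex.exp (-(ρ * x) * I)) (Complex.exp (ρ * x * I))]

/-- Lets every estimate for ψ be divided by r₁: the coefficient r₂ is at most a constant times r₁ at
large arguments. -/
theorem exists_norm_eval_le {p q : ℂ[X]} {M : ℕ} (hp : p.Monic) (hpM : p.natDegree = M)
    (hq : q.natDegree ≤ M) : ∃ K R : ℝ, 0 < K ∧ 0 < R ∧ ∀ z : ℂ, R ≤ ‖z‖ →
      p.eval z ≠ 0 ∧ ‖q.eval z‖ ≤ K * ‖p.eval z‖ := by
  have hd : q.degree ≤ p.degree := by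
    rw [Polynomial.degree_eq_natDegree hp.ne_zero, hpM]
    exact Polynomial.natDegree_le_iff_degree_le.1 hq
  have h1d : (1 : ℂ[X]).degree ≤ p.degree := by
    rw [Polynomial.degree_one, Polynomial.degree_eq_natDegree hp.ne_zero]
    exact_mod_cast Nat.zero_le _
  obtain ⟨K, hK, h⟩ := (Polynomial.isBigO_cobounded_of_degree_le hd).exists_pos
  obtain ⟨K', hK', h'⟩ := (Polynomial.isBigO_cobounded_of_degree_le h1d).exists_pos
  rw [Asymptotics.isBigOWith_iff] at h h'
  obtain ⟨R, -, hR⟩ := (Metric.hasBasis_cobounded_compl_ball (0 : ℂ)).eventually_iff.1 (h.and h')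
  refine ⟨K, max R 1, hK, by positivity, fun z hz => ?_⟩
  have := hR (x := z) (by simpa using le_trans (le_max_left _ _) hz)
  refine ⟨fun h0 => ?_, this.1⟩
  have := this.2
  simp [h0] at this
  linarith

namespace Problem

variable {L : Problem} {M : ℕ}

/-- The reflected potential. -/
def refl (L : Problem) : ℝ → ℂ := fun x => -L.σ (Real.pi - x)

theorem IsNormalized.memLp (hL : L.IsNormalized M) :
    MemLp L.σ 2 (volume.restrict (Ioo 0 Real.pi)) := hL.1

theorem IsNormalized.memLp_refl (hL : L.IsNormalized M) :
    MemLp L.refl 2 (volume.restrict (Ioo 0 Real.pi)) := memLp_reflect hL.1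

theorem pi_sub_mem {x : ℝ} (hx : x ∈ Icc 0 Real.pi) : Real.pi - x ∈ Icc 0 Real.pi :=
  ⟨by linarith [hx.2], by linarith [hx.1]⟩

theorem solution_pi_eq (hL : L.IsNormalized M) {x : ℝ} (hx : x ∈ Icc 0 Real.pi) (l : ℂ) :
    L.psi x l = (solution L.refl l 0 (L.r₁.eval l, L.r₂.eval l) (Real.pi - x)).1 ∧
      L.psiQ x l = -(solution L.refl l 0 (L.r₁.eval l, L.r₂.eval l) (Real.pi - x)).2 := by
  have h := (isSolution_solution hL.memLp pi_mem_Icc_pi l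
    (L.r₁.eval l, -L.r₂.eval l)).reflect
  simp only [neg_neg] at h
  have := h.solution_eq hL.memLp_refl zero_mem_Icc_pi (pi_sub_mem hx)
  change solution L.refl _ _ _ _ = _ at this
  rw [this]
  simp only [sub_sub_cancel, neg_neg]
  exact ⟨rfl, rfl⟩

theorem solution_smul_add {σ : ℝ → ℂ} (hσ : MemLp σ 2 (volume.restrict (Ioo 0 Real.pi))) (l p q : ℂ)
    {x : ℝ} (hx : x ∈ Icc 0 Real.pi) :
    solution σ l 0 (p, q) x = p • solution σ l 0 (1, 0) x + q • solution σ l 0 (0, 1) x := by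
  have h := (isSolution_solution hσ zero_mem_Icc_pi l (1, 0)).linear_comb hσ zero_mem_Icc_pi
    (isSolution_solution hσ zero_mem_Icc_pi l (0, 1)) p q
  have e : p • ((1 : ℂ), (0 : ℂ)) + q • ((0 : ℂ), (1 : ℂ)) = (p, q) := by simp
  rw [e] at h
  exact h.solution_eq hσ zero_mem_Icc_pi hx

theorem psi_eq (hL : L.IsNormalized M) {x : ℝ} (hx : x ∈ Icc 0 Real.pi) (l : ℂ) :
    L.psi x l = L.r₁.eval l * (solution L.refl l 0 (1, 0) (Real.pi - x)).1 +
      L.r₂.eval l * (solution L.refl l 0 (0, 1) (Real.pi - x)).1 := by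
  rw [(solution_pi_eq hL hx l).1, solution_smul_add hL.memLp_refl _ _ _ (pi_sub_mem hx)]
  rfl

theorem psiQ_eq (hL : L.IsNormalized M) {x : ℝ} (hx : x ∈ Icc 0 Real.pi) (l : ℂ) :
    L.psiQ x l = -(L.r₁.eval l * (solution L.refl l 0 (1, 0) (Real.pi - x)).2 +
      L.r₂.eval l * (solution L.refl l 0 (0, 1) (Real.pi - x)).2) := by
  rw [(solution_pi_eq hL hx l).2, solution_smul_add hL.memLp_refl _ _ _ (pi_sub_mem hx)]
  rfl

theorem differentiable_solution {σ : ℝ → ℂ}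
    (hσ : MemLp σ 2 (volume.restrict (Ioo 0 Real.pi))) (c : ℂ × ℂ) {x : ℝ}
    (hx : x ∈ Icc 0 Real.pi) : Differentiable ℂ fun l => solution σ l 0 c x := by
  have h := (ContinuousMap.evalCLM ℂ (⟨x, hx⟩ : Icc 0 Real.pi)).differentiable.comp
    (differentiable_solutionMap hσ c)
  have e : (fun l => solution σ l 0 c x) =
      (ContinuousMap.evalCLM ℂ (⟨x, hx⟩ : Icc 0 Real.pi)) ∘ solutionMap hσ c := funext fun l => by
    rw [Function.comp_apply, ContinuousMap.evalCLM_apply, solutionMap_apply hσ]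
  rw [e]
  exact h

theorem IsNormalized.differentiable_phi (hL : L.IsNormalized M) {x : ℝ} (hx : x ∈ Icc 0 Real.pi) :
    Differentiable ℂ (L.phi x) := (differentiable_solution hL.memLp (1, 0) hx).fst

theorem IsNormalized.differentiable_phiQ (hL : L.IsNormalized M) {x : ℝ} (hx : x ∈ Icc 0 Real.pi) :
    Differentiable ℂ (L.phiQ x) := (differentiable_solution hL.memLp (1, 0) hx).snd

theorem IsNormalized.differentiable_psi (hL : L.IsNormalized M) {x : ℝ} (hx : x ∈ Icc 0 Real.pi) :
    Differentiable ℂ (L.psi x) := by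
  have h1 := differentiable_solution hL.memLp_refl (1, 0) (pi_sub_mem hx)
  have h2 := differentiable_solution hL.memLp_refl (0, 1) (pi_sub_mem hx)
  rw [funext fun l => psi_eq hL hx l]
  exact (L.r₁.differentiable.fun_mul h1.fst).fun_add (L.r₂.differentiable.fun_mul h2.fst)

theorem IsNormalized.differentiable_psiQ (hL : L.IsNormalized M) {x : ℝ} (hx : x ∈ Icc 0 Real.pi) :
    Differentiable ℂ (L.psiQ x) := by
  have h1 := differentiable_solution hL.memLp_refl (1, 0) (pi_sub_mem hx)
  have h2 := differentiable_solution hL.memLp_refl (0, 1) (pi_sub_mem hx)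
  rw [funext fun l => psiQ_eq hL hx l]
  exact ((L.r₁.differentiable.fun_mul h1.snd).fun_add (L.r₂.differentiable.fun_mul h2.snd)).fun_neg

/-- The Wronskian of `φ` and `ψ` is constant. -/
theorem phi_mul_psiQ_sub (hL : L.IsNormalized M) {x : ℝ} (hx : x ∈ Icc 0 Real.pi) (l : ℂ) :
    L.phi x l * L.psiQ x l - L.phiQ x l * L.psi x l = -L.charFun l := by
  have hφ := isSolution_solution hL.memLp zero_mem_Icc_pi l (1, 0)
  have hψ := (isSolution_solution hL.memLp pi_mem_Icc_pi l (L.r₁.eval l, -L.r₂.eval l))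
  have hψ0 := hψ.change_base hL.memLp pi_mem_Icc_pi zero_mem_Icc_pi
  have h1 := hφ.wronskian_eq hL.memLp hψ0 hx
  have h2 := hφ.wronskian_eq hL.memLp hψ0 pi_mem_Icc_pi
  rw [hψ.apply_base pi_mem_Icc_pi] at h2
  simp only [sub_self, zero_mul, add_zero] at h1 h2
  rw [← h2] at h1
  unfold phi phiQ psi psiQ charFun phi phiQ
  rw [h1]
  ring

theorem phi_zero (hL : L.IsNormalized M) (l : ℂ) : L.phi 0 l = 1 ∧ L.phiQ 0 l = 0 := by
  have h := (isSolution_solution hL.memLp zero_mem_Icc_pi l (1, 0)).apply_base zero_mem_Icc_pi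
  unfold phi phiQ
  rw [h]
  exact ⟨rfl, rfl⟩

/-- Evaluates the constant Wronskian at 0. The denominator of the Weyl function is thus −Δ, so its
poles can only be eigenvalues. -/
theorem psiQ_zero (hL : L.IsNormalized M) (l : ℂ) : L.psiQ 0 l = -L.charFun l := by
  have h := phi_mul_psiQ_sub hL zero_mem_Icc_pi l
  rwa [(phi_zero hL l).1, (phi_zero hL l).2, one_mul, zero_mul, sub_zero] at h

theorem IsNormalized.differentiable_charFun (hL : L.IsNormalized M) :
    Differentiable ℂ L.charFun := by
  have h := (hL.differentiable_psiQ zero_mem_Icc_pi).fun_neg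
  rw [funext fun l => psiQ_zero hL l] at h
  simpa using h

theorem exists_norm_phi_le (hL : L.IsNormalized M) : ∃ C : ℝ, 0 < C ∧ ∀ ρ : ℂ, 1 ≤ ‖ρ‖ →
    ∀ x ∈ Icc 0 Real.pi, ‖L.phi x (ρ ^ 2)‖ ≤ C * Real.exp (|ρ.im| * x) ∧
      ‖L.phiQ x (ρ ^ 2)‖ ≤ C * ‖ρ‖ * Real.exp (|ρ.im| * x) := by
  obtain ⟨C, hC, h⟩ := exists_norm_solution_le hL.memLp
  refine ⟨C, hC, fun ρ hρ x hx => ?_⟩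
  simpa [phi, phiQ] using h ρ hρ (1, 0) x hx

/-- After reflection ψ is r₁ times a cosine-type solution plus r₂ times a sine-type solution. The
latter is smaller by a factor 1/|ρ|, which `err` absorbs. -/
theorem exists_norm_psi_sub_le (hL : L.IsNormalized M) : ∃ C R : ℝ, 0 < C ∧ 1 ≤ R ∧
    ∀ ρ : ℂ, R ≤ ‖ρ‖ → L.r₁.eval (ρ ^ 2) ≠ 0 ∧ ∀ x ∈ Icc 0 Real.pi,
      ‖L.psi x (ρ ^ 2) - L.r₁.eval (ρ ^ 2) * Complex.cos (ρ * (Real.pi - x : ℝ))‖ ≤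
        C * ‖L.r₁.eval (ρ ^ 2)‖ * Real.exp (|ρ.im| * (Real.pi - x)) *
          err L.refl ρ (Real.pi - x) ∧
      ‖L.psiQ x (ρ ^ 2) - L.r₁.eval (ρ ^ 2) * (ρ * Complex.sin (ρ * (Real.pi - x : ℝ)))‖ ≤
        C * ‖L.r₁.eval (ρ ^ 2)‖ * ‖ρ‖ * Real.exp (|ρ.im| * (Real.pi - x)) *
          err L.refl ρ (Real.pi - x) := by
  obtain ⟨C₁, hC₁, h₁⟩ := exists_norm_solution_le hL.memLp_refl
  obtain ⟨C₂, hC₂, h₂⟩ := exists_norm_solution_sub_le_err hL.memLp_refl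
  obtain ⟨K, R, hK, hR, h⟩ := exists_norm_eval_le hL.2.1 hL.2.2.1 hL.2.2.2
  refine ⟨C₂ + K * C₁, max R 1, by positivity, le_max_right _ _, fun ρ hρ => ?_⟩
  have hρ1 : 1 ≤ ‖ρ‖ := (le_max_right _ _).trans hρ
  have hρR : R ≤ ‖ρ ^ 2‖ := by
    rw [norm_pow]
    nlinarith [(le_max_left R 1).trans hρ]
  obtain ⟨hr0, hr⟩ := h _ hρR
  refine ⟨hr0, fun x hx => ?_⟩
  obtain ⟨a1, a2⟩ := h₂ ρ hρ1 _ (pi_sub_mem hx)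
  obtain ⟨b1, b2⟩ := h₁ ρ hρ1 (0, 1) _ (pi_sub_mem hx)
  simp only [norm_zero, norm_one, zero_add] at b1 b2
  have he := one_div_norm_le_err L.refl ρ (Real.pi - x)
  set e := err L.refl ρ (Real.pi - x)
  set E := Real.exp (|ρ.im| * (Real.pi - x))
  set r := L.r₁.eval (ρ ^ 2)
  have hE : 0 < E := Real.exp_pos _
  constructor
  · rw [psi_eq hL hx]
    calc _ = ‖r * ((solution L.refl (ρ ^ 2) 0 (1, 0) (Real.pi - x)).1 -
            Complex.cos (ρ * (Real.pi - x : ℝ))) +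
          L.r₂.eval (ρ ^ 2) * (solution L.refl (ρ ^ 2) 0 (0, 1) (Real.pi - x)).1‖ := by
          congr 1; ring
      _ ≤ ‖r‖ * (C₂ * E * e) + (K * ‖r‖) * (C₁ * E * e) := by
          refine (norm_add_le _ _).trans ?_
          rw [norm_mul, norm_mul]
          gcongr
          exact b1.trans (by gcongr)
      _ = _ := by ring
  · rw [psiQ_eq hL hx]
    calc _ = ‖r * ((solution L.refl (ρ ^ 2) 0 (1, 0) (Real.pi - x)).2 +
            ρ * Complex.sin (ρ * (Real.pi - x : ℝ))) +
          L.r₂.eval (ρ ^ 2) * (solution L.refl (ρ ^ 2) 0 (0, 1) (Real.pi - x)).2‖ := by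
          rw [← norm_neg]; congr 1; ring
      _ ≤ ‖r‖ * (C₂ * ‖ρ‖ * E * e) + (K * ‖r‖) * (C₁ * ‖ρ‖ * E * e) := by
          refine (norm_add_le _ _).trans ?_
          rw [norm_mul, norm_mul]
          gcongr
          exact b2.trans (by gcongr)
      _ = _ := by ring

end Problem

end SturmLiouville

end

/-! ### The residue theorem with principal parts; asymptotics of the Weyl solution. -/

noncomputable section

namespace SturmLiouville

open Complex (I)

/-- Cauchy's formula for the derivatives, with an arbitrary point of the disc. -/
theorem circleIntegral_div_sub_pow {h : ℂ → ℂ} (hh : Differentiable ℂ h) {c z : ℂ} {R : ℝ}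
    (hz : z ∈ Metric.ball c R) (j : ℕ) :
    ∮ w in C(c, R), h w / (w - z) ^ (j + 1) =
      2 * Real.pi * I * (iteratedDeriv j h z / (j ! : ℂ)) := by
  have hR : 0 < R := lt_of_le_of_lt dist_nonneg hz
  have hne : ∀ w ∈ Metric.sphere c R, w - z ≠ 0 := fun w hw h0 => by
    rw [sub_eq_zero.1 h0, Metric.mem_sphere] at hw
    exact (Metric.mem_ball.1 hz).ne hw
  have hcont : ∀ {h : ℂ → ℂ}, Differentiable ℂ h → ∀ j : ℕ,
      ContinuousOn (fun w => h w / (w - z) ^ j) (Metric.sphere c R) := fun hh j =>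
    hh.continuous.continuousOn.div (Continuous.continuousOn (by fun_prop))
      fun w hw => pow_ne_zero _ (hne w hw)
  induction j generalizing h with
  | zero =>
    have := (hh.diffContOnCl (s := Metric.ball c R)).circleIntegral_sub_inv_smul hz
    simp only [zero_add, pow_one, iteratedDeriv_zero, Nat.factorial_zero, Nat.cast_one, div_one]
    simp only [smul_eq_mul] at this
    rw [← this]
    refine circleIntegral.integral_congr hR.le fun w _ => ?_
    exact div_eq_inv_mul _ _
  | succ j ih =>
    have hd : Differentiable ℂ (deriv h) := by
      have := (hh.contDiff (n := (2 : ℕ))).differentiable_iteratedDeriv 1 (by norm_num)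
      rwa [iteratedDeriv_one] at this
    -- The derivative of h/(w − z)^{j+1} integrates to zero, which trades one order of the pole for
    -- one derivative of h.
    have h0 := circleIntegral.integral_eq_zero_of_hasDerivWithinAt hR.le
      (f := fun w => h w / (w - z) ^ (j + 1))
      (f' := fun w => deriv h w / (w - z) ^ (j + 1) -
        ((j : ℂ) + 1) * (h w / (w - z) ^ (j + 1 + 1))) fun w hw => by
        have hw0 := hne w hw
        have h1 : HasDerivAt (fun w => h w / (w - z) ^ (j + 1)) ((deriv h w * (w - z) ^ (j + 1) -
            h w * (((j + 1 : ℕ) : ℂ) * (w - z) ^ j * 1)) / ((w - z) ^ (j + 1)) ^ 2) w :=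
          (hh w).hasDerivAt.fun_div
          (((hasDerivAt_id w).sub_const z).fun_pow (j + 1)) (pow_ne_zero _ hw0)
        have h2 : (deriv h w * (w - z) ^ (j + 1) -
            h w * (((j + 1 : ℕ) : ℂ) * (w - z) ^ j * 1)) / ((w - z) ^ (j + 1)) ^ 2 =
            deriv h w / (w - z) ^ (j + 1) - ((j : ℂ) + 1) * (h w / (w - z) ^ (j + 1 + 1)) := by
          push_cast
          field_simp
          ring
        exact (h1.congr_deriv h2).hasDerivWithinAt
    have hc2 : ContinuousOn (fun w => ((j : ℂ) + 1) * (h w / (w - z) ^ (j + 1 + 1)))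
        (Metric.sphere c R) := continuousOn_const.mul (hcont hh _)
    rw [circleIntegral.integral_sub ((hcont hd _).circleIntegrable hR.le)
      (hc2.circleIntegrable hR.le),
      circleIntegral.integral_const_mul, ih hd, sub_eq_zero] at h0
    have hj : (j : ℂ) + 1 ≠ 0 := by exact_mod_cast Nat.succ_ne_zero j
    have hfac : (j ! : ℂ) ≠ 0 := by exact_mod_cast Nat.factorial_ne_zero j
    rw [iteratedDeriv_succ', Nat.factorial_succ]
    push_cast
    refine mul_left_cancel₀ hj (h0.symm.trans ?_)
    field_simp

/-- The residue theorem on a disc, for the product of an entire function and a function with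
finitely many poles that are given by their principal parts. -/
theorem circleIntegral_mul_eq_sum_residue {f h : ℂ → ℂ} (hh : Differentiable ℂ h) {c : ℂ} {R : ℝ}
    (hR : 0 < R) (s : Finset ℂ) (hs : ∀ z ∈ s, z ∈ Metric.ball c R)
    (hd : ∀ z ∈ Metric.closedBall c R, z ∉ s → DifferentiableAt ℂ f z)
    (m : ℂ → ℕ) (a : ℂ → ℕ → ℂ)
    (hpp : ∀ z ∈ s, ∃ g : ℂ → ℂ, AnalyticAt ℂ g z ∧ ∀ᶠ w in 𝓝[≠] z,
      f w = ∑ j ∈ Finset.range (m z), a z j / (w - z) ^ (j + 1) + g w) :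
    ∮ w in C(c, R), h w * f w = 2 * Real.pi * I *
      ∑ z ∈ s, ∑ j ∈ Finset.range (m z), a z j * (iteratedDeriv j h z / (j ! : ℂ)) := by
  classical
  choose! g hg hgf using hpp
  set P : ℂ → ℂ → ℂ := fun z w => ∑ j ∈ Finset.range (m z), a z j / (w - z) ^ (j + 1) with hP
  have hPd : ∀ z w, w ≠ z → DifferentiableAt ℂ (P z) w := fun z w hw => by
    refine DifferentiableAt.fun_sum fun j _ => ?_
    exact (differentiableAt_const _).fun_div (by fun_prop) (pow_ne_zero _ (sub_ne_zero.2 hw))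
  set G : ℂ → ℂ → ℂ := fun z w => g z w - ∑ y ∈ s.erase z, P y w with hG
  have hGc : ∀ z ∈ s, ContinuousAt (G z) z := fun z hz =>
    (hg z hz).continuousAt.fun_sub (DifferentiableAt.fun_sum fun y hy =>
      hPd y z (Finset.ne_of_mem_erase hy).symm).continuousAt
  -- Subtracting all principal parts and filling in the limits at the poles gives a function
  -- continuous on the closed disc and differentiable off a finite set; Cauchy's theorem with
  -- exceptional points then applies without proving differentiability at the poles.
  set F : ℂ → ℂ := fun w => if w ∈ s then G w w else f w - ∑ z ∈ s, P z w with hF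
  have hFd : ∀ w ∈ Metric.closedBall c R, w ∉ s → DifferentiableAt ℂ F w := fun w hw hws => by
    have h1 : DifferentiableAt ℂ (fun w => f w - ∑ z ∈ s, P z w) w :=
      (hd w hw hws).fun_sub (DifferentiableAt.fun_sum fun z hz =>
        hPd z w (fun h => hws (h ▸ hz)))
    refine h1.congr_of_eventuallyEq ?_
    filter_upwards [s.finite_toSet.isClosed.isOpen_compl.mem_nhds hws] with v hv
    simp only [hF]
    exact if_neg (fun h => hv h)
  have hFc : ContinuousOn F (Metric.closedBall c R) := fun w hw => by
    refine ContinuousAt.continuousWithinAt ?_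
    by_cases hws : w ∈ s
    · have hev : F =ᶠ[𝓝 w] G w := by
        have h1 := eventually_nhdsWithin_iff.1 (hgf w hws)
        have h2 : ∀ᶠ v in 𝓝 w, v ∉ s.erase w :=
          (s.erase w).finite_toSet.isClosed.isOpen_compl.mem_nhds (by simp)
        filter_upwards [h1, h2] with v hv1 hv2
        rcases eq_or_ne v w with rfl | hne
        · simp only [hF]; rw [if_pos hws]
        · have hvs : v ∉ s := fun h => hv2 (Finset.mem_erase.2 ⟨hne, h⟩)
          simp only [hF]
          rw [if_neg hvs, hv1 hne, ← Finset.add_sum_erase s _ hws]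
          simp only [hG, hP]
          ring
      exact (hGc w hws).congr hev.symm
    · exact (hFd w hw hws).continuousAt
  have h0 := Complex.circleIntegral_eq_zero_of_differentiable_on_off_countable hR.le
    s.finite_toSet.countable (hh.continuous.continuousOn.mul hFc) fun z hz =>
      (hh z).mul (hFd z (Metric.ball_subset_closedBall hz.1) hz.2)
  have hsph : ∀ w ∈ Metric.sphere c R, w ∉ s := fun w hw hws => by
    have := hs w hws
    rw [Metric.mem_ball, Metric.mem_sphere.1 hw] at this
    exact lt_irrefl _ this
  have hPc : ∀ z ∈ s, ContinuousOn (fun w => h w * P z w) (Metric.sphere c R) := fun z hz w hw =>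
    ((hh w).mul (hPd z w fun h => hsph w hw (h ▸ hz))).continuousAt.continuousWithinAt
  have hfc : ContinuousOn (fun w => h w * f w) (Metric.sphere c R) := fun w hw =>
    ((hh w).mul (hd w (Metric.sphere_subset_closedBall hw)
      (hsph w hw))).continuousAt.continuousWithinAt
  have h1 : ∮ w in C(c, R), (h * F) w =
      (∮ w in C(c, R), h w * f w) - ∑ z ∈ s, ∮ w in C(c, R), h w * P z w := by
    rw [← circleIntegral.integral_fun_sum fun z hz => (hPc z hz).circleIntegrable hR.le,
      ← circleIntegral.integral_sub (hfc.circleIntegrable hR.le)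
        ((continuousOn_finsetSum s hPc).circleIntegrable hR.le)]
    refine circleIntegral.integral_congr hR.le fun w hw => ?_
    simp only [hF, Pi.mul_apply]
    rw [if_neg (hsph w hw), mul_sub, Finset.mul_sum]
  have h2 : ∀ z ∈ s, ∮ w in C(c, R), h w * P z w = 2 * Real.pi * I *
      ∑ j ∈ Finset.range (m z), a z j * (iteratedDeriv j h z / (j ! : ℂ)) := fun z hz => by
    have e : ∀ w, h w * P z w = ∑ j ∈ Finset.range (m z), a z j * (h w / (w - z) ^ (j + 1)) :=
      fun w => by
        simp only [hP, Finset.mul_sum]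
        exact Finset.sum_congr rfl fun j _ => by ring
    simp only [e]
    rw [circleIntegral.integral_fun_sum, Finset.mul_sum]
    · refine Finset.sum_congr rfl fun j _ => ?_
      rw [circleIntegral.integral_const_mul, circleIntegral_div_sub_pow hh (hs z hz)]
      ring
    · intro j _
      refine ContinuousOn.circleIntegrable hR.le fun w hw => ?_
      have hne : w ≠ z := fun h => hsph w hw (h ▸ hz)
      have hdiv : DifferentiableAt ℂ (fun w => h w / (w - z) ^ (j + 1)) w :=
        (hh w).fun_div (by fun_prop) (pow_ne_zero _ (sub_ne_zero.2 hne))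
      exact (hdiv.const_mul (a z j)).continuousAt.continuousWithinAt
  have h0' : ∮ w in C(c, R), (h * F) w = 0 := h0
  rw [h1, Finset.sum_congr rfl h2, ← Finset.mul_sum] at h0'
  exact sub_eq_zero.1 h0'

/-- Stability of a quotient: when the error in the denominator is at most half its lower bound, the
relative errors of numerator and denominator simply add up to a constant. -/
theorem norm_div_sub_div_le {A s e₁ e₂ : ℂ} {E₁ E C c ε₁ ε₂ : ℝ} (hE : 0 < E) (hc : 0 < c)
    (hC : 0 < C) (hE₁ : 0 ≤ E₁)
    (hA : ‖A‖ ≤ E₁) (he₁ : ‖e₁‖ ≤ C * E₁ * ε₁) (hs : c * E ≤ ‖s‖) (he₂ : ‖e₂‖ ≤ C * E * ε₂)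
    (hε₁ : 0 ≤ ε₁) (hε₂ : 0 ≤ ε₂) (hsmall : C * ε₂ ≤ c / 2) :
    s + e₂ ≠ 0 ∧
      ‖(A + e₁) / (s + e₂) - A / s‖ ≤ 2 * C / c * (1 + 1 / c) * (E₁ / E) * (ε₁ + ε₂) := by
  have hs0 : 0 < ‖s‖ := lt_of_lt_of_le (by positivity) hs
  have h1 : c / 2 * E ≤ ‖s + e₂‖ := by
    have h := norm_sub_le (s + e₂) e₂
    rw [add_sub_cancel_right] at h
    nlinarith
  have h10 : 0 < ‖s + e₂‖ := lt_of_lt_of_le (by positivity) h1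
  have hne := norm_pos_iff.1 h10
  have hsne := norm_pos_iff.1 hs0
  refine ⟨hne, ?_⟩
  have e : (A + e₁) / (s + e₂) - A / s = e₁ / (s + e₂) - A * e₂ / (s * (s + e₂)) := by
    field_simp
    ring
  rw [e]
  calc _ ≤ ‖e₁‖ / ‖s + e₂‖ + ‖A‖ * ‖e₂‖ / (‖s‖ * ‖s + e₂‖) := by
        refine (norm_sub_le _ _).trans (le_of_eq ?_)
        rw [norm_div, norm_div, norm_mul, norm_mul]
    _ ≤ C * E₁ * ε₁ / (c / 2 * E) + E₁ * (C * E * ε₂) / (c * E * (c / 2 * E)) := by gcongr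
    _ = 2 * C / c * (E₁ / E) * (ε₁ + 1 / c * ε₂) := by field_simp
    _ ≤ 2 * C / c * (E₁ / E) * ((1 + 1 / c) * (ε₁ + ε₂)) := by
        gcongr
        have : 0 ≤ 1 / c := by positivity
        nlinarith [mul_nonneg this hε₁]
    _ = _ := by ring

namespace Problem

variable {L : Problem} {M : ℕ}

/-- The Weyl solution `Φ(x, l)`. -/
def weylSol (L : Problem) (x : ℝ) (l : ℂ) : ℂ := L.psi x l / L.psiQ 0 l

/-- The quasi-derivative of the Weyl solution. -/
def weylSolQ (L : Problem) (x : ℝ) (l : ℂ) : ℂ := L.psiQ x l / L.psiQ 0 l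

/-- In the quotient defining Φ the factor r₁ cancels, so only cosine or sine over sin πρ remains.
The growth e^{|Im ρ|(π−x)} against e^{|Im ρ|π} leaves e^{−|Im ρ|x}, valid away from the zeros of sin
πρ. -/
theorem exists_norm_weylSol_sub_le (hL : L.IsNormalized M) : ∃ C R : ℝ, 0 < C ∧ 1 ≤ R ∧
    ∀ ρ : ℂ, R ≤ ‖ρ‖ → (∀ k : ℤ, 1 / 4 ≤ ‖ρ - k‖) → L.psiQ 0 (ρ ^ 2) ≠ 0 ∧ ∀ x ∈ Icc 0 Real.pi,
      ‖ρ * L.weylSol x (ρ ^ 2) - Complex.cos (ρ * (Real.pi - x : ℝ)) / Complex.sin (Real.pi * ρ)‖ ≤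
        C * Real.exp (-(|ρ.im| * x)) * (err L.refl ρ (Real.pi - x) + err L.refl ρ Real.pi) ∧
      ‖L.weylSolQ x (ρ ^ 2) - Complex.sin (ρ * (Real.pi - x : ℝ)) / Complex.sin (Real.pi * ρ)‖ ≤
        C * Real.exp (-(|ρ.im| * x)) * (err L.refl ρ (Real.pi - x) + err L.refl ρ Real.pi) := by
  obtain ⟨C, R, hC, hR, h⟩ := exists_norm_psi_sub_le hL
  obtain ⟨c, hc, hsin⟩ := exists_le_norm_sin
  obtain ⟨R', hR', hsmall⟩ := exists_err_le hL.memLp_refl (ε := c / (2 * C)) (by positivity)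
  refine ⟨2 * C / c * (1 + 1 / c), max R R', by positivity, hR.trans (le_max_left _ _),
    fun ρ hρ hk => ?_⟩
  obtain ⟨hr0, hψ⟩ := h ρ ((le_max_left _ _).trans hρ)
  have hρ0 : ρ ≠ 0 := norm_pos_iff.1 (by linarith [(le_max_left R R').trans hρ])
  have hρn : 0 < ‖ρ‖ := norm_pos_iff.2 hρ0
  have hrn : 0 < ‖L.r₁.eval (ρ ^ 2)‖ := norm_pos_iff.2 hr0
  set r := L.r₁.eval (ρ ^ 2) with hr
  have hε := err_nonneg L.refl ρ
  have hsm : C * err L.refl ρ Real.pi ≤ c / 2 := by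
    have := hsmall ρ ((le_max_right _ _).trans hρ) Real.pi pi_mem_Icc_pi
    calc _ ≤ C * (c / (2 * C)) := by gcongr
      _ = _ := by field_simp
  have h0 := (hψ 0 zero_mem_Icc_pi).2
  rw [sub_zero] at h0
  set s := Complex.sin (Real.pi * ρ) with hs
  have hs' := hsin ρ hk
  have hcomm : Complex.sin (ρ * Real.pi) = s := by rw [mul_comm]
  rw [hcomm] at h0
  set e₂ := L.psiQ 0 (ρ ^ 2) / (r * ρ) - s with he₂
  have hψ0 : L.psiQ 0 (ρ ^ 2) = r * ρ * (s + e₂) := by rw [he₂]; field_simp; ring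
  have he₂n : ‖e₂‖ ≤ C * Real.exp (Real.pi * |ρ.im|) * err L.refl ρ Real.pi := by
    rw [hψ0, show r * ρ * (s + e₂) - r * (ρ * s) = r * ρ * e₂ by ring, norm_mul, norm_mul,
      mul_comm |ρ.im|] at h0
    refine le_of_mul_le_mul_left (h0.trans (le_of_eq ?_)) (mul_pos hrn hρn)
    ring
  have hgen : ∀ (A e₁ : ℂ) (x : ℝ), x ∈ Icc 0 Real.pi →
      ‖A‖ ≤ Real.exp (|ρ.im| * (Real.pi - x)) →
      ‖e₁‖ ≤ C * Real.exp (|ρ.im| * (Real.pi - x)) * err L.refl ρ (Real.pi - x) →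
      s + e₂ ≠ 0 ∧ ‖(A + e₁) / (s + e₂) - A / s‖ ≤ 2 * C / c * (1 + 1 / c) *
        Real.exp (-(|ρ.im| * x)) * (err L.refl ρ (Real.pi - x) + err L.refl ρ Real.pi) := by
    intro A e₁ x hx hA he₁
    have := norm_div_sub_div_le (Real.exp_pos (Real.pi * |ρ.im|)) hc hC (Real.exp_pos _).le hA he₁
      hs' he₂n (hε _) (hε _) hsm
    rwa [← Real.exp_sub, show |ρ.im| * (Real.pi - x) - Real.pi * |ρ.im| = -(|ρ.im| * x) by ring]
      at this
  have hne : s + e₂ ≠ 0 := (hgen 0 0 0 zero_mem_Icc_pi (by rw [norm_zero]; positivity)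
    (by rw [norm_zero]; have := hε (Real.pi - 0); positivity)).1
  refine ⟨by rw [hψ0]; exact mul_ne_zero (mul_ne_zero hr0 hρ0) hne, fun x hx => ⟨?_, ?_⟩⟩
  · have h1 := (hψ x hx).1
    set A := Complex.cos (ρ * (Real.pi - x : ℝ)) with hA
    set e₁ := L.psi x (ρ ^ 2) / r - A with he₁
    have hψx : L.psi x (ρ ^ 2) = r * (A + e₁) := by rw [he₁]; field_simp; ring
    rw [weylSol, hψ0, hψx, show ρ * (r * (A + e₁) / (r * ρ * (s + e₂))) = (A + e₁) / (s + e₂) by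
      field_simp]
    refine (hgen A e₁ x hx (norm_cos_mul_le ρ (by linarith [hx.2])) ?_).2
    rw [hψx, show r * (A + e₁) - r * A = r * e₁ by ring, norm_mul] at h1
    refine le_of_mul_le_mul_left (h1.trans (le_of_eq ?_)) hrn
    ring
  · have h1 := (hψ x hx).2
    set A := Complex.sin (ρ * (Real.pi - x : ℝ)) with hA
    set e₁ := L.psiQ x (ρ ^ 2) / (r * ρ) - A with he₁
    have hψx : L.psiQ x (ρ ^ 2) = r * ρ * (A + e₁) := by rw [he₁]; field_simp; ring
    rw [weylSolQ, hψ0, hψx, show r * ρ * (A + e₁) / (r * ρ * (s + e₂)) = (A + e₁) / (s + e₂) by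
      field_simp]
    refine (hgen A e₁ x hx (norm_sin_mul_le ρ (by linarith [hx.2])) ?_).2
    rw [hψx, show r * ρ * (A + e₁) - r * (ρ * A) = r * ρ * e₁ by ring, norm_mul, norm_mul] at h1
    refine le_of_mul_le_mul_left (h1.trans (le_of_eq ?_)) (mul_pos hrn hρn)
    ring

theorem weyl_eq_weylSol (L : Problem) (l : ℂ) : L.weyl l = L.weylSol 0 l := rfl

end Problem

end SturmLiouville

end

/-! ### Asymptotics of the eigenvalues; residues as contour integrals. -/

noncomputable section

namespace SturmLiouville

open Complex (I)

theorem sqrtBranch_sq (z : ℂ) : sqrtBranch z ^ 2 = z := by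
  have h : (z ^ (1 / 2 : ℂ)) ^ 2 = z := by
    have := Complex.cpow_nat_inv_pow z (two_ne_zero)
    rwa [Nat.cast_ofNat, inv_eq_one_div] at this
  unfold sqrtBranch
  split_ifs
  · rw [neg_sq, h]
  · exact h

theorem SpectralSeq.rho_sq (S : SpectralSeq) (n : ℕ) : S.rho n ^ 2 = S.lam n := sqrtBranch_sq _

theorem summable_sq_of_le_err {σ : ℝ → ℂ} (hσ : MemLp σ 2 (volume.restrict (Ioo 0 Real.pi)))
    {a : ℕ → ℝ} {ρ : ℕ → ℂ} {B C x : ℝ} (hx : x ∈ Icc 0 Real.pi) (N : ℕ)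
    (h : ∀ n, N ≤ n → ‖ρ n - n‖ ≤ B ∧ 1 ≤ ‖ρ n‖ ∧ |a n| ≤ C * err σ (ρ n) x) :
    Summable fun n => a n ^ 2 := by
  obtain ⟨C₀, hC₀, hsum⟩ := exists_sum_sq_err_le hσ B
  rw [← summable_nat_add_iff N]
  refine summable_of_sum_le (c := C ^ 2 * C₀) (fun n => sq_nonneg _) fun F => ?_
  have h1 := hsum (F.map (addRightEmbedding N)) ρ (fun n hn => by
    obtain ⟨m, -, rfl⟩ := Finset.mem_map.1 hn
    exact ⟨(h _ (Nat.le_add_left N m)).1, (h _ (Nat.le_add_left N m)).2.1⟩) x hx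
  rw [Finset.sum_map] at h1
  calc ∑ n ∈ F, a (n + N) ^ 2 ≤ ∑ n ∈ F, C ^ 2 * err σ (ρ (n + N)) x ^ 2 := by
        refine Finset.sum_le_sum fun n _ => ?_
        rw [← sq_abs, ← mul_pow]
        exact pow_le_pow_left₀ (abs_nonneg _) (h _ (Nat.le_add_left N n)).2.2 2
    _ ≤ C ^ 2 * C₀ := by
        rw [← Finset.mul_sum]
        exact mul_le_mul_of_nonneg_left h1 (sq_nonneg _)

theorem eq_of_norm_natCast_sub_lt {k n : ℕ} (h : ‖(k : ℂ) - n‖ < 1) : k = n := by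
  have h1 : ‖(((k : ℤ) - n : ℤ) : ℂ)‖ < 1 := by push_cast; exact h
  rw [Complex.norm_intCast] at h1
  have h2 : |(k : ℤ) - n| < 1 := by exact_mod_cast h1
  rw [Int.abs_lt_one_iff] at h2
  omega

namespace IsSpectralData

variable {L : Problem} {S : SpectralSeq} {M : ℕ}

theorem tendsto_sub (hL : L.IsNormalized M) (hS : IsSpectralData L S) :
    Tendsto (fun n : ℕ => S.rho n - ((n : ℂ) - M)) atTop (𝓝 0) := by
  have := hS.numbering
  rwa [hL.2.2.1] at this

theorem exists_norm_rho_sub_le (hL : L.IsNormalized M) (hS : IsSpectralData L S) :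
    ∃ B : ℝ, 0 < B ∧ ∀ n, ‖S.rho n - n‖ ≤ B := by
  obtain ⟨B, hB⟩ := (tendsto_sub hL hS).norm.bddAbove_range
  have h : ∀ n, ‖S.rho n - n‖ ≤ B + M := fun n => by
    have h1 : ‖S.rho n - ((n : ℂ) - M)‖ ≤ B := hB ⟨n, rfl⟩
    have h2 := norm_sub_le (S.rho n - ((n : ℂ) - M)) M
    rw [show S.rho n - ((n : ℂ) - M) - M = S.rho n - n by ring, Complex.norm_natCast] at h2
    linarith
  refine ⟨B + M + 1, by have := (norm_nonneg _).trans (h 0); linarith, fun n => ?_⟩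
  linarith [h n]

theorem finite_fiber (hL : L.IsNormalized M) (hS : IsSpectralData L S) (z : ℂ) :
    {k | S.lam k = z}.Finite := by
  obtain ⟨B, -, hB⟩ := exists_norm_rho_sub_le hL hS
  refine (finite_le_nat ⌈‖sqrtBranch z‖ + B⌉₊).subset fun k hk => ?_
  have h1 := hB k
  have h2 := norm_sub_norm_le (k : ℂ) (S.rho k)
  rw [norm_sub_rev, Complex.norm_natCast] at h2
  rw [SpectralSeq.rho, show S.lam k = z from hk] at h1 h2
  exact Nat.cast_le.1 (le_trans (by linarith) (Nat.le_ceil _) : (k : ℝ) ≤ _)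

theorem charFun_lam (hL : L.IsNormalized M) (hS : IsSpectralData L S) (n : ℕ) :
    L.charFun (S.lam n) = 0 := by
  have h := hS.encard_eq (S.lam n)
  by_contra hne
  have han : AnalyticAt ℂ L.charFun (S.lam n) :=
    hL.differentiable_charFun.analyticAt _
  rw [han.analyticOrderAt_eq_zero.2 hne, encard_eq_zero] at h
  exact (h ▸ (rfl : S.lam n = S.lam n) : n ∈ (∅ : Set ℕ))

theorem exists_lam_eq (hL : L.IsNormalized M) (hS : IsSpectralData L S) {z : ℂ}
    (hz : L.charFun z = 0) : ∃ n, S.lam n = z := by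
  have h := hS.encard_eq z
  have han : AnalyticAt ℂ L.charFun z := hL.differentiable_charFun.analyticAt _
  have hne : analyticOrderAt L.charFun z ≠ 0 := fun h0 => han.analyticOrderAt_eq_zero.1 h0 hz
  rw [← h, encard_ne_zero] at hne
  exact hne

/-- For large n the disc of radius 1/4 about n − M isolates ρ_n among all square roots of
eigenvalues, including the roots −ρ_k. Simplicity of large eigenvalues and the contour formula for
α_n follow from this. -/
theorem exists_eq_of_sq_eq_lam (hL : L.IsNormalized M) (hS : IsSpectralData L S) :
    ∃ N : ℕ, M + 1 ≤ N ∧ ∀ n, N ≤ n → ‖S.rho n - ((n : ℂ) - M)‖ < 1 / 4 ∧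
      ∀ (k : ℕ) (z : ℂ), ‖z - ((n : ℂ) - M)‖ ≤ 1 / 4 → z ^ 2 = S.lam k → k = n ∧ z = S.rho n := by
  obtain ⟨B, hB0, hB⟩ := exists_norm_rho_sub_le hL hS
  obtain ⟨K, hK⟩ := Metric.tendsto_atTop.1 (tendsto_sub hL hS) (1 / 4) (by norm_num)
  simp only [dist_zero_right] at hK
  -- Beyond this index, a ρ_k with k < K is too small in modulus to lie in the disc, and a root −ρ_k
  -- would force n + k − 2M ≤ 1/2.
  refine ⟨K + ⌈B⌉₊ + 2 * M + 2, by omega, fun n hn => ⟨hK n (by omega), fun k z hz hzk => ?_⟩⟩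
  have hn' : (K : ℝ) + B + 2 * M + 2 ≤ n := by
    have h1 : ((K + ⌈B⌉₊ + 2 * M + 2 : ℕ) : ℝ) ≤ n := Nat.cast_le.2 hn
    push_cast at h1
    linarith [Nat.le_ceil B]
  have hKk : K ≤ k := by
    by_contra hlt
    have h1 : (k : ℝ) < K := Nat.cast_lt.2 (not_le.1 hlt)
    have h2 : ‖z‖ = ‖S.rho k‖ := by
      have := congrArg norm hzk
      rw [← S.rho_sq, norm_pow, norm_pow] at this
      exact (pow_left_inj₀ (norm_nonneg _) (norm_nonneg _) two_ne_zero).1 this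
    have h3 := norm_sub_norm_le (S.rho k) k
    have h4 : ‖((n : ℂ) - M)‖ ≤ ‖z‖ + 1 / 4 := by
      have := norm_sub_norm_le ((n : ℂ) - M) z
      rw [norm_sub_rev _ z] at this
      linarith
    have h5 : (n : ℝ) - M ≤ ‖((n : ℂ) - M)‖ := by
      have := Complex.re_le_norm ((n : ℂ) - M)
      simpa using this
    rw [Complex.norm_natCast] at h3
    have := hB k
    have : (0 : ℝ) ≤ M := Nat.cast_nonneg _
    linarith
  have hδ := hK k hKk
  rw [← S.rho_sq] at hzk
  rcases sq_eq_sq_iff_eq_or_eq_neg.1 hzk with h | h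
  · have hkn : k = n := by
      refine eq_of_norm_natCast_sub_lt ?_
      have := norm_sub_le (z - ((n : ℂ) - M)) (S.rho k - ((k : ℂ) - M))
      rw [h, show S.rho k - ((n : ℂ) - M) - (S.rho k - ((k : ℂ) - M)) = k - n by ring] at this
      rw [h] at hz
      linarith
    exact ⟨hkn, by rw [h, hkn]⟩
  · exfalso
    have h1 := norm_add_le (z - ((n : ℂ) - M)) (S.rho k - ((k : ℂ) - M))
    rw [h, show -S.rho k - ((n : ℂ) - M) + (S.rho k - ((k : ℂ) - M)) = -(n + k - 2 * M) by ring,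
      norm_neg] at h1
    have h2 := Complex.re_le_norm ((n : ℂ) + k - 2 * M)
    rw [h] at hz
    simp at h2
    have : (0 : ℝ) ≤ k := Nat.cast_nonneg _
    have : (0 : ℝ) ≤ K := Nat.cast_nonneg _
    linarith

theorem exists_mult_eq_one (hL : L.IsNormalized M) (hS : IsSpectralData L S) :
    ∃ N : ℕ, ∀ n, N ≤ n → S.mult n = 1 ∧ S.pos n = 0 := by
  obtain ⟨N, -, hN⟩ := exists_eq_of_sq_eq_lam hL hS
  refine ⟨N, fun n hn => ?_⟩
  obtain ⟨h1, h2⟩ := hN n hn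
  have h3 : ∀ k, S.lam k = S.lam n → k = n := fun k hk =>
    (h2 k (S.rho n) h1.le (by rw [hk, S.rho_sq])).1
  constructor
  · rw [SpectralSeq.mult, show {k | S.lam k = S.lam n} = {n} from
      Set.ext fun k => ⟨h3 k, fun hk => congrArg S.lam hk⟩, ncard_singleton]
  · rw [SpectralSeq.pos, show {k | k < n ∧ S.lam k = S.lam n} = ∅ from
      Set.eq_empty_of_forall_notMem fun k hk => hk.1.ne (h3 k hk.2), ncard_empty]

/-- `ρ_n - (n - M)` is square summable. -/
theorem summable_sq_norm_rho_sub (hL : L.IsNormalized M) (hS : IsSpectralData L S) :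
    Summable fun n : ℕ => ‖S.rho n - ((n : ℂ) - M)‖ ^ 2 := by
  obtain ⟨B, hB0, hB⟩ := exists_norm_rho_sub_le hL hS
  obtain ⟨N, -, hN⟩ := exists_eq_of_sq_eq_lam hL hS
  obtain ⟨C, R, hC, hR, hψ⟩ := Problem.exists_norm_psi_sub_le hL
  refine summable_sq_of_le_err hL.memLp_refl (B := B) (ρ := S.rho)
    (C := C * Real.exp (B * Real.pi)) pi_mem_Icc_pi (max N ⌈R + B⌉₊) fun n hn => ?_
  obtain ⟨h1, -⟩ := hN n ((le_max_left _ _).trans hn)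
  have hnR : R + B ≤ n := (Nat.le_ceil _).trans (Nat.cast_le.2 ((le_max_right _ _).trans hn))
  have hρR : R ≤ ‖S.rho n‖ := by
    have h2 := norm_sub_norm_le (n : ℂ) (S.rho n)
    rw [norm_sub_rev, Complex.norm_natCast] at h2
    linarith [hB n]
  refine ⟨hB n, hR.trans hρR, ?_⟩
  rw [abs_of_nonneg (norm_nonneg _)]
  obtain ⟨hr, hx⟩ := hψ _ hρR
  -- At an eigenvalue ψ^{[1]}(0) = −Δ vanishes, so the asymptotic formula bounds sin πρ_n by `err`;
  -- near n − M the sine controls the distance linearly.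
  have h3 := (hx 0 zero_mem_Icc_pi).2
  rw [S.rho_sq, Problem.psiQ_zero hL, charFun_lam hL hS, ← S.rho_sq, neg_zero, zero_sub, norm_neg, norm_mul, norm_mul,
    sub_zero, mul_comm (S.rho n) (Real.pi : ℂ)] at h3
  have hrn := norm_pos_iff.2 hr
  have hρn : 0 < ‖S.rho n‖ := by linarith
  have h4 : ‖Complex.sin (Real.pi * S.rho n)‖ ≤
      C * Real.exp (|(S.rho n).im| * Real.pi) * err L.refl (S.rho n) Real.pi := by
    refine le_of_mul_le_mul_left ?_ (mul_pos hrn hρn)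
    refine (le_of_eq ?_).trans (h3.trans (le_of_eq ?_)) <;> ring
  have h5 := norm_sin_pi_sub_int (S.rho n) ((n : ℤ) - M)
  push_cast at h5
  have h6 : 2 * ‖S.rho n - ((n : ℂ) - M)‖ ≤ _ := two_mul_norm_le_norm_sin
    ((Complex.abs_re_le_norm _).trans (h1.le.trans (by norm_num)))
  rw [h5] at h6
  have him : |(S.rho n).im| ≤ B := by
    have := (Complex.abs_im_le_norm (S.rho n - n)).trans (hB n)
    simpa using this
  calc ‖S.rho n - ((n : ℂ) - M)‖ ≤ 2 * ‖S.rho n - ((n : ℂ) - M)‖ := by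
        linarith [norm_nonneg (S.rho n - ((n : ℂ) - M))]
    _ ≤ _ := h6.trans h4
    _ ≤ _ := by
        have := err_nonneg L.refl (S.rho n) Real.pi
        have := Real.pi_nonneg
        gcongr

/-- Substituting λ = ρ² in the residue gives dλ = 2ρ dρ. In the variable ρ the contour has fixed
radius 1/4, while in λ the distance between eigenvalues grows. -/
theorem exists_alpha_eq (hL : L.IsNormalized M) (hS : IsSpectralData L S) :
    ∃ N : ℕ, ∀ n, N ≤ n →
      ContinuousOn (fun ρ => 2 * ρ * L.weyl (ρ ^ 2)) (Metric.sphere ((n : ℂ) - M) (1 / 4)) ∧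
      ∮ ρ in C((n : ℂ) - M, 1 / 4), 2 * ρ * L.weyl (ρ ^ 2) = 2 * Real.pi * I * S.alpha n := by
  obtain ⟨N, hN1, hN⟩ := exists_eq_of_sq_eq_lam hL hS
  obtain ⟨N', hN'⟩ := exists_mult_eq_one hL hS
  refine ⟨max N N', fun n hn => ?_⟩
  obtain ⟨h1, h2⟩ := hN n ((le_max_left _ _).trans hn)
  obtain ⟨hm, hp⟩ := hN' n ((le_max_right _ _).trans hn)
  have hnM : (M : ℝ) + 1 ≤ n := by exact_mod_cast hN1.trans ((le_max_left _ _).trans hn)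
  have hρ0 : S.rho n ≠ 0 := fun h0 => by
    rw [h0, zero_sub, norm_neg] at h1
    have := Complex.re_le_norm ((n : ℂ) - M)
    simp at this
    linarith
  have hd : ∀ z ∈ Metric.closedBall ((n : ℂ) - M) (1 / 4), z ∉ ({S.rho n} : Finset ℂ) →
      DifferentiableAt ℂ (fun ρ => 2 * ρ * L.weyl (ρ ^ 2)) z := fun z hz hzn => by
    have hne : L.psiQ 0 (z ^ 2) ≠ 0 := fun h0 => by
      rw [Problem.psiQ_zero hL, neg_eq_zero] at h0
      obtain ⟨k, hk⟩ := exists_lam_eq hL hS h0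
      exact hzn (Finset.mem_singleton.2
        (h2 k z (by rwa [Metric.mem_closedBall, dist_eq_norm] at hz) hk.symm).2)
    have hsq : DifferentiableAt ℂ (fun ρ : ℂ => ρ ^ 2) z := by fun_prop
    have e1 : DifferentiableAt ℂ (fun ρ : ℂ => L.psi 0 (ρ ^ 2)) z :=
      (hL.differentiable_psi zero_mem_Icc_pi _).comp z hsq
    have e2 : DifferentiableAt ℂ (fun ρ : ℂ => L.psiQ 0 (ρ ^ 2)) z :=
      (hL.differentiable_psiQ zero_mem_Icc_pi _).comp z hsq
    exact DifferentiableAt.fun_mul (by fun_prop) (e1.fun_div e2 hne)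
  refine ⟨fun z hz => (hd z (Metric.sphere_subset_closedBall hz) fun hzn => ?_).continuousAt.continuousWithinAt, ?_⟩
  · rw [Finset.mem_singleton.1 hzn, Metric.mem_sphere, dist_eq_norm] at hz
    linarith
  have key := circleIntegral_mul_eq_sum_residue (h := fun _ => 1) (differentiable_const _) (f := fun ρ => 2 * ρ * L.weyl (ρ ^ 2))
    (c := (n : ℂ) - M) (R := 1 / 4) (by norm_num) {S.rho n}
    (fun z hz => by rwa [Finset.mem_singleton.1 hz, Metric.mem_ball, dist_eq_norm]) hd
    (fun _ => 1) (fun _ _ => S.alpha n) (fun z hz => by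
      rw [Finset.mem_singleton.1 hz]
      obtain ⟨g, hg, hgw⟩ := hS.principal_part n hp
      -- Partial fractions: 2ρ/(ρ² − ρ_n²) = 1/(ρ − ρ_n) + 1/(ρ + ρ_n), and the second term is
      -- analytic at ρ_n ≠ 0.
      refine ⟨fun ρ => S.alpha n / (ρ + S.rho n) + 2 * ρ * g (ρ ^ 2), ?_, ?_⟩
      · have hg' : AnalyticAt ℂ (fun ρ : ℂ => g (ρ ^ 2)) (S.rho n) := by
          refine AnalyticAt.fun_comp (f := fun ρ : ℂ => ρ ^ 2) (g := g) ?_ (by fun_prop)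
          rw [S.rho_sq]; exact hg
        have h2ρ : S.rho n + S.rho n ≠ 0 := by
          rw [← two_mul]; exact mul_ne_zero two_ne_zero hρ0
        exact (analyticAt_const.div (analyticAt_id.add analyticAt_const) h2ρ).add
          ((analyticAt_const.mul analyticAt_id).mul hg')
      · have htend : Tendsto (fun ρ : ℂ => ρ ^ 2) (𝓝[≠] (S.rho n)) (𝓝[≠] (S.lam n)) := by
          refine tendsto_nhdsWithin_iff.2 ⟨?_, ?_⟩
          · rw [← S.rho_sq]
            exact (Continuous.tendsto (by fun_prop) _).mono_left nhdsWithin_le_nhds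
          · have : ∀ᶠ ρ in 𝓝[≠] (S.rho n), ρ ≠ -S.rho n := by
              refine (eventually_ne_nhds ?_).filter_mono nhdsWithin_le_nhds
              exact fun h => hρ0 (self_eq_neg.1 h)
            filter_upwards [this, self_mem_nhdsWithin] with ρ h1 h2 h3
            rw [mem_singleton_iff, ← S.rho_sq] at h3
            rcases sq_eq_sq_iff_eq_or_eq_neg.1 h3 with h | h
            · exact h2 h
            · exact h1 h
        have hadd : ∀ᶠ ρ in 𝓝[≠] (S.rho n), ρ + S.rho n ≠ 0 := by
          refine (ContinuousAt.eventually_ne (by fun_prop) ?_).filter_mono nhdsWithin_le_nhds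
          rw [← two_mul]; exact mul_ne_zero two_ne_zero hρ0
        filter_upwards [htend.eventually hgw, hadd, self_mem_nhdsWithin] with ρ h1 h3 h4
        have h5 : ρ - S.rho n ≠ 0 := sub_ne_zero.2 h4
        rw [h1, hm]
        simp only [Finset.range_one, Finset.sum_singleton, add_zero, zero_add, pow_one]
        have h6 : ρ ^ 2 - S.lam n = (ρ - S.rho n) * (ρ + S.rho n) := by rw [← S.rho_sq]; ring
        rw [h6]
        field_simp
        ring)
  simpa using key

end IsSpectralData

end SturmLiouville

end

/-! ### Boundedness of α_n and square summability of ξ_n. -/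

noncomputable section

namespace SturmLiouville

open Complex (I)

theorem le_norm_sub_int_of_mem_sphere {n M : ℕ} {ρ : ℂ}
    (h : ρ ∈ Metric.sphere ((n : ℂ) - M) (1 / 4)) (k : ℤ) : 1 / 4 ≤ ‖ρ - k‖ := by
  rw [Metric.mem_sphere, dist_eq_norm] at h
  rcases eq_or_ne k ((n : ℤ) - M) with rfl | hk
  · push_cast; exact h.ge
  · have h1 : (1 : ℝ) ≤ ‖(((n : ℤ) - M - k : ℤ) : ℂ)‖ := by
      rw [Complex.norm_intCast]
      exact_mod_cast Int.one_le_abs (sub_ne_zero.2 hk.symm)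
    have h2 := norm_sub_le (ρ - k) (ρ - ((n : ℂ) - M))
    push_cast at h1
    rw [show ρ - k - (ρ - ((n : ℂ) - M)) = (n : ℂ) - M - k by ring, h] at h2
    linarith

theorem norm_sub_natCast_le_of_mem_sphere {n M : ℕ} {ρ : ℂ}
    (h : ρ ∈ Metric.sphere ((n : ℂ) - M) (1 / 4)) : ‖ρ - n‖ ≤ M + 1 / 4 := by
  rw [Metric.mem_sphere, dist_eq_norm] at h
  have h2 := norm_sub_le (ρ - ((n : ℂ) - M)) M
  rw [show ρ - ((n : ℂ) - M) - M = ρ - n by ring, h, Complex.norm_natCast] at h2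
  linarith

theorem le_norm_of_mem_sphere {n M : ℕ} {ρ : ℂ}
    (h : ρ ∈ Metric.sphere ((n : ℂ) - M) (1 / 4)) : (n : ℝ) - M - 1 / 4 ≤ ‖ρ‖ := by
  have h1 := norm_sub_natCast_le_of_mem_sphere h
  have h2 := norm_sub_norm_le (n : ℂ) ρ
  rw [norm_sub_rev, Complex.norm_natCast] at h2
  linarith

theorem Problem.exists_norm_mul_weyl_sub_le {L : Problem} {M : ℕ} (hL : L.IsNormalized M) :
    ∃ C R : ℝ, 0 < C ∧ 1 ≤ R ∧ ∀ ρ : ℂ, R ≤ ‖ρ‖ → (∀ k : ℤ, 1 / 4 ≤ ‖ρ - k‖) →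
      ‖2 * ρ * L.weyl (ρ ^ 2) - 2 * (Complex.cos (ρ * Real.pi) / Complex.sin (Real.pi * ρ))‖ ≤
        C * err L.refl ρ Real.pi := by
  obtain ⟨C, R, hC, hR, h⟩ := exists_norm_weylSol_sub_le hL
  refine ⟨4 * C, R, by positivity, hR, fun ρ hρ hk => ?_⟩
  have h1 := ((h ρ hρ hk).2 0 zero_mem_Icc_pi).1
  rw [sub_zero, mul_zero, neg_zero, Real.exp_zero, mul_one, ← weyl_eq_weylSol] at h1
  rw [mul_assoc, ← mul_sub, norm_mul, Complex.norm_ofNat]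
  linarith

namespace IsSpectralData

variable {L Lt : Problem} {S T : SpectralSeq} {M : ℕ}

theorem exists_norm_alpha_le (hL : L.IsNormalized M) (hS : IsSpectralData L S) :
    ∃ A : ℝ, 0 < A ∧ ∀ n, ‖S.alpha n‖ ≤ A := by
  obtain ⟨N, hN⟩ := exists_alpha_eq hL hS
  obtain ⟨C, R, hC, hR, h⟩ := Problem.exists_norm_mul_weyl_sub_le hL
  obtain ⟨c, hc, hsin⟩ := exists_le_norm_sin
  obtain ⟨R', hR', herr⟩ := exists_err_le hL.memLp_refl one_pos
  have hev : ∀ᶠ n in atTop, ‖S.alpha n‖ ≤ 1 / 4 * (C + 2 * (1 / c)) := by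
    filter_upwards [eventually_ge_atTop N, eventually_ge_atTop ⌈max R R' + M + 1 / 4⌉₊] with n h1 h2
    have h2' : max R R' + M + 1 / 4 ≤ n := (Nat.le_ceil _).trans (Nat.cast_le.2 h2)
    have h3 := circleIntegral.norm_integral_le_of_norm_le_const
      (f := fun ρ => 2 * ρ * L.weyl (ρ ^ 2)) (c := (n : ℂ) - M) (R := 1 / 4)
      (C := C + 2 * (1 / c)) (by norm_num) fun ρ hρ => by
        have hρn := le_norm_of_mem_sphere hρ
        have hk := le_norm_sub_int_of_mem_sphere hρ
        have e1 := h ρ (by linarith [le_max_left R R']) hk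
        have e2 := herr ρ (by linarith [le_max_right R R']) Real.pi pi_mem_Icc_pi
        have e3 := norm_cos_mul_le ρ Real.pi_nonneg
        have e4 := hsin ρ hk
        rw [mul_comm |ρ.im|] at e3
        have e5 : ‖Complex.cos (ρ * Real.pi) / Complex.sin (Real.pi * ρ)‖ ≤ 1 / c := by
          have hp : 0 < c * Real.exp (Real.pi * |ρ.im|) := by positivity
          rw [norm_div, div_le_div_iff₀ (hp.trans_le e4) hc]
          nlinarith
        have e6 := norm_sub_norm_le (2 * ρ * L.weyl (ρ ^ 2))
          (2 * (Complex.cos (ρ * Real.pi) / Complex.sin (Real.pi * ρ)))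
        rw [norm_mul 2 (Complex.cos _ / _), Complex.norm_ofNat] at e6
        have e7 : C * err L.refl ρ Real.pi ≤ C := mul_le_of_le_one_right hC.le e2
        linarith
    rw [(hN n h1).2, norm_mul, norm_mul, norm_mul, Complex.norm_I, Complex.norm_ofNat,
      Complex.norm_real, Real.norm_of_nonneg Real.pi_nonneg] at h3
    have : 0 < 2 * Real.pi := by positivity
    refine le_of_mul_le_mul_left ?_ this
    linarith
  obtain ⟨A, hA⟩ := (isBoundedUnder_of_eventually_le hev).bddAbove_range
  exact ⟨max A 1, by positivity, fun n => (hA ⟨n, rfl⟩).trans (le_max_left _ _)⟩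

/-- The leading cotangent in 2ρM(ρ²) is the same for both problems, so the difference of the contour
integrals is controlled by the error terms on the circle. -/
theorem summable_sq_norm_alpha_sub (hL : L.IsNormalized M) (hS : IsSpectralData L S)
    (hLt : Lt.IsNormalized M) (hT : IsSpectralData Lt T) :
    Summable fun n : ℕ => ‖S.alpha n - T.alpha n‖ ^ 2 := by
  obtain ⟨N, hN⟩ := exists_alpha_eq hL hS
  obtain ⟨N', hN'⟩ := exists_alpha_eq hLt hT
  obtain ⟨C, R, hC, hR, h⟩ := Problem.exists_norm_mul_weyl_sub_le hL
  obtain ⟨C', R', hC', hR', h'⟩ := Problem.exists_norm_mul_weyl_sub_le hLt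
  set K := max (max N N') ⌈max R R' + M + 1 / 4⌉₊ with hK
  have key : ∀ n, K ≤ n → ∃ ρ ∈ Metric.sphere ((n : ℂ) - M) (1 / 4),
      ‖S.alpha n - T.alpha n‖ ≤ C * err L.refl ρ Real.pi + C' * err Lt.refl ρ Real.pi := by
    intro n hn
    obtain ⟨hc, hi⟩ := hN n (((le_max_left _ _).trans (le_max_left _ _)).trans hn)
    obtain ⟨hc', hi'⟩ := hN' n (((le_max_right _ _).trans (le_max_left _ _)).trans hn)
    have h2' : max R R' + M + 1 / 4 ≤ n :=
      (Nat.le_ceil _).trans (Nat.cast_le.2 ((le_max_right _ _).trans hn))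
    -- The maximum on the circle is attained, and the maximum points form a sequence of frequencies
    -- at bounded distance from the integers, to which the square summability of `err` applies.
    obtain ⟨ρ, hρ, hmax⟩ := (isCompact_sphere ((n : ℂ) - M) (1 / 4)).exists_isMaxOn
      (NormedSpace.sphere_nonempty.2 (by norm_num)) (hc.sub hc').norm
    refine ⟨ρ, hρ, ?_⟩
    have h3 := circleIntegral.norm_integral_le_of_norm_le_const (by norm_num) fun z hz => hmax hz
    simp only [Pi.sub_apply] at h3
    rw [circleIntegral.integral_sub (hc.circleIntegrable (by norm_num))
      (hc'.circleIntegrable (by norm_num)), hi, hi', ← mul_sub, norm_mul, norm_mul, norm_mul,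
      Complex.norm_I, Complex.norm_ofNat, Complex.norm_real,
      Real.norm_of_nonneg Real.pi_nonneg] at h3
    have hρn := le_norm_of_mem_sphere hρ
    have hk := le_norm_sub_int_of_mem_sphere hρ
    have e1 := h ρ (by linarith [le_max_left R R']) hk
    have e2 := h' ρ (by linarith [le_max_right R R']) hk
    have e3 := norm_sub_le_norm_sub_add_norm_sub (2 * ρ * L.weyl (ρ ^ 2))
      (2 * (Complex.cos (ρ * Real.pi) / Complex.sin (Real.pi * ρ))) (2 * ρ * Lt.weyl (ρ ^ 2))
    rw [norm_sub_rev (2 * (Complex.cos _ / _))] at e3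
    have h4 : 0 < 2 * Real.pi := by positivity
    have h5 : ‖S.alpha n - T.alpha n‖ ≤
        1 / 4 * ‖2 * ρ * L.weyl (ρ ^ 2) - 2 * ρ * Lt.weyl (ρ ^ 2)‖ := by
      refine le_of_mul_le_mul_left ?_ h4
      linarith
    linarith [norm_nonneg (2 * ρ * L.weyl (ρ ^ 2) - 2 * ρ * Lt.weyl (ρ ^ 2))]
  choose! ρ hρ hle using key
  have hb : ∀ n, K ≤ n → ‖ρ n - n‖ ≤ M + 1 / 4 ∧ 1 ≤ ‖ρ n‖ := fun n hn => by
    refine ⟨norm_sub_natCast_le_of_mem_sphere (hρ n hn), ?_⟩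
    have h2' : max R R' + M + 1 / 4 ≤ n :=
      (Nat.le_ceil _).trans (Nat.cast_le.2 ((le_max_right _ _).trans hn))
    have := le_norm_of_mem_sphere (hρ n hn)
    linarith [le_max_left R R']
  have s1 := summable_sq_of_le_err hL.memLp_refl (a := fun n => err L.refl (ρ n) Real.pi)
    (ρ := ρ) (B := M + 1 / 4) (C := 1) pi_mem_Icc_pi K fun n hn =>
      ⟨(hb n hn).1, (hb n hn).2, by rw [abs_of_nonneg (err_nonneg _ _ _), one_mul]⟩
  have s2 := summable_sq_of_le_err hLt.memLp_refl (a := fun n => err Lt.refl (ρ n) Real.pi)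
    (ρ := ρ) (B := M + 1 / 4) (C := 1) pi_mem_Icc_pi K fun n hn =>
      ⟨(hb n hn).1, (hb n hn).2, by rw [abs_of_nonneg (err_nonneg _ _ _), one_mul]⟩
  rw [← summable_nat_add_iff K]
  refine Summable.of_nonneg_of_le (fun n => sq_nonneg _) (fun n => ?_)
    ((summable_nat_add_iff K).2 ((s1.mul_left (2 * C ^ 2)).add (s2.mul_left (2 * C' ^ 2))))
  refine (pow_le_pow_left₀ (norm_nonneg _) (hle (n + K) (Nat.le_add_left _ _)) 2).trans ?_
  nlinarith [sq_nonneg (C * err L.refl (ρ (n + K)) Real.pi - C' * err Lt.refl (ρ (n + K)) Real.pi)]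

end IsSpectralData

variable {L Lt : Problem} {S : Fin 2 → SpectralSeq} {M : ℕ}

theorem xi_nonneg (S : Fin 2 → SpectralSeq) (n : ℕ) : 0 ≤ xi S n := by unfold xi; positivity

theorem summable_sq_xi (hL : L.IsNormalized M) (hS : IsSpectralData L (S 0))
    (hLt : Lt.IsNormalized M) (hT : IsSpectralData Lt (S 1)) :
    Summable fun n => xi S n ^ 2 := by
  have h1 := IsSpectralData.summable_sq_norm_alpha_sub hL hS hLt hT
  have h2 := IsSpectralData.summable_sq_norm_rho_sub hL hS
  have h3 := IsSpectralData.summable_sq_norm_rho_sub hLt hT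
  refine Summable.of_nonneg_of_le (fun n => sq_nonneg _) (fun n => ?_)
    (((h1.add h2).add h3).mul_left 3)
  have h4 := norm_sub_le ((S 0).rho n - ((n : ℂ) - M)) ((S 1).rho n - ((n : ℂ) - M))
  rw [sub_sub_sub_cancel_right] at h4
  have h5 : xi S n ≤ ‖(S 0).rho n - ((n : ℂ) - M)‖ + ‖(S 1).rho n - ((n : ℂ) - M)‖ +
    ‖(S 0).alpha n - (S 1).alpha n‖ := by unfold xi; linarith
  refine (pow_le_pow_left₀ (xi_nonneg S n) h5 2).trans ?_
  set a := ‖(S 0).rho n - ((n : ℂ) - M)‖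
  set b := ‖(S 1).rho n - ((n : ℂ) - M)‖
  set c := ‖(S 0).alpha n - (S 1).alpha n‖
  nlinarith [sq_nonneg (a - b), sq_nonneg (a - c), sq_nonneg (b - c)]

end SturmLiouville

end

/-! ### Jets and residues of entire functions along the spectral data. -/

noncomputable section

namespace SturmLiouville

open Complex (I)

section Jets

variable {F : Type*} [NormedAddCommGroup F] [NormedSpace ℂ F]

/-- The Taylor coefficient of `f` that belongs to the index `n` of a sequence with multiplicities. -/
def SpectralSeq.jet (S : SpectralSeq) (n : ℕ) (f : ℂ → F) : F :=
  ((S.pos n)! : ℂ)⁻¹ • iteratedDeriv (S.pos n) f (S.lam n)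

/-- The Laurent coefficient, belonging to the index `k`, of the product of `f` and the principal
part with coefficients `alpha`. -/
def SpectralSeq.res (S : SpectralSeq) (k : ℕ) (f : ℂ → F) : F :=
  ∑ p ∈ Finset.range (S.mult k - S.pos k),
    S.alpha (k + p) • ((p ! : ℂ)⁻¹ • iteratedDeriv p f (S.lam k))

/-- The row transformation with the matrices `matT`, applied to the jets of `f`. -/
def rowT (S : Fin 2 → SpectralSeq) (u : ℕ × Fin 2) (f : ℂ → F) : F :=
  ∑ i, matT S u.1 u.2 i • (S i).jet u.1 f

/-- The column transformation with the matrices `matR`, applied to the Laurent coefficients. -/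
def colR (S : Fin 2 → SpectralSeq) (v : ℕ × Fin 2) (f : ℂ → F) : F :=
  ∑ j, matR S v.1 j v.2 • (S j).res v.1 f

end Jets

/-- If |w − a||w + a| ≤ 1, one of the factors is at most 1. Cauchy estimates on the unit circle in λ
can therefore use bounds on discs in ρ of fixed size. -/
theorem exists_sq_eq_of_norm_sub_le_one {a z : ℂ} (h : ‖z - a ^ 2‖ ≤ 1) :
    ∃ ρ : ℂ, ρ ^ 2 = z ∧ ‖ρ - a‖ ≤ 1 := by
  have hw := sqrtBranch_sq z
  set w := sqrtBranch z
  by_cases h1 : ‖w - a‖ ≤ 1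
  · exact ⟨w, hw, h1⟩
  · refine ⟨-w, by rw [neg_sq, hw], ?_⟩
    rw [← hw, show w ^ 2 - a ^ 2 = (w - a) * (w + a) by ring, norm_mul] at h
    rw [show -w - a = -(w + a) by ring, norm_neg]
    nlinarith [norm_nonneg (w + a)]

section Bounds

variable {f : ℂ → ℂ} {a b c : ℂ} {A B : ℝ}

theorem norm_iteratedDeriv_sq_le (hf : Differentiable ℂ f) (ha : ‖a - c‖ ≤ B)
    (hA : ∀ ρ : ℂ, ‖ρ - c‖ ≤ B + 1 → ‖f (ρ ^ 2)‖ ≤ A) (p : ℕ) :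
    ‖iteratedDeriv p f (a ^ 2)‖ ≤ p ! * A := by
  have h := Complex.norm_iteratedDeriv_le_of_forall_mem_sphere_norm_le (c := a ^ 2) (C := A) p
    one_pos hf.diffContOnCl fun z hz => by
      rw [Metric.mem_sphere, dist_eq_norm] at hz
      obtain ⟨ρ, rfl, hρ⟩ := exists_sq_eq_of_norm_sub_le_one hz.le
      refine hA ρ ?_
      have := norm_sub_le_norm_sub_add_norm_sub ρ a c
      linarith
  simpa using h

/-- The mean value inequality and the Cauchy estimate are both taken in the variable ρ, so no factor
of size |ρ| appears as it would from |λ_n − λ̃_n|. -/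
theorem norm_sub_sq_le (hf : Differentiable ℂ f) (ha : ‖a - c‖ ≤ B) (hb : ‖b - c‖ ≤ B)
    (hA : ∀ ρ : ℂ, ‖ρ - c‖ ≤ B + 1 → ‖f (ρ ^ 2)‖ ≤ A) :
    ‖f (a ^ 2) - f (b ^ 2)‖ ≤ ‖a - b‖ * A := by
  have hg : Differentiable ℂ fun ρ : ℂ => f (ρ ^ 2) := hf.comp (differentiable_id.pow 2)
  have h := (convex_closedBall c B).norm_image_sub_le_of_norm_deriv_le (C := A)
    (fun z _ => hg z) (fun z hz => ?_) (mem_closedBall_iff_norm.2 hb) (mem_closedBall_iff_norm.2 ha)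
  · rwa [mul_comm] at h
  · have h1 := Complex.norm_deriv_le_of_forall_mem_sphere_norm_le (c := z) (C := A)
      one_pos hg.diffContOnCl fun w hw => hA w (by
        rw [mem_sphere_iff_norm] at hw
        rw [mem_closedBall_iff_norm] at hz
        have := norm_sub_le_norm_sub_add_norm_sub w z c
        linarith)
    rwa [div_one] at h1

theorem SpectralSeq.norm_jet_le {S : SpectralSeq} {n : ℕ} (hf : Differentiable ℂ f)
    (ha : ‖S.rho n - c‖ ≤ B) (hA : ∀ ρ : ℂ, ‖ρ - c‖ ≤ B + 1 → ‖f (ρ ^ 2)‖ ≤ A) :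
    ‖S.jet n f‖ ≤ A := by
  have h := norm_iteratedDeriv_sq_le hf ha hA (S.pos n)
  rw [S.rho_sq] at h
  rw [jet, norm_smul, norm_inv, Complex.norm_natCast]
  have hp : (0 : ℝ) < (S.pos n)! := by exact_mod_cast Nat.factorial_pos _
  rwa [inv_mul_le_iff₀ hp]

theorem SpectralSeq.norm_res_le {S : SpectralSeq} {n : ℕ} {α : ℝ} (hα : ∀ k, ‖S.alpha k‖ ≤ α)
    (hf : Differentiable ℂ f)
    (ha : ‖S.rho n - c‖ ≤ B) (hA : ∀ ρ : ℂ, ‖ρ - c‖ ≤ B + 1 → ‖f (ρ ^ 2)‖ ≤ A) :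
    ‖S.res n f‖ ≤ S.mult n * (α * A) := by
  have hα0 : 0 ≤ α := (norm_nonneg _).trans (hα 0)
  have hA0 : 0 ≤ A := (norm_nonneg _).trans (S.norm_jet_le hf ha hA)
  have hterm : ∀ p ∈ Finset.range (S.mult n - S.pos n),
      ‖S.alpha (n + p) • ((p ! : ℂ)⁻¹ • iteratedDeriv p f (S.lam n))‖ ≤ α * A := fun p _ => by
    have h := norm_iteratedDeriv_sq_le hf ha hA p
    rw [S.rho_sq] at h
    rw [norm_smul, norm_smul, norm_inv, Complex.norm_natCast]
    have hp : (0 : ℝ) < p ! := by exact_mod_cast Nat.factorial_pos _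
    rw [← inv_mul_le_iff₀ hp] at h
    exact mul_le_mul (hα _) h (by positivity) hα0
  refine (norm_sum_le_of_le _ hterm).trans ?_
  rw [Finset.sum_const, Finset.card_range, nsmul_eq_mul]
  have : ((S.mult n - S.pos n : ℕ) : ℝ) ≤ S.mult n := Nat.cast_le.2 (Nat.sub_le _ _)
  gcongr

end Bounds

section Transformations

variable {F : Type*} [NormedAddCommGroup F] [NormedSpace ℂ F] (S : Fin 2 → SpectralSeq) (n : ℕ)
  (f : ℂ → F)

theorem rowT_zero : rowT S (n, 0) f = (chi S n : ℂ) • ((S 0).jet n f - (S 1).jet n f) := by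
  simp [rowT, matT, Fin.sum_univ_two, sub_eq_add_neg]

theorem rowT_one : rowT S (n, 1) f = (S 1).jet n f := by
  simp [rowT, matT, Fin.sum_univ_two]

theorem colR_zero : colR S (n, 0) f = (xi S n : ℂ) • (S 0).res n f := by
  simp [colR, matR, Fin.sum_univ_two]

theorem colR_one : colR S (n, 1) f = (S 0).res n f - (S 1).res n f := by
  simp [colR, matR, Fin.sum_univ_two, sub_eq_add_neg]

theorem chi_nonneg : 0 ≤ chi S n := by
  unfold chi
  split_ifs
  · exact le_rfl
  · exact inv_nonneg.2 (xi_nonneg S n)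

theorem chi_mul_xi_le : chi S n * xi S n ≤ 1 := by
  unfold chi
  split_ifs with h
  · simp
  · rw [inv_mul_cancel₀ h]

end Transformations

variable {L Lt : Problem} {S : Fin 2 → SpectralSeq} {M : ℕ}

/-- For large n both spectra are simple: differences of values are of order ξ_n, which χ_n
normalises in the rows and which remains as a gain in the columns. The finitely many other n only
affect the constant. -/
theorem exists_jet_bounds (hL : L.IsNormalized M) (hS : IsSpectralData L (S 0))
    (hLt : Lt.IsNormalized M) (hT : IsSpectralData Lt (S 1)) :
    ∃ (C R : ℝ) (η : ℕ → ℝ), 0 < C ∧ 0 < R ∧ (∀ n, 0 ≤ η n) ∧ (Summable fun n => η n ^ 2) ∧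
      ∀ f : ℂ → ℂ, Differentiable ℂ f → ∀ (n : ℕ) (A : ℝ),
        (∀ ρ : ℂ, ‖ρ - n‖ ≤ R → ‖f (ρ ^ 2)‖ ≤ A) → ∀ i,
          ‖(S i).jet n f‖ ≤ C * A ∧ ‖rowT S (n, i) f‖ ≤ C * A ∧ ‖colR S (n, i) f‖ ≤ C * η n * A := by
  obtain ⟨B₀, hB₀, hB₀n⟩ := IsSpectralData.exists_norm_rho_sub_le hL hS
  obtain ⟨B₁, hB₁, hB₁n⟩ := IsSpectralData.exists_norm_rho_sub_le hLt hT
  obtain ⟨α₀, hα₀, hα₀n⟩ := IsSpectralData.exists_norm_alpha_le hL hS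
  obtain ⟨α₁, hα₁, hα₁n⟩ := IsSpectralData.exists_norm_alpha_le hLt hT
  obtain ⟨N₀, hN₀⟩ := IsSpectralData.exists_mult_eq_one hL hS
  obtain ⟨N₁, hN₁⟩ := IsSpectralData.exists_mult_eq_one hLt hT
  set N := max N₀ N₁ with hN
  set B := max B₀ B₁ with hB
  set α := max α₀ α₁ with hα
  have hαn : ∀ i k, ‖(S i).alpha k‖ ≤ α := fun i k => by
    fin_cases i
    · exact (hα₀n k).trans (le_max_left _ _)
    · exact (hα₁n k).trans (le_max_right _ _)
  have hBn : ∀ i n, ‖(S i).rho n - n‖ ≤ B := fun i n => by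
    fin_cases i
    · exact (hB₀n n).trans (le_max_left _ _)
    · exact (hB₁n n).trans (le_max_right _ _)
  have hsimple : ∀ i n, N ≤ n → (S i).mult n = 1 ∧ (S i).pos n = 0 := fun i n hn => by
    fin_cases i
    · exact hN₀ n ((le_max_left _ _).trans hn)
    · exact hN₁ n ((le_max_right _ _).trans hn)
  have hα0 : 0 < α := lt_max_of_lt_left hα₀
  set X := ∑ n ∈ Finset.range N, chi S n with hX
  set Y := ∑ n ∈ Finset.range N, ((S 0).mult n + (S 1).mult n : ℝ) with hY
  have hX0 : 0 ≤ X := Finset.sum_nonneg fun n _ => chi_nonneg S n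
  have hY0 : 0 ≤ Y := Finset.sum_nonneg fun n _ => by positivity
  -- Where multiplicities may occur, the residues for the two problems can differ even if ξ_n = 0,
  -- since they involve later members of the block. Adding 1 for these finitely many n keeps square
  -- summability.
  set η : ℕ → ℝ := fun n => xi S n + if n < N then 1 else 0 with hη
  have hη0 : ∀ n, 0 ≤ η n := fun n => add_nonneg (xi_nonneg S n) (by split_ifs <;> norm_num)
  have hηxi : ∀ n, xi S n ≤ η n := fun n => by
    have : (0 : ℝ) ≤ if n < N then 1 else 0 := by split_ifs <;> norm_num
    simp only [hη]; linarith
  refine ⟨1 + 2 * X + (2 * Y + 1) * (2 * α + 1), B + 1, η, by positivity,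
    by have : 0 < B := lt_max_of_lt_left hB₀
       linarith, hη0, ?_, ?_⟩
  · have h1 : Summable fun n : ℕ => if n < N then (1 : ℝ) else 0 :=
      summable_of_ne_finset_zero (s := Finset.range N) fun n hn => by
        rw [if_neg]; simpa using hn
    refine Summable.of_nonneg_of_le (fun n => sq_nonneg _) (fun n => ?_)
      (((summable_sq_xi hL hS hLt hT).mul_left 2).add (h1.mul_left 2))
    simp only [hη]
    have h2 : (if n < N then (1 : ℝ) else 0) ^ 2 = if n < N then 1 else 0 := by
      split_ifs <;> norm_num
    nlinarith [sq_nonneg (xi S n - if n < N then (1 : ℝ) else 0)]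
  · intro f hf n A hA i
    have hjet : ∀ i, ‖(S i).jet n f‖ ≤ A := fun i => (S i).norm_jet_le hf (hBn i n) hA
    have hres : ∀ i, ‖(S i).res n f‖ ≤ (S i).mult n * (α * A) := fun i =>
      (S i).norm_res_le (hαn i) hf (hBn i n) hA
    have hA0 : 0 ≤ A := (norm_nonneg _).trans (hjet 0)
    have hdiff : ‖f ((S 0).lam n) - f ((S 1).lam n)‖ ≤ ‖(S 0).rho n - (S 1).rho n‖ * A := by
      rw [← (S 0).rho_sq, ← (S 1).rho_sq]
      exact norm_sub_sq_le hf (hBn 0 n) (hBn 1 n) hA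
    have hYα : 0 ≤ (2 * Y + 1) * (2 * α + 1) := by positivity
    have hrow0 : ‖rowT S (n, 0) f‖ ≤ (1 + 2 * X) * A := by
      rw [rowT_zero, norm_smul, Complex.norm_real, Real.norm_of_nonneg (chi_nonneg S n)]
      by_cases hn : n < N
      · have h1 : chi S n ≤ X := Finset.single_le_sum (f := fun n => chi S n)
          (fun n _ => chi_nonneg S n) (Finset.mem_range.2 hn)
        have h2 := norm_sub_le ((S 0).jet n f) ((S 1).jet n f)
        calc _ ≤ X * (2 * A) := by
              gcongr
              linarith [hjet 0, hjet 1]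
          _ ≤ _ := by nlinarith
      · have hs := fun i => (hsimple i n (not_lt.1 hn)).2
        have e : ∀ i, (S i).jet n f = f ((S i).lam n) := fun i => by
          simp [SpectralSeq.jet, hs i]
        rw [e, e]
        have h3 : ‖(S 0).rho n - (S 1).rho n‖ ≤ xi S n := by
          unfold xi; linarith [norm_nonneg ((S 0).alpha n - (S 1).alpha n)]
        calc _ ≤ chi S n * (xi S n * A) := by
              have := chi_nonneg S n
              gcongr
              exact hdiff.trans (by gcongr)
          _ ≤ 1 * A := by
              rw [← mul_assoc]
              gcongr
              exact chi_mul_xi_le S n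
          _ ≤ _ := by nlinarith
    have hmultY : ∀ i, n < N → ((S i).mult n : ℝ) ≤ Y := fun i hn => by
      have h1 : ((S 0).mult n + (S 1).mult n : ℝ) ≤ Y :=
        Finset.single_le_sum (f := fun n => ((S 0).mult n + (S 1).mult n : ℝ))
          (fun n _ => by positivity) (Finset.mem_range.2 hn)
      have h2 : (0 : ℝ) ≤ (S 0).mult n := Nat.cast_nonneg _
      have h3 : (0 : ℝ) ≤ (S 1).mult n := Nat.cast_nonneg _
      fin_cases i
      · show ((S 0).mult n : ℝ) ≤ Y
        linarith
      · show ((S 1).mult n : ℝ) ≤ Y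
        linarith
    have hmult : ∀ i, ((S i).mult n : ℝ) ≤ Y + 1 := fun i => by
      by_cases hn : n < N
      · linarith [hmultY i hn]
      · rw [(hsimple i n (not_lt.1 hn)).1]
        push_cast
        linarith
    have hcol0 : ‖colR S (n, 0) f‖ ≤ (Y + 1) * α * (η n * A) := by
      rw [colR_zero, norm_smul, Complex.norm_real, Real.norm_of_nonneg (xi_nonneg S n)]
      calc _ ≤ η n * ((Y + 1) * (α * A)) :=
            mul_le_mul (hηxi n) ((hres 0).trans (by gcongr; exact hmult 0)) (norm_nonneg _) (hη0 n)
        _ = _ := by ring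
    have hcol1 : ‖colR S (n, 1) f‖ ≤ (2 * Y + 1) * (2 * α + 1) * (η n * A) := by
      rw [colR_one]
      by_cases hn : n < N
      · have h1 : 1 ≤ η n := by
          simp only [hη]; rw [if_pos hn]; linarith [xi_nonneg S n]
        have h2 := norm_sub_le ((S 0).res n f) ((S 1).res n f)
        have h3 := fun i => (hres i).trans (mul_le_mul_of_nonneg_right (hmultY i hn)
          (by positivity : 0 ≤ α * A))
        calc _ ≤ (2 * Y * α) * (1 * A) := by linarith [h3 0, h3 1]
          _ ≤ (2 * Y + 1) * (2 * α + 1) * (η n * A) := by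
              gcongr <;> linarith
      · have hs := fun i => hsimple i n (not_lt.1 hn)
        have e : ∀ i, (S i).res n f = (S i).alpha n * f ((S i).lam n) := fun i => by
          simp [SpectralSeq.res, hs i]
        -- The change of αf is split into the change of the point and the change of the coefficient,
        -- each of order ξ_n.
        rw [e, e, show (S 0).alpha n * f ((S 0).lam n) - (S 1).alpha n * f ((S 1).lam n) =
          (S 0).alpha n * (f ((S 0).lam n) - f ((S 1).lam n)) +
            ((S 0).alpha n - (S 1).alpha n) * f ((S 1).lam n) by ring]
        have hf1 : ‖f ((S 1).lam n)‖ ≤ A := by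
          have := hjet 1
          rwa [show (S 1).jet n f = f ((S 1).lam n) by simp [SpectralSeq.jet, hs 1]] at this
        have h3 : ‖(S 0).rho n - (S 1).rho n‖ ≤ xi S n := by
          unfold xi; linarith [norm_nonneg ((S 0).alpha n - (S 1).alpha n)]
        have h4 : ‖(S 0).alpha n - (S 1).alpha n‖ ≤ xi S n := by
          unfold xi; linarith [norm_nonneg ((S 0).rho n - (S 1).rho n)]
        have h5 := hηxi n
        calc _ ≤ α * (η n * A) + η n * A := by
              refine (norm_add_le _ _).trans ?_
              rw [norm_mul, norm_mul]
              refine add_le_add (mul_le_mul (hαn 0 n) (hdiff.trans ?_) (norm_nonneg _) hα0.le)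
                (mul_le_mul (h4.trans h5) hf1 (norm_nonneg _) (hη0 n))
              exact mul_le_mul_of_nonneg_right (h3.trans h5) hA0
          _ = (1 * (α + 1)) * (η n * A) := by ring
          _ ≤ (2 * Y + 1) * (2 * α + 1) * (η n * A) := by
              have := hη0 n
              gcongr <;> linarith
    refine ⟨?_, ?_, ?_⟩
    · refine (hjet i).trans ?_
      nlinarith [mul_nonneg hYα hA0, mul_nonneg hX0 hA0]
    · fin_cases i
      · exact hrow0.trans (mul_le_mul_of_nonneg_right (by linarith) hA0)
      · show ‖rowT S (n, 1) f‖ ≤ _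
        rw [rowT_one]
        refine (hjet 1).trans ?_
        nlinarith [mul_nonneg hYα hA0, mul_nonneg hX0 hA0]
    · have hηA : 0 ≤ η n * A := mul_nonneg (hη0 n) hA0
      rw [mul_assoc]
      fin_cases i
      · refine hcol0.trans (mul_le_mul_of_nonneg_right ?_ hηA)
        nlinarith [mul_nonneg hY0 hα0.le]
      · exact hcol1.trans (mul_le_mul_of_nonneg_right (by linarith) hηA)

end SturmLiouville

end

/-! ### The kernel D as a bilinear form in the solutions. -/

noncomputable section

namespace SturmLiouville

open Complex (I)

theorem continuous_fst_IccExtend (f : C(Icc 0 Real.pi, ℂ × ℂ)) :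
    Continuous fun t => (IccExtend Real.pi_nonneg f t).1 :=
  continuous_fst.comp (f.continuous.Icc_extend' (h := Real.pi_nonneg))

theorem norm_fst_IccExtend_le (f : C(Icc 0 Real.pi, ℂ × ℂ)) (t : ℝ) :
    ‖(IccExtend Real.pi_nonneg f t).1‖ ≤ ‖f‖ :=
  (norm_fst_le _).trans (f.norm_coe_le_norm _)

theorem intervalIntegrable_fst_mul_fst (f g : C(Icc 0 Real.pi, ℂ × ℂ)) (a b : ℝ) :
    IntervalIntegrable (fun t => (IccExtend Real.pi_nonneg f t).1 *
      (IccExtend Real.pi_nonneg g t).1) volume a b :=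
  ((continuous_fst_IccExtend f).mul (continuous_fst_IccExtend g)).intervalIntegrable a b

/-- The bilinear form `(f, g) ↦ ∫₀ˣ f₁ g₁`. -/
def intForm {x : ℝ} (hx : x ∈ Icc 0 Real.pi) :
    C(Icc 0 Real.pi, ℂ × ℂ) →L[ℂ] C(Icc 0 Real.pi, ℂ × ℂ) →L[ℂ] ℂ :=
  LinearMap.mkContinuous₂ (LinearMap.mk₂ ℂ (fun f g => ∫ t in 0..x,
      (IccExtend Real.pi_nonneg f t).1 * (IccExtend Real.pi_nonneg g t).1)
    (fun f f' g => by
      rw [← intervalIntegral.integral_add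
        (intervalIntegrable_fst_mul_fst f g _ _)
        (intervalIntegrable_fst_mul_fst f' g _ _)]
      exact intervalIntegral.integral_congr fun t _ => add_mul _ _ _)
    (fun c f g => by
      rw [smul_eq_mul, ← intervalIntegral.integral_const_mul]
      exact intervalIntegral.integral_congr fun t _ => mul_assoc _ _ _)
    (fun f g g' => by
      rw [← intervalIntegral.integral_add
        (intervalIntegrable_fst_mul_fst f g _ _)
        (intervalIntegrable_fst_mul_fst f g' _ _)]
      exact intervalIntegral.integral_congr fun t _ => mul_add _ _ _)
    (fun c f g => by
      rw [smul_eq_mul, ← intervalIntegral.integral_const_mul]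
      exact intervalIntegral.integral_congr fun t _ => mul_left_comm _ _ _)) x
    fun f g => by
      have h := intervalIntegral.norm_integral_le_of_norm_le_const (a := 0) (b := x)
        (C := ‖f‖ * ‖g‖) (f := fun t => (IccExtend Real.pi_nonneg f t).1 *
          (IccExtend Real.pi_nonneg g t).1) fun t _ => by
          rw [norm_mul]
          exact mul_le_mul (norm_fst_IccExtend_le f t) (norm_fst_IccExtend_le g t)
            (norm_nonneg _) (norm_nonneg _)
      rw [sub_zero, abs_of_nonneg hx.1] at h
      exact h.trans (le_of_eq (by ring))

theorem intForm_apply {x : ℝ} (hx : x ∈ Icc 0 Real.pi) (f g : C(Icc 0 Real.pi, ℂ × ℂ)) :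
    intForm hx f g = ∫ t in 0..x,
      (IccExtend Real.pi_nonneg f t).1 * (IccExtend Real.pi_nonneg g t).1 := rfl

section Commute

variable {E F : Type*} [NormedAddCommGroup E] [NormedSpace ℂ E] [NormedAddCommGroup F]
  [NormedSpace ℂ F] [CompleteSpace E]

/-- Because solutions depend analytically on l in the sup norm, derivatives in l pass through
bounded linear functionals. This avoids differentiating under the integral in D. -/
theorem iteratedDeriv_clm_comp (Λ : E →L[ℂ] F) {f : ℂ → E} (hf : Differentiable ℂ f) (p : ℕ) :
    iteratedDeriv p (fun z => Λ (f z)) = fun z => Λ (iteratedDeriv p f z) := by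
  induction p with
  | zero => simp
  | succ p ih =>
    ext z
    have hd : DifferentiableAt ℂ (iteratedDeriv p f) z :=
      (hf.contDiff (n := (p + 1 : ℕ))).differentiable_iteratedDeriv p
        (by exact_mod_cast Nat.lt_succ_self p) z
    rw [iteratedDeriv_succ, ih, iteratedDeriv_succ]
    exact (Λ.hasFDerivAt.comp_hasDerivAt z hd.hasDerivAt).deriv

theorem SpectralSeq.jet_clm_comp (S : SpectralSeq) (Λ : E →L[ℂ] F) {f : ℂ → E}
    (hf : Differentiable ℂ f) (n : ℕ) : S.jet n (fun z => Λ (f z)) = Λ (S.jet n f) := by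
  rw [jet, jet, iteratedDeriv_clm_comp Λ hf, map_smul]

theorem SpectralSeq.res_clm_comp (S : SpectralSeq) (Λ : E →L[ℂ] F) {f : ℂ → E}
    (hf : Differentiable ℂ f) (n : ℕ) : S.res n (fun z => Λ (f z)) = Λ (S.res n f) := by
  rw [res, res, map_sum]
  refine Finset.sum_congr rfl fun p _ => ?_
  rw [iteratedDeriv_clm_comp Λ hf, map_smul, map_smul]

theorem rowT_clm_comp (S : Fin 2 → SpectralSeq) (Λ : E →L[ℂ] F) {f : ℂ → E}
    (hf : Differentiable ℂ f) (u : ℕ × Fin 2) : rowT S u (fun z => Λ (f z)) = Λ (rowT S u f) := by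
  rw [rowT, rowT, map_sum]
  refine Finset.sum_congr rfl fun i _ => ?_
  rw [SpectralSeq.jet_clm_comp _ Λ hf, map_smul]

theorem colR_clm_comp (S : Fin 2 → SpectralSeq) (Λ : E →L[ℂ] F) {f : ℂ → E}
    (hf : Differentiable ℂ f) (v : ℕ × Fin 2) : colR S v (fun z => Λ (f z)) = Λ (colR S v f) := by
  rw [colR, colR, map_sum]
  refine Finset.sum_congr rfl fun i _ => ?_
  rw [SpectralSeq.res_clm_comp _ Λ hf, map_smul]

end Commute

variable {L : Problem} {M : ℕ} {x : ℝ}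

theorem wronskian_eq_integral (hL : L.IsNormalized M) (hx : x ∈ Icc 0 Real.pi) (l m : ℂ) :
    wronskian L x l m = (l - m) * intForm hx (solutionMap hL.memLp (1, 0) l)
      (solutionMap hL.memLp (1, 0) m) := by
  have h := (isSolution_solution hL.memLp zero_mem_Icc_pi l (1, 0)).wronskian_eq hL.memLp
    (isSolution_solution hL.memLp zero_mem_Icc_pi m (1, 0)) hx
  simp only [mul_zero, zero_mul, sub_self, zero_add] at h
  rw [intForm_apply, wronskian]
  refine h.trans ?_
  congr 1
  refine intervalIntegral.integral_congr fun t ht => ?_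
  rw [uIcc_of_le hx.1] at ht
  have ht' : t ∈ Icc 0 Real.pi := ⟨ht.1, ht.2.trans hx.2⟩
  rw [IccExtend_of_mem _ _ ht', IccExtend_of_mem _ _ ht', solutionMap_apply, solutionMap_apply]

/-- The Lagrange identity gives D(l, m) = ∫φ(l)φ(m) off the diagonal, and the right-hand side is
continuous across it. Symmetry and analyticity of D in each variable become visible. -/
theorem kernelD_eq (hL : L.IsNormalized M) (hx : x ∈ Icc 0 Real.pi) (l m : ℂ) :
    kernelD L x l m = intForm hx (solutionMap hL.memLp (1, 0) l)
      (solutionMap hL.memLp (1, 0) m) := by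
  unfold kernelD
  split_ifs with h
  · subst h
    refine Tendsto.limUnder_eq ?_
    have hc : Continuous fun ν => intForm hx (solutionMap hL.memLp (1, 0) l)
        (solutionMap hL.memLp (1, 0) ν) :=
      (intForm hx _).continuous.comp (differentiable_solutionMap hL.memLp (1, 0)).continuous
    refine Tendsto.congr' ?_ ((hc.tendsto l).mono_left nhdsWithin_le_nhds)
    filter_upwards [self_mem_nhdsWithin] with ν hν
    rw [wronskian_eq_integral hL hx, mul_div_cancel_left₀ _ (sub_ne_zero.2 (Ne.symm hν))]
  · rw [wronskian_eq_integral hL hx, mul_div_cancel_left₀ _ (sub_ne_zero.2 h)]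

theorem wronskian_eq_kernelD (hL : L.IsNormalized M) (hx : x ∈ Icc 0 Real.pi) (l m : ℂ) :
    wronskian L x l m = (l - m) * kernelD L x l m := by
  rw [kernelD_eq hL hx, wronskian_eq_integral hL hx]

theorem kernelD_comm (hL : L.IsNormalized M) (hx : x ∈ Icc 0 Real.pi) (l m : ℂ) :
    kernelD L x l m = kernelD L x m l := by
  rw [kernelD_eq hL hx, kernelD_eq hL hx, intForm_apply, intForm_apply]
  exact intervalIntegral.integral_congr fun t _ => mul_comm _ _

theorem differentiable_kernelD_right (hL : L.IsNormalized M) (hx : x ∈ Icc 0 Real.pi) (l : ℂ) :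
    Differentiable ℂ fun m => kernelD L x l m := by
  rw [funext fun m => kernelD_eq hL hx l m]
  exact (intForm hx _).differentiable.comp (differentiable_solutionMap hL.memLp (1, 0))

theorem differentiable_kernelD_left (hL : L.IsNormalized M) (hx : x ∈ Icc 0 Real.pi) (m : ℂ) :
    Differentiable ℂ fun l => kernelD L x l m := by
  rw [funext fun l => kernelD_comm hL hx l m]
  exact differentiable_kernelD_right hL hx m

theorem phiVal_eq_jet (L : Problem) (S : SpectralSeq) (x : ℝ) (n : ℕ) :
    phiVal L S x n = S.jet n (L.phi x) := div_eq_inv_mul _ _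

theorem coeffA_eq_res (L : Problem) (S : SpectralSeq) (x : ℝ) (l : ℂ) (k : ℕ) :
    coeffA L S x l k = S.res k (fun m => kernelD L x l m) :=
  Finset.sum_congr rfl fun p _ => by rw [div_eq_inv_mul]; rfl

theorem matQ_eq_jet (L : Problem) (S : Fin 2 → SpectralSeq) (x : ℝ) (u v : ℕ × Fin 2) :
    matQ L S x u v = (S u.2).jet u.1 (fun l => coeffA L (S v.2) x l v.1) := div_eq_inv_mul _ _

theorem coeffA_eq_intForm (hL : L.IsNormalized M) (hx : x ∈ Icc 0 Real.pi) (S : SpectralSeq)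
    (l : ℂ) (k : ℕ) : coeffA L S x l k = (intForm hx).flip
      (S.res k (solutionMap hL.memLp (1, 0))) (solutionMap hL.memLp (1, 0) l) := by
  rw [coeffA_eq_res, ContinuousLinearMap.flip_apply,
    ← S.res_clm_comp _ (differentiable_solutionMap hL.memLp (1, 0))]
  congr 1
  ext m
  exact kernelD_eq hL hx l m

theorem differentiable_coeffA (hL : L.IsNormalized M) (hx : x ∈ Icc 0 Real.pi) (S : SpectralSeq)
    (k : ℕ) : Differentiable ℂ fun l => coeffA L S x l k := by
  rw [funext fun l => coeffA_eq_intForm hL hx S l k]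
  exact (ContinuousLinearMap.differentiable _).comp (differentiable_solutionMap hL.memLp (1, 0))

theorem matQ_eq_intForm (hL : L.IsNormalized M) (hx : x ∈ Icc 0 Real.pi)
    (S : Fin 2 → SpectralSeq) (u v : ℕ × Fin 2) :
    matQ L S x u v = intForm hx ((S u.2).jet u.1 (solutionMap hL.memLp (1, 0)))
      ((S v.2).res v.1 (solutionMap hL.memLp (1, 0))) := by
  rw [matQ_eq_jet, funext fun l => coeffA_eq_intForm hL hx (S v.2) l v.1,
    SpectralSeq.jet_clm_comp _ _ (differentiable_solutionMap hL.memLp (1, 0))]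
  rfl

theorem psiVec_eq_rowT (L : Problem) (S : Fin 2 → SpectralSeq) (x : ℝ) (u : ℕ × Fin 2) :
    psiVec L S x u = rowT S u (L.phi x) := by
  rw [psiVec, rowT, Matrix.mulVec, dotProduct]
  simp only [phiVal_eq_jet, smul_eq_mul]

/-- The row transformation acts on one argument of the bilinear form and the column transformation
on the other, so they can be estimated one after the other. -/
theorem matH_eq_intForm (hL : L.IsNormalized M) (hx : x ∈ Icc 0 Real.pi)
    (S : Fin 2 → SpectralSeq) (u v : ℕ × Fin 2) :
    matH L S x u v = intForm hx (rowT S u (solutionMap hL.memLp (1, 0)))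
      (colR S v (solutionMap hL.memLp (1, 0))) := by
  rw [matH, rowT, colR]
  simp only [Matrix.mul_apply, Matrix.of_apply, matQ_eq_intForm hL hx, map_add, map_smul,
    add_apply, smul_apply, smul_eq_mul, Fin.sum_univ_two]
  ring

theorem intForm_colR (hL : L.IsNormalized M) (hx : x ∈ Icc 0 Real.pi)
    (S : Fin 2 → SpectralSeq) (y : C(Icc 0 Real.pi, ℂ × ℂ)) (v : ℕ × Fin 2) :
    intForm hx y (colR S v (solutionMap hL.memLp (1, 0))) =
      colR S v (fun m => intForm hx y (solutionMap hL.memLp (1, 0) m)) :=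
  (colR_clm_comp S _ (differentiable_solutionMap hL.memLp (1, 0)) v).symm

end SturmLiouville

end

/-! ### Off-diagonal decay and uniform bounds for the rows of the matrix. -/

noncomputable section

namespace SturmLiouville

open Complex (I)

variable {L Lt : Problem} {S : Fin 2 → SpectralSeq} {M : ℕ} {x : ℝ}

/-- Small ρ are covered by continuity on a compact disc; the factor 1 + ‖ρ‖ replaces ‖ρ‖ for this
reason. -/
theorem Problem.exists_norm_phi_le_all (hL : L.IsNormalized M) : ∃ C : ℝ, 0 < C ∧ ∀ ρ : ℂ,
    ∀ x ∈ Icc 0 Real.pi, ‖L.phi x (ρ ^ 2)‖ ≤ C * Real.exp (|ρ.im| * x) ∧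
      ‖L.phiQ x (ρ ^ 2)‖ ≤ C * (1 + ‖ρ‖) * Real.exp (|ρ.im| * x) := by
  obtain ⟨C, hC, h⟩ := exists_norm_phi_le hL
  obtain ⟨C', hC'⟩ := (isCompact_closedBall (0 : ℂ) 1).exists_bound_of_continuousOn
    ((differentiable_solutionMap hL.memLp (1, 0)).continuous.comp
      (continuous_pow 2)).continuousOn
  have hC'0 : 0 ≤ C' := (norm_nonneg _).trans (hC' 0 (Metric.mem_closedBall_self zero_le_one))
  refine ⟨C + C', by positivity, fun ρ x hx => ?_⟩
  have hE : 1 ≤ Real.exp (|ρ.im| * x) := Real.one_le_exp (mul_nonneg (abs_nonneg _) hx.1)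
  rcases le_total 1 ‖ρ‖ with hρ | hρ
  · obtain ⟨h1, h2⟩ := h ρ hρ x hx
    constructor
    · refine h1.trans ?_
      gcongr
      linarith
    · refine h2.trans ?_
      gcongr <;> linarith
  · have h1 := hC' ρ (by rwa [mem_closedBall_zero_iff])
    rw [Function.comp_apply] at h1
    have h2 := ((solutionMap hL.memLp (1, 0) (ρ ^ 2)).norm_coe_le_norm ⟨x, hx⟩).trans h1
    rw [solutionMap_apply] at h2
    constructor
    · refine ((norm_fst_le _).trans h2).trans ?_
      nlinarith
    · refine ((norm_snd_le _).trans h2).trans ?_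
      have : 1 ≤ (1 + ‖ρ‖) * Real.exp (|ρ.im| * x) :=
        one_le_mul_of_one_le_of_one_le (by linarith [norm_nonneg ρ]) hE
      nlinarith

theorem abs_im_le_of_norm_sub_natCast_le {ρ : ℂ} {n : ℕ} {R : ℝ} (h : ‖ρ - n‖ ≤ R) :
    |ρ.im| ≤ R := by
  have := (Complex.abs_im_le_norm (ρ - n)).trans h
  simpa using this

theorem Problem.exists_norm_phi_le_strip (hL : L.IsNormalized M) (R : ℝ) : ∃ C : ℝ, 0 < C ∧
    ∀ (ρ : ℂ) (n : ℕ), ‖ρ - n‖ ≤ R → ∀ x ∈ Icc 0 Real.pi, ‖L.phi x (ρ ^ 2)‖ ≤ C ∧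
      ‖L.phiQ x (ρ ^ 2)‖ ≤ C * (1 + ‖ρ‖) := by
  obtain ⟨C, hC, h⟩ := exists_norm_phi_le_all hL
  refine ⟨C * Real.exp (R * Real.pi), by positivity, fun ρ n hρ x hx => ?_⟩
  have hE : Real.exp (|ρ.im| * x) ≤ Real.exp (R * Real.pi) := by
    rw [Real.exp_le_exp]
    exact mul_le_mul (abs_im_le_of_norm_sub_natCast_le hρ) hx.2 hx.1
      ((norm_nonneg _).trans hρ)
  obtain ⟨h1, h2⟩ := h ρ x hx
  refine ⟨h1.trans (by gcongr), h2.trans ?_⟩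
  rw [mul_right_comm]
  gcongr

/-- Off-diagonal decay of the kernel `D`. -/
theorem exists_norm_kernelD_le (hL : L.IsNormalized M) (hx : x ∈ Icc 0 Real.pi) (R : ℝ)
    (hR : 0 ≤ R) : ∃ C : ℝ, 0 < C ∧ ∀ (ρ θ : ℂ) (n k : ℕ), ‖ρ - n‖ ≤ R → ‖θ - k‖ ≤ R →
      ‖kernelD L x (ρ ^ 2) (θ ^ 2)‖ ≤ C / (1 + |(n : ℝ) - k|) := by
  obtain ⟨C, hC, h⟩ := Problem.exists_norm_phi_le_strip hL R
  have hpi := Real.pi_pos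
  refine ⟨C ^ 2 * Real.pi * (4 * R + 2) + 32 * (R + 1) * C ^ 2, by positivity,
    fun ρ θ n k hρ hθ => ?_⟩
  have hd : 0 < 1 + |(n : ℝ) - k| := by positivity
  rw [le_div_iff₀ hd]
  -- Close to the diagonal the integral form bounds D by a constant. Far from it, D is the Wronskian
  -- over (ρ − θ)(ρ + θ); the numerator grows at most like n + k, which ρ + θ compensates, and ρ − θ
  -- supplies the decay.
  rcases le_total |(n : ℝ) - k| (4 * R + 1) with hc | hc
  · have h1 : ‖kernelD L x (ρ ^ 2) (θ ^ 2)‖ ≤ C ^ 2 * Real.pi := by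
      rw [kernelD_eq hL hx, intForm_apply]
      have h2 := intervalIntegral.norm_integral_le_of_norm_le_const (a := 0) (b := x)
        (C := C ^ 2) (f := fun t => (IccExtend Real.pi_nonneg (solutionMap hL.memLp (1, 0) (ρ ^ 2)) t).1 *
          (IccExtend Real.pi_nonneg (solutionMap hL.memLp (1, 0) (θ ^ 2)) t).1) fun t ht => by
          rw [uIoc_of_le hx.1] at ht
          have ht' : t ∈ Icc 0 Real.pi := ⟨ht.1.le, ht.2.trans hx.2⟩
          rw [IccExtend_of_mem _ _ ht', IccExtend_of_mem _ _ ht', solutionMap_apply,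
            solutionMap_apply, norm_mul, pow_two C]
          exact mul_le_mul (h ρ n hρ t ht').1 (h θ k hθ t ht').1 (norm_nonneg _) hC.le
      rw [sub_zero, abs_of_nonneg hx.1] at h2
      refine h2.trans ?_
      gcongr
      exact hx.2
    calc _ ≤ C ^ 2 * Real.pi * (4 * R + 2) :=
          mul_le_mul h1 (by linarith) hd.le (by positivity)
      _ ≤ _ := by linarith [show 0 ≤ 32 * (R + 1) * C ^ 2 by positivity]
  · have hn0 : (0 : ℝ) ≤ n := Nat.cast_nonneg _
    have hk0 : (0 : ℝ) ≤ k := Nat.cast_nonneg _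
    have hnk : |(n : ℝ) - k| ≤ n + k := by
      rw [abs_le]; constructor <;> linarith
    have hρn := norm_sub_norm_le ρ n
    have hθk := norm_sub_norm_le θ k
    rw [Complex.norm_natCast] at hρn hθk
    have h1 : |(n : ℝ) - k| - 2 * R ≤ ‖ρ - θ‖ := by
      have e1 := norm_sub_norm_le ((n : ℂ) - k) (((n : ℂ) - ρ) - (k - θ))
      have e2 := norm_sub_le ((n : ℂ) - ρ) (k - θ)
      rw [show ((n : ℂ) - k) - (((n : ℂ) - ρ) - (k - θ)) = ρ - θ by ring] at e1
      rw [norm_sub_rev (n : ℂ), norm_sub_rev (k : ℂ)] at e2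
      have e3 : ‖(n : ℂ) - k‖ = |(n : ℝ) - k| := by
        rw [← Complex.ofReal_natCast, ← Complex.ofReal_natCast, ← Complex.ofReal_sub,
          Complex.norm_real, Real.norm_eq_abs]
      rw [e3] at e1
      linarith
    have h2 : (n : ℝ) + k - 2 * R ≤ ‖ρ + θ‖ := by
      have e1 := norm_sub_norm_le ((n : ℂ) + k) (((n : ℂ) - ρ) + (k - θ))
      have e2 := norm_add_le ((n : ℂ) - ρ) (k - θ)
      rw [show ((n : ℂ) + k) - (((n : ℂ) - ρ) + (k - θ)) = ρ + θ by ring] at e1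
      rw [norm_sub_rev (n : ℂ), norm_sub_rev (k : ℂ)] at e2
      have e3 : ‖(n : ℂ) + k‖ = (n : ℝ) + k := by
        rw [← Nat.cast_add, Complex.norm_natCast, Nat.cast_add]
      rw [e3] at e1
      linarith
    set d := |(n : ℝ) - k| with hdd
    have hw : ‖wronskian L x (ρ ^ 2) (θ ^ 2)‖ ≤ C ^ 2 * (2 + ‖ρ‖ + ‖θ‖) := by
      obtain ⟨a1, a2⟩ := h ρ n hρ x hx
      obtain ⟨b1, b2⟩ := h θ k hθ x hx
      unfold wronskian
      refine (norm_sub_le _ _).trans ?_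
      rw [norm_mul, norm_mul]
      calc _ ≤ C * (C * (1 + ‖θ‖)) + C * (1 + ‖ρ‖) * C := by gcongr
        _ = _ := by ring
    rw [wronskian_eq_kernelD hL hx, norm_mul, show ρ ^ 2 - θ ^ 2 = (ρ - θ) * (ρ + θ) by ring,
      norm_mul] at hw
    set D := ‖kernelD L x (ρ ^ 2) (θ ^ 2)‖ with hD
    have hD0 : 0 ≤ D := norm_nonneg _
    set s := (n : ℝ) + k with hs
    have h3 : d / 2 * (s / 2) * D ≤ C ^ 2 * (2 + s + 2 * R) := by
      refine le_trans ?_ (hw.trans ?_)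
      · gcongr <;> linarith
      · exact mul_le_mul_of_nonneg_left (by linarith) (sq_nonneg C)
    have h4 : 2 + s + 2 * R ≤ (2 * R + 3) * s := by
      have : 1 ≤ s := by linarith
      nlinarith
    have h5 : s * (d * D) ≤ s * (4 * C ^ 2 * (2 * R + 3)) := by
      have := mul_le_mul_of_nonneg_left h4 (sq_nonneg C)
      linarith
    have hs0 : 0 < s := by linarith
    have h6 := le_of_mul_le_mul_left h5 hs0
    have h7 : D ≤ d * D := by
      have : 1 ≤ d := by linarith
      nlinarith
    have h8 : 0 ≤ C ^ 2 * Real.pi * (4 * R + 2) := by positivity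
    nlinarith [mul_nonneg (sq_nonneg C) hR]

theorem summable_one_div_one_add_abs_sq : Summable fun m : ℤ => 1 / (1 + |(m : ℝ)|) ^ 2 := by
  have h : Summable fun n : ℕ => 1 / (1 + (n : ℝ)) ^ 2 := by
    have := (summable_nat_add_iff 1).2 (Real.summable_one_div_nat_pow.2 (one_lt_two))
    simpa [add_comm] using this
  refine Summable.of_nat_of_neg (h.congr fun n => ?_) (h.congr fun n => ?_)
  · simp
  · simp

/-- Each term is bounded by the sum of the squares of its factors; the second family is part of a
shifted sum over all integers, so the bound does not depend on n. -/
theorem exists_tsum_div_le {η : ℕ → ℝ} (hη : ∀ n, 0 ≤ η n) (hs : Summable fun n => η n ^ 2) :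
    ∃ C : ℝ, ∀ n : ℕ, (Summable fun k : ℕ => η k / (1 + |(n : ℝ) - k|)) ∧
      ∑' k : ℕ, η k / (1 + |(n : ℝ) - k|) ≤ C := by
  refine ⟨∑' k, η k ^ 2 + ∑' m : ℤ, 1 / (1 + |(m : ℝ)|) ^ 2, fun n => ?_⟩
  have hinj : Function.Injective fun k : ℕ => (n : ℤ) - k := fun a b hab => by
    simp only [sub_right_inj, Nat.cast_inj] at hab
    exact hab
  have h1 := summable_one_div_one_add_abs_sq.comp_injective hinj
  have h2 := tsum_comp_le_tsum_of_inj summable_one_div_one_add_abs_sq (fun m => by positivity) hinj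
  have e : ((fun m : ℤ => 1 / (1 + |(m : ℝ)|) ^ 2) ∘ fun k : ℕ => (n : ℤ) - k) =
      fun k : ℕ => 1 / (1 + |(n : ℝ) - k|) ^ 2 := by
    ext k; simp
  rw [e] at h1 h2
  have hle : ∀ k : ℕ, η k / (1 + |(n : ℝ) - k|) ≤ η k ^ 2 + 1 / (1 + |(n : ℝ) - k|) ^ 2 := fun k => by
    rw [div_eq_mul_one_div, ← one_div_pow]
    nlinarith [sq_nonneg (η k - 1 / (1 + |(n : ℝ) - k|)), sq_nonneg (η k),
      sq_nonneg (1 / (1 + |(n : ℝ) - k|))]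
  have h3 := Summable.of_nonneg_of_le (fun k => div_nonneg (hη k) (by positivity)) hle (hs.add h1)
  refine ⟨h3, (h3.tsum_le_tsum hle (hs.add h1)).trans ?_⟩
  rw [hs.tsum_add h1]
  gcongr

/-- The one-variable estimates are applied to D twice, to columns in one variable and to rows in the
other. The last bound has plain jets in place of transformed rows; it serves the unnormalised
equation. -/
theorem exists_kernel_bounds (hL : L.IsNormalized M) (hS : IsSpectralData L (S 0))
    (hLt : Lt.IsNormalized M) (hT : IsSpectralData Lt (S 1)) (hx : x ∈ Icc 0 Real.pi) :
    ∃ (C : ℝ) (η : ℕ → ℝ), 0 < C ∧ (∀ n, 0 ≤ η n) ∧ (Summable fun n => η n ^ 2) ∧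
      (∀ u, ‖psiVec L S x u‖ ≤ C) ∧ (∀ u, ‖psiVec Lt S x u‖ ≤ C) ∧
      (∀ u v, ‖matH Lt S x u v‖ ≤ C * (η v.1 / (1 + |(u.1 : ℝ) - v.1|))) ∧
      ∀ u v : ℕ × Fin 2,
        ‖intForm hx ((S u.2).jet u.1 (solutionMap hLt.memLp (1, 0)))
          (colR S v (solutionMap hLt.memLp (1, 0)))‖ ≤ C * (η v.1 / (1 + |(u.1 : ℝ) - v.1|)) := by
  obtain ⟨C, R, η, hC, hR, hη, hs, h⟩ := exists_jet_bounds hL hS hLt hT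
  obtain ⟨C₁, hC₁, h₁⟩ := Problem.exists_norm_phi_le_strip hL R
  obtain ⟨C₂, hC₂, h₂⟩ := Problem.exists_norm_phi_le_strip hLt R
  obtain ⟨C₃, hC₃, h₃⟩ := exists_norm_kernelD_le hLt hx R hR.le
  have hY := differentiable_solutionMap hLt.memLp (1, 0)
  have hcol : ∀ (y : C(Icc 0 Real.pi, ℂ × ℂ)) (n : ℕ) (v : ℕ × Fin 2),
      (∀ (θ : ℂ) (k : ℕ), ‖θ - k‖ ≤ R →
        ‖intForm hx y (solutionMap hLt.memLp (1, 0) (θ ^ 2))‖ ≤ C * (C₃ / (1 + |(n : ℝ) - k|))) →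
      ‖intForm hx y (colR S v (solutionMap hLt.memLp (1, 0)))‖ ≤
        C * C * C₃ * (η v.1 / (1 + |(n : ℝ) - v.1|)) := fun y n v hy => by
    rw [intForm_colR hLt hx]
    refine ((h _ ((intForm hx y).differentiable.comp hY) v.1 _
      (fun θ hθ => hy θ v.1 hθ) v.2).2.2).trans (le_of_eq ?_)
    ring
  have hmono : ∀ u v : ℕ × Fin 2, C * C * C₃ * (η v.1 / (1 + |(u.1 : ℝ) - v.1|)) ≤
      (C * C₁ + C * C₂ + C * C * C₃) * (η v.1 / (1 + |(u.1 : ℝ) - v.1|)) := fun u v => by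
    have := hη v.1
    gcongr
    have : 0 < C * C₁ + C * C₂ := by positivity
    linarith
  have hflip : ∀ μ : ℂ, Differentiable ℂ fun l => kernelD Lt x l μ :=
    fun μ => differentiable_kernelD_left hLt hx μ
  refine ⟨C * C₁ + C * C₂ + C * C * C₃, η, by positivity, hη, hs, fun u => ?_, fun u => ?_,
    fun u v => ?_, fun u v => ?_⟩
  · rw [psiVec_eq_rowT]
    have := (h _ (hL.differentiable_phi hx) u.1 C₁ (fun ρ hρ => (h₁ ρ u.1 hρ x hx).1) u.2).2.1
    have h0 : 0 < C * C₂ + C * C * C₃ := by positivity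
    exact this.trans (by linarith)
  · rw [psiVec_eq_rowT]
    have := (h _ (hLt.differentiable_phi hx) u.1 C₂ (fun ρ hρ => (h₂ ρ u.1 hρ x hx).1) u.2).2.1
    have h0 : 0 < C * C₁ + C * C * C₃ := by positivity
    exact this.trans (by linarith)
  · rw [matH_eq_intForm hLt hx]
    refine (hcol _ u.1 v fun θ k hθ => ?_).trans (hmono u v)
    have e := rowT_clm_comp S ((intForm hx).flip (solutionMap hLt.memLp (1, 0) (θ ^ 2))) hY u
    rw [ContinuousLinearMap.flip_apply] at e
    rw [← e]
    have e2 : (fun z => (intForm hx).flip (solutionMap hLt.memLp (1, 0) (θ ^ 2))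
        (solutionMap hLt.memLp (1, 0) z)) = fun l => kernelD Lt x l (θ ^ 2) :=
      funext fun l => (kernelD_eq hLt hx l _).symm
    rw [e2]
    exact (h _ (hflip _) u.1 _ (fun ρ hρ => h₃ ρ θ u.1 k hρ hθ) u.2).2.1
  · refine (hcol _ u.1 v fun θ k hθ => ?_).trans (hmono u v)
    have e := (S u.2).jet_clm_comp ((intForm hx).flip (solutionMap hLt.memLp (1, 0) (θ ^ 2))) hY u.1
    rw [ContinuousLinearMap.flip_apply] at e
    rw [← e]
    have e2 : (fun z => (intForm hx).flip (solutionMap hLt.memLp (1, 0) (θ ^ 2))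
        (solutionMap hLt.memLp (1, 0) z)) = fun l => kernelD Lt x l (θ ^ 2) :=
      funext fun l => (kernelD_eq hLt hx l _).symm
    rw [e2]
    exact (h _ (hflip _) u.1 _ (fun ρ hρ => h₃ ρ θ u.1 k hρ hθ) u.2).1

end SturmLiouville

end

/-! ### Blocks of equal eigenvalues and residues on large circles. -/

noncomputable section

namespace SturmLiouville

open Complex (I)

namespace SpectralSeq

variable {S : SpectralSeq} {k : ℕ} {z : ℂ}

theorem mult_congr {i j : ℕ} (h : S.lam i = S.lam j) : S.mult i = S.mult j := by
  unfold mult; rw [h]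

/-- The indices that carry a given value form an interval. -/
theorem exists_block (hfin : ∀ z, {k | S.lam k = z}.Finite)
    (hcons : ∀ i j k : ℕ, i ≤ j → j ≤ k → S.lam i = S.lam k → S.lam j = S.lam i)
    (hz : ∃ n, S.lam n = z) : ∃ k, S.lam k = z ∧ S.pos k = 0 ∧
      ∀ n, S.lam n = z ↔ n ∈ Finset.Ico k (k + S.mult k) := by
  classical
  set T := (hfin z).toFinset with hT
  have hmem : ∀ n, n ∈ T ↔ S.lam n = z := fun n => by simp [hT]
  have hne : T.Nonempty := hz.imp fun n hn => (hmem n).2 hn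
  set k := T.min' hne
  set b := T.max' hne
  have hk : S.lam k = z := (hmem k).1 (T.min'_mem hne)
  have hb : S.lam b = z := (hmem b).1 (T.max'_mem hne)
  have hkb : k ≤ b := T.min'_le b (T.max'_mem hne)
  have hIcc : T = Finset.Icc k b := by
    ext n
    rw [Finset.mem_Icc]
    refine ⟨fun hn => ⟨T.min'_le n hn, T.le_max' n hn⟩, fun hn => (hmem n).2 ?_⟩
    rw [hcons k n b hn.1 hn.2 (hk.trans hb.symm), hk]
  have hmult : S.mult k = b + 1 - k := by
    rw [mult, hk, show {j | S.lam j = z} = (T : Set ℕ) by ext; simp [hmem], ncard_coe_finset, hIcc,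
      Nat.card_Icc]
  refine ⟨k, hk, ?_, fun n => ?_⟩
  · rw [pos, ncard_eq_zero ((hfin z).subset fun j hj => hj.2.trans hk)]
    refine Set.eq_empty_of_forall_notMem fun j hj => ?_
    exact absurd (T.min'_le j ((hmem j).2 (hj.2.trans hk))) (not_le.2 hj.1)
  · rw [← hmem, hIcc, hmult, Finset.mem_Icc, Finset.mem_Ico]
    omega

theorem pos_add (hk : ∀ n, S.lam n = z ↔ n ∈ Finset.Ico k (k + S.mult k)) {ν : ℕ}
    (hν : ν < S.mult k) : S.pos (k + ν) = ν := by
  have h1 : S.lam (k + ν) = z := (hk _).2 (Finset.mem_Ico.2 ⟨by omega, by omega⟩)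
  rw [pos, h1, show {j | j < k + ν ∧ S.lam j = z} = (Finset.Ico k (k + ν) : Set ℕ) by
    ext j
    simp only [mem_ofPred_eq, hk, Finset.coe_Ico, mem_Ico, Finset.mem_Ico]
    omega, ncard_coe_finset, Nat.card_Ico]
  omega

theorem inv_factorial_mul_iteratedDeriv_mul {g d : ℂ → ℂ} (hg : Differentiable ℂ g)
    (hd : Differentiable ℂ d) (q : ℕ) (z : ℂ) :
    ((q ! : ℂ)⁻¹ * iteratedDeriv q (fun w => g w * d w) z) = ∑ i ∈ Finset.range (q + 1),
      ((i ! : ℂ)⁻¹ * iteratedDeriv i g z) * (((q - i)! : ℂ)⁻¹ * iteratedDeriv (q - i) d z) := by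
  have h := iteratedDeriv_fun_mul (n := q) (x := z) (hg.contDiff.contDiffAt) (hd.contDiff.contDiffAt)
  rw [h, Finset.mul_sum]
  refine Finset.sum_congr rfl fun i hi => ?_
  have hiq : i ≤ q := Nat.lt_succ_iff.1 (Finset.mem_range.1 hi)
  have hq : (q ! : ℂ) ≠ 0 := by exact_mod_cast Nat.factorial_ne_zero q
  have hi0 : (i ! : ℂ) ≠ 0 := by exact_mod_cast Nat.factorial_ne_zero i
  have hqi : ((q - i)! : ℂ) ≠ 0 := by exact_mod_cast Nat.factorial_ne_zero (q - i)
  rw [Nat.cast_choose ℂ hiq]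
  field_simp

/-- Leibniz rule for the residue at a block. -/
theorem res_mul_eq_sum (hk : ∀ n, S.lam n = z ↔ n ∈ Finset.Ico k (k + S.mult k))
    (hpos : S.pos k = 0) (hkz : S.lam k = z) {g d : ℂ → ℂ} (hg : Differentiable ℂ g)
    (hd : Differentiable ℂ d) :
    S.res k (fun w => g w * d w) =
      ∑ n ∈ Finset.Ico k (k + S.mult k), S.jet n g * S.res n d := by
  rw [Finset.sum_Ico_eq_sum_range, Nat.add_sub_cancel_left]
  have h1 : ∀ ν ∈ Finset.range (S.mult k), S.jet (k + ν) g * S.res (k + ν) d =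
      ∑ p ∈ Finset.range (S.mult k - ν), S.alpha (k + (ν + p)) *
        (((ν ! : ℂ)⁻¹ * iteratedDeriv ν g z) * ((p ! : ℂ)⁻¹ * iteratedDeriv p d z)) := by
    intro ν hν
    have hν' := Finset.mem_range.1 hν
    have hl : S.lam (k + ν) = z := (hk _).2 (Finset.mem_Ico.2 ⟨by omega, by omega⟩)
    rw [jet, res, pos_add hk hν', hl, mult_congr (hl.trans hkz.symm), Finset.mul_sum]
    refine Finset.sum_congr rfl fun p _ => ?_
    simp only [smul_eq_mul, add_assoc]
    ring
  -- The double sum over ν + p < `mult` is regrouped by q = ν + p, which is the order of the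
  -- coefficient α it involves.
  rw [Finset.sum_congr rfl h1, ← Finset.sum_range_diag_flip (S.mult k) fun ν p =>
    S.alpha (k + (ν + p)) *
        (((ν ! : ℂ)⁻¹ * iteratedDeriv ν g z) * ((p ! : ℂ)⁻¹ * iteratedDeriv p d z)), res, hpos,
    Nat.sub_zero, hkz]
  refine Finset.sum_congr rfl fun q _ => ?_
  rw [smul_eq_mul, smul_eq_mul, inv_factorial_mul_iteratedDeriv_mul hg hd, Finset.mul_sum]
  refine Finset.sum_congr rfl fun i hi => ?_
  rw [Nat.add_sub_cancel' (Nat.lt_succ_iff.1 (Finset.mem_range.1 hi))]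

end SpectralSeq

namespace IsSpectralData

variable {L : Problem} {S : SpectralSeq} {M : ℕ}

/-- With indices from 0, ρ_n is close to n − M, so the circle |ρ| = N + 1/2 encloses exactly the
first N + M + 1 of them. -/
theorem exists_norm_rho_lt (hL : L.IsNormalized M) (hS : IsSpectralData L S) :
    ∃ N₀ : ℕ, ∀ N, N₀ ≤ N → ∀ n, (n < N + M + 1 → ‖S.rho n‖ < N + 1 / 2) ∧
      (N + M + 1 ≤ n → N + 1 / 2 < ‖S.rho n‖) := by
  obtain ⟨B, hB0, hB⟩ := exists_norm_rho_sub_le hL hS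
  obtain ⟨K, hK⟩ := Metric.tendsto_atTop.1 (tendsto_sub hL hS) (1 / 4) (by norm_num)
  simp only [dist_zero_right] at hK
  refine ⟨K + M + ⌈B⌉₊, fun N hN n => ⟨fun hn => ?_, fun hn => ?_⟩⟩
  · by_cases hMn : K + M ≤ n
    · have h1 := norm_sub_norm_le (S.rho n) ((n : ℂ) - M)
      have h2 := hK n (by omega)
      have h3 : ‖((n : ℂ) - M)‖ = (n : ℝ) - M := by
        rw [← Nat.cast_sub (by omega : M ≤ n), Complex.norm_natCast, Nat.cast_sub (by omega)]
      have h4 : (n : ℝ) ≤ N + M := by exact_mod_cast Nat.lt_succ_iff.1 hn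
      linarith
    · have h1 := norm_sub_norm_le (S.rho n) n
      rw [Complex.norm_natCast] at h1
      have h2 : (n : ℝ) ≤ K + M := by exact_mod_cast (not_le.1 hMn).le
      have h3 : ((K + M + ⌈B⌉₊ : ℕ) : ℝ) ≤ N := Nat.cast_le.2 hN
      push_cast at h3
      linarith [hB n, Nat.le_ceil B]
  · have h1 := norm_sub_norm_le ((n : ℂ) - M) (S.rho n)
    rw [norm_sub_rev _ (S.rho n)] at h1
    have h2 := hK n (by omega)
    have h3 : ‖((n : ℂ) - M)‖ = (n : ℝ) - M := by
      rw [← Nat.cast_sub (by omega : M ≤ n), Complex.norm_natCast, Nat.cast_sub (by omega)]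
    have h4 : (N : ℝ) + M + 1 ≤ n := by exact_mod_cast hn
    linarith

/-- The residue theorem for the Weyl function on large circles. -/
theorem exists_circleIntegral_mul_weyl (hL : L.IsNormalized M) (hS : IsSpectralData L S) :
    ∃ N₀ : ℕ, ∀ N : ℕ, N₀ ≤ N →
      ContinuousOn L.weyl (Metric.sphere 0 (((N : ℝ) + 1 / 2) ^ 2)) ∧
      ∀ g d : ℂ → ℂ, Differentiable ℂ g → Differentiable ℂ d →
        ∮ w in C(0, ((N : ℝ) + 1 / 2) ^ 2), g w * d w * L.weyl w =
          2 * Real.pi * I * ∑ n ∈ Finset.range (N + M + 1), S.jet n g * S.res n d := by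
  classical
  obtain ⟨N₀, hN₀⟩ := exists_norm_rho_lt hL hS
  have hblock : ∀ z, (∃ n, S.lam n = z) → ∃ k, S.lam k = z ∧ S.pos k = 0 ∧
      ∀ n, S.lam n = z ↔ n ∈ Finset.Ico k (k + S.mult k) := fun z hz =>
    S.exists_block (finite_fiber hL hS) hS.consecutive hz
  choose! κ hκ hκ0 hκm using hblock
  refine ⟨N₀, fun N hN => ?_⟩
  have hr : (0 : ℝ) < ((N : ℝ) + 1 / 2) ^ 2 := by positivity
  have hrho := hN₀ N hN
  have hlam : ∀ n, ‖S.lam n‖ = ‖S.rho n‖ ^ 2 := fun n => by rw [← S.rho_sq, norm_pow]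
  set s := (Finset.range (N + M + 1)).image S.lam with hs
  have hsball : ∀ z ∈ s, z ∈ Metric.ball (0 : ℂ) (((N : ℝ) + 1 / 2) ^ 2) := fun z hz => by
    obtain ⟨n, hn, rfl⟩ := Finset.mem_image.1 hz
    rw [mem_ball_zero_iff, hlam]
    exact pow_lt_pow_left₀ ((hrho n).1 (Finset.mem_range.1 hn)) (norm_nonneg _) two_ne_zero
  have hd : ∀ z ∈ Metric.closedBall (0 : ℂ) (((N : ℝ) + 1 / 2) ^ 2), z ∉ s →
      DifferentiableAt ℂ L.weyl z := fun z hz hzs => by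
    have hne : L.psiQ 0 z ≠ 0 := fun h0 => by
      rw [Problem.psiQ_zero hL, neg_eq_zero] at h0
      obtain ⟨k, rfl⟩ := exists_lam_eq hL hS h0
      refine hzs (Finset.mem_image_of_mem _ (Finset.mem_range.2 ?_))
      by_contra hk
      have h1 := (hrho k).2 (not_lt.1 hk)
      rw [mem_closedBall_zero_iff, hlam] at hz
      exact absurd hz (not_le.2 (pow_lt_pow_left₀ h1 (by positivity) two_ne_zero))
    exact (hL.differentiable_psi zero_mem_Icc_pi z).fun_div
      (hL.differentiable_psiQ zero_mem_Icc_pi z) hne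
  refine ⟨fun z hz => (hd z (Metric.sphere_subset_closedBall hz)
    fun hzs => ?_).continuousAt.continuousWithinAt, fun g d hg hdd => ?_⟩
  · have := hsball z hzs
    rw [Metric.mem_ball, Metric.mem_sphere.1 hz] at this
    exact lt_irrefl _ this
  have hex : ∀ z ∈ s, ∃ n, S.lam n = z := fun z hz => by
    obtain ⟨n, -, hn⟩ := Finset.mem_image.1 hz
    exact ⟨n, hn⟩
  have key := circleIntegral_mul_eq_sum_residue (hg.fun_mul hdd) hr s hsball hd
    (fun z => S.mult (κ z)) (fun z j => S.alpha (κ z + j)) fun z hz => by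
      have h := hS.principal_part (κ z) (hκ0 z (hex z hz))
      rwa [hκ z (hex z hz)] at h
  rw [key]
  congr 1
  rw [← Finset.sum_fiberwise_of_maps_to (s := Finset.range (N + M + 1)) (t := s) (g := S.lam)
    fun n hn => Finset.mem_image_of_mem _ hn]
  refine Finset.sum_congr rfl fun z hz => ?_
  have hz' := hex z hz
  -- A block lies entirely inside or entirely outside the circle, because its members share one
  -- value of ρ; no block is cut by the range of summation.
  have hfil : (Finset.range (N + M + 1)).filter (fun n => S.lam n = z) =
      Finset.Ico (κ z) (κ z + S.mult (κ z)) := by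
    ext n
    rw [Finset.mem_filter, ← hκm z hz' n, and_iff_right_iff_imp]
    rintro rfl
    obtain ⟨n', hn', hnn⟩ := Finset.mem_image.1 hz
    by_contra hn
    have h1 := (hrho n).2 (not_lt.1 (mt Finset.mem_range.2 hn))
    have h2 := (hrho n').1 (Finset.mem_range.1 hn')
    rw [SpectralSeq.rho, hnn] at h2
    exact absurd h1 (not_lt.2 h2.le)
  rw [hfil, ← SpectralSeq.res_mul_eq_sum (hκm z hz') (hκ0 z hz') (hκ z hz') hg hdd,
    SpectralSeq.res, hκ0 z hz', Nat.sub_zero, hκ z hz']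
  refine Finset.sum_congr rfl fun j _ => ?_
  rw [smul_eq_mul, smul_eq_mul, div_eq_inv_mul]

end IsSpectralData

end SturmLiouville

end

/-! ### Asymptotics of the spectral mapping entries. -/

noncomputable section

namespace SturmLiouville

open Complex (I)

variable {L Lt : Problem} {S : Fin 2 → SpectralSeq} {M : ℕ} {x : ℝ}

/-- The constant K is fixed before δ, so products of a bounded factor and a small one can be made
arbitrarily small. The exponentials for φ and Φ are reciprocal and cancel in such products. -/
theorem Problem.exists_phi_weylSol_bounds (hL : L.IsNormalized M) (hx : x ∈ Icc 0 Real.pi) :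
    ∃ K : ℝ, 0 < K ∧ ∀ δ : ℝ, 0 < δ → δ ≤ 1 → ∃ R : ℝ, 1 ≤ R ∧ ∀ ρ : ℂ, R ≤ ‖ρ‖ →
      (∀ k : ℤ, 1 / 4 ≤ ‖ρ - k‖) → L.psiQ 0 (ρ ^ 2) ≠ 0 ∧
        ‖L.phi x (ρ ^ 2)‖ ≤ K * Real.exp (|ρ.im| * x) ∧
        ‖L.phiQ x (ρ ^ 2) + ρ * Complex.sin (ρ * x)‖ ≤ K * ‖ρ‖ * Real.exp (|ρ.im| * x) * δ ∧
        ‖ρ * L.weylSol x (ρ ^ 2)‖ ≤ K * Real.exp (-(|ρ.im| * x)) ∧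
        ‖L.weylSolQ x (ρ ^ 2) - Complex.sin (ρ * (Real.pi - x : ℝ)) / Complex.sin (Real.pi * ρ)‖ ≤
          K * Real.exp (-(|ρ.im| * x)) * δ := by
  obtain ⟨C₁, hC₁, h₁⟩ := exists_norm_phi_le hL
  obtain ⟨C₂, hC₂, h₂⟩ := exists_norm_solution_sub_le_err hL.memLp
  obtain ⟨C₃, R₃, hC₃, hR₃, h₃⟩ := exists_norm_weylSol_sub_le hL
  obtain ⟨c, hc, hsin⟩ := exists_le_norm_sin
  refine ⟨C₁ + C₂ + 2 * C₃ + 1 / c, by positivity, fun δ hδ hδ1 => ?_⟩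
  obtain ⟨R₁, hR₁, e₁⟩ := exists_err_le hL.memLp hδ
  obtain ⟨R₂, hR₂, e₂⟩ := exists_err_le hL.memLp_refl hδ
  refine ⟨max R₃ (max R₁ R₂), hR₃.trans (le_max_left _ _), fun ρ hρ hk => ?_⟩
  have hρ3 : R₃ ≤ ‖ρ‖ := (le_max_left _ _).trans hρ
  have hρ1 : R₁ ≤ ‖ρ‖ := ((le_max_left _ _).trans (le_max_right _ _)).trans hρ
  have hρ2 : R₂ ≤ ‖ρ‖ := ((le_max_right _ _).trans (le_max_right _ _)).trans hρ
  have hone : 1 ≤ ‖ρ‖ := hR₃.trans hρ3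
  obtain ⟨hne, hw⟩ := h₃ ρ hρ3 hk
  obtain ⟨hw1, hw2⟩ := hw x hx
  have f₁ := e₁ ρ hρ1 x hx
  have f₂ := e₂ ρ hρ2 _ (pi_sub_mem hx)
  have f₃ := e₂ ρ hρ2 _ pi_mem_Icc_pi
  have hc' : 0 < 1 / c := by positivity
  have hsum : err L.refl ρ (Real.pi - x) + err L.refl ρ Real.pi ≤ 2 * δ := by linarith
  have hE : 0 < Real.exp (-(|ρ.im| * x)) := Real.exp_pos _
  refine ⟨hne, ?_, ?_, ?_, ?_⟩
  · refine (h₁ ρ hone x hx).1.trans ?_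
    gcongr
    linarith
  · refine (h₂ ρ hone x hx).2.trans ?_
    gcongr
    · exact err_nonneg _ _ _
    · linarith
  · have h4 : ‖Complex.cos (ρ * (Real.pi - x : ℝ)) / Complex.sin (Real.pi * ρ)‖ ≤
        1 / c * Real.exp (-(|ρ.im| * x)) := by
      have a1 := norm_cos_mul_le ρ (x := Real.pi - x) (by linarith [hx.2])
      have a2 := hsin ρ hk
      rw [norm_div]
      calc _ ≤ Real.exp (|ρ.im| * (Real.pi - x)) / (c * Real.exp (Real.pi * |ρ.im|)) := by gcongr
        _ = 1 / c * (Real.exp (|ρ.im| * (Real.pi - x)) / Real.exp (Real.pi * |ρ.im|)) := by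
          field_simp
        _ = _ := by rw [← Real.exp_sub]; ring_nf
    have h5 := norm_le_norm_sub_add (ρ * L.weylSol x (ρ ^ 2))
      (Complex.cos (ρ * (Real.pi - x : ℝ)) / Complex.sin (Real.pi * ρ))
    have h6 : C₃ * Real.exp (-(|ρ.im| * x)) * (err L.refl ρ (Real.pi - x) + err L.refl ρ Real.pi) ≤
        C₃ * Real.exp (-(|ρ.im| * x)) * 2 := by gcongr; linarith
    have h7 : 0 ≤ (C₁ + C₂) * Real.exp (-(|ρ.im| * x)) := by positivity
    linarith
  · refine hw2.trans ?_
    calc _ ≤ C₃ * Real.exp (-(|ρ.im| * x)) * (2 * δ) := by gcongr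
      _ = 2 * C₃ * Real.exp (-(|ρ.im| * x)) * δ := by ring
      _ ≤ _ := by
        gcongr
        linarith

/-- The Wronskian of `φ` and the Weyl solution. -/
theorem Problem.phi_mul_weylSolQ_sub (hL : L.IsNormalized M) (hx : x ∈ Icc 0 Real.pi) {l : ℂ}
    (hl : L.psiQ 0 l ≠ 0) : L.phi x l * L.weylSolQ x l - L.weylSol x l * L.phiQ x l = 1 := by
  have h := phi_mul_psiQ_sub hL hx l
  rw [← psiQ_zero hL] at h
  unfold weylSol weylSolQ
  field_simp
  linear_combination h

/-- The entries of the first row of the matrix that maps the fundamental solutions of the model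
problem to those of the problem tend to `1` and `0`. -/
theorem exists_norm_spectralMap_sub_le (hL : L.IsNormalized M) (hLt : Lt.IsNormalized M)
    (hx : x ∈ Icc 0 Real.pi) {ε : ℝ} (hε : 0 < ε) : ∃ R : ℝ, 1 ≤ R ∧ ∀ ρ : ℂ, R ≤ ‖ρ‖ →
      (∀ k : ℤ, 1 / 4 ≤ ‖ρ - k‖) → L.psiQ 0 (ρ ^ 2) ≠ 0 ∧ Lt.psiQ 0 (ρ ^ 2) ≠ 0 ∧
        ‖L.phi x (ρ ^ 2) * Lt.weylSolQ x (ρ ^ 2) - L.weylSol x (ρ ^ 2) * Lt.phiQ x (ρ ^ 2) - 1‖ ≤ ε ∧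
        ‖L.weylSol x (ρ ^ 2) * Lt.phi x (ρ ^ 2) - L.phi x (ρ ^ 2) * Lt.weylSol x (ρ ^ 2)‖ ≤ ε := by
  obtain ⟨K, hK, h⟩ := Problem.exists_phi_weylSol_bounds hL hx
  obtain ⟨K', hK', h'⟩ := Problem.exists_phi_weylSol_bounds hLt hx
  set δ := min 1 (ε / (2 * K * (K + K'))) with hδ
  have hδ0 : 0 < δ := lt_min one_pos (by positivity)
  obtain ⟨R, hR, hb⟩ := h δ hδ0 (min_le_left _ _)
  obtain ⟨R', hR', hb'⟩ := h' δ hδ0 (min_le_left _ _)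
  refine ⟨max (max R R') (2 * K * K' / ε), (hR.trans (le_max_left _ _)).trans (le_max_left _ _),
    fun ρ hρ hk => ?_⟩
  obtain ⟨a0, a1, a2, a3, a4⟩ := hb ρ (((le_max_left _ _).trans (le_max_left _ _)).trans hρ) hk
  obtain ⟨b0, b1, b2, b3, b4⟩ := hb' ρ (((le_max_right _ _).trans (le_max_left _ _)).trans hρ) hk
  have hρ1 : 1 ≤ ‖ρ‖ := (hR.trans ((le_max_left _ _).trans (le_max_left _ _))).trans hρ
  have hρ0 : 0 < ‖ρ‖ := by linarith
  have hρne : ρ ≠ 0 := norm_pos_iff.1 hρ0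
  have hEE : Real.exp (|ρ.im| * x) * Real.exp (-(|ρ.im| * x)) = 1 := by
    rw [← Real.exp_add, add_neg_cancel, Real.exp_zero]
  set E := Real.exp (|ρ.im| * x)
  set E' := Real.exp (-(|ρ.im| * x))
  have hE : 0 < E := Real.exp_pos _
  have hE' : 0 < E' := Real.exp_pos _
  refine ⟨a0, b0, ?_, ?_⟩
  · have hw := Problem.phi_mul_weylSolQ_sub hL hx a0
    -- Writing 1 as the Wronskian of φ and Φ for the first problem leaves only differences of
    -- quasi-derivatives of the two problems, in which the leading sines cancel.
    have hid : L.phi x (ρ ^ 2) * Lt.weylSolQ x (ρ ^ 2) - L.weylSol x (ρ ^ 2) * Lt.phiQ x (ρ ^ 2) - 1 =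
        L.phi x (ρ ^ 2) * ((Lt.weylSolQ x (ρ ^ 2) -
            Complex.sin (ρ * (Real.pi - x : ℝ)) / Complex.sin (Real.pi * ρ)) -
          (L.weylSolQ x (ρ ^ 2) -
            Complex.sin (ρ * (Real.pi - x : ℝ)) / Complex.sin (Real.pi * ρ))) -
        ρ * L.weylSol x (ρ ^ 2) * (((Lt.phiQ x (ρ ^ 2) + ρ * Complex.sin (ρ * x)) -
          (L.phiQ x (ρ ^ 2) + ρ * Complex.sin (ρ * x))) / ρ) := by
      rw [← hw]
      field_simp
      ring
    rw [hid]
    refine (norm_sub_le _ _).trans ?_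
    rw [norm_mul, norm_mul (ρ * _), norm_div]
    have c1 := (norm_sub_le (Lt.weylSolQ x (ρ ^ 2) -
            Complex.sin (ρ * (Real.pi - x : ℝ)) / Complex.sin (Real.pi * ρ)) (L.weylSolQ x (ρ ^ 2) -
            Complex.sin (ρ * (Real.pi - x : ℝ)) / Complex.sin (Real.pi * ρ))).trans (add_le_add b4 a4)
    have c2 := (norm_sub_le (Lt.phiQ x (ρ ^ 2) + ρ * Complex.sin (ρ * x))
      (L.phiQ x (ρ ^ 2) + ρ * Complex.sin (ρ * x))).trans (add_le_add b2 a2)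
    calc _ ≤ K * E * (K' * E' * δ + K * E' * δ) +
          K * E' * ((K' * ‖ρ‖ * E * δ + K * ‖ρ‖ * E * δ) / ‖ρ‖) := by gcongr
      _ = 2 * K * (K + K') * δ * (E * E') := by field_simp; ring
      _ ≤ 2 * K * (K + K') * (ε / (2 * K * (K + K'))) * 1 := by
          rw [hEE]
          gcongr
          exact min_le_right _ _
      _ = ε := by field_simp
  -- Here no cancellation is needed: ρΦ is bounded on the scale of the exponentials, which leaves a
  -- factor 1/ρ.
  · have hid : L.weylSol x (ρ ^ 2) * Lt.phi x (ρ ^ 2) - L.phi x (ρ ^ 2) * Lt.weylSol x (ρ ^ 2) =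
        (ρ * L.weylSol x (ρ ^ 2) * Lt.phi x (ρ ^ 2) -
          L.phi x (ρ ^ 2) * (ρ * Lt.weylSol x (ρ ^ 2))) / ρ := by
      field_simp
    rw [hid, norm_div]
    have c1 := norm_sub_le (ρ * L.weylSol x (ρ ^ 2) * Lt.phi x (ρ ^ 2))
      (L.phi x (ρ ^ 2) * (ρ * Lt.weylSol x (ρ ^ 2)))
    rw [norm_mul (ρ * L.weylSol x (ρ ^ 2)), norm_mul (L.phi x (ρ ^ 2))] at c1
    have c2 : ‖ρ * L.weylSol x (ρ ^ 2)‖ * ‖Lt.phi x (ρ ^ 2)‖ +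
        ‖L.phi x (ρ ^ 2)‖ * ‖ρ * Lt.weylSol x (ρ ^ 2)‖ ≤ 2 * K * K' * (E * E') := by
      calc _ ≤ K * E' * (K' * E) + K * E * (K' * E') := by gcongr
        _ = _ := by ring
    rw [hEE, mul_one] at c2
    rw [div_le_iff₀ hρ0]
    have c3 := (le_max_right _ _).trans hρ
    rw [div_le_iff₀ hε] at c3
    linarith

/-- The sine-type solution. -/
def Problem.sinSol (L : Problem) (x : ℝ) (l : ℂ) : ℂ × ℂ := solution L.σ l 0 (0, 1) x

/-- Expanding in the fundamental solutions at 0 confines all singularities in l to the scalar factor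
M. -/
theorem Problem.weylSol_eq (hL : L.IsNormalized M) (hx : x ∈ Icc 0 Real.pi) {l : ℂ}
    (hl : L.psiQ 0 l ≠ 0) : L.weylSol x l = (L.sinSol x l).1 + L.weyl l * L.phi x l ∧
      L.weylSolQ x l = (L.sinSol x l).2 + L.weyl l * L.phiQ x l := by
  have h := (isSolution_solution hL.memLp pi_mem_Icc_pi l (L.r₁.eval l, -L.r₂.eval l)).change_base
    hL.memLp pi_mem_Icc_pi zero_mem_Icc_pi
  have h1 := h.solution_eq hL.memLp zero_mem_Icc_pi hx
  have h2 := solution_smul_add hL.memLp l (L.psi 0 l) (L.psiQ 0 l) hx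
  rw [show (L.psi 0 l, L.psiQ 0 l) =
    solution L.σ l Real.pi (L.r₁.eval l, -L.r₂.eval l) 0 from rfl, h1] at h2
  have e1 : L.psi x l = L.psi 0 l * L.phi x l + L.psiQ 0 l * (L.sinSol x l).1 := congrArg Prod.fst h2
  have e2 : L.psiQ x l = L.psi 0 l * L.phiQ x l + L.psiQ 0 l * (L.sinSol x l).2 :=
    congrArg Prod.snd h2
  rw [weylSol, weylSolQ, weyl, e1, e2]
  constructor <;> · field_simp; ring

theorem Problem.phi_mul_sinSol_sub (hL : L.IsNormalized M) (hx : x ∈ Icc 0 Real.pi) (l : ℂ) :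
    L.phi x l * (L.sinSol x l).2 - L.phiQ x l * (L.sinSol x l).1 = 1 := by
  have h := (isSolution_solution hL.memLp zero_mem_Icc_pi l (1, 0)).wronskian_eq hL.memLp
    (isSolution_solution hL.memLp zero_mem_Icc_pi l (0, 1)) hx
  simpa [phi, phiQ, sinSol] using h

theorem le_norm_sub_int_of_norm_eq {ρ : ℂ} {N : ℕ} (h : ‖ρ‖ = N + 1 / 2) (k : ℤ) :
    1 / 4 ≤ ‖ρ - k‖ := by
  have h1 := abs_norm_sub_norm_le ρ k
  rw [h, Complex.norm_intCast] at h1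
  have h2 : |(k : ℝ)| = (k.natAbs : ℝ) := by rw [Nat.cast_natAbs]; simp
  rw [h2] at h1
  refine le_trans ?_ h1
  rcases le_or_gt k.natAbs N with hk | hk
  · have : (k.natAbs : ℝ) ≤ N := Nat.cast_le.2 hk
    rw [le_abs]; left; linarith
  · have : (N : ℝ) + 1 ≤ k.natAbs := by exact_mod_cast hk
    rw [le_abs]; right; linarith

end SturmLiouville

end

/-! ### The contour integral and convergence of the partial sums. -/

noncomputable section

namespace SturmLiouville

open Complex (I)

variable {L Lt : Problem} {S : Fin 2 → SpectralSeq} {M : ℕ} {x : ℝ}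

/-- The partial sum of the main equation over the eigenvalues inside a large circle. -/
def partialSum (L Lt : Problem) (S : Fin 2 → SpectralSeq) (x : ℝ) (K : ℕ) (l : ℂ) : ℂ :=
  ∑ n ∈ Finset.range K, (coeffA Lt (S 0) x l n * phiVal L (S 0) x n -
    coeffA Lt (S 1) x l n * phiVal L (S 1) x n)

theorem differentiable_partialSum (hLt : Lt.IsNormalized M) (hx : x ∈ Icc 0 Real.pi) (K : ℕ) :
    Differentiable ℂ (partialSum L Lt S x K) :=
  Differentiable.fun_sum fun n _ => ((differentiable_coeffA hLt hx (S 0) n).mul_const _).fun_sub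
    ((differentiable_coeffA hLt hx (S 1) n).mul_const _)

/-- Collecting the coefficients of M and M̃ produces the Wronskian of φ̃(l) and φ̃(μ) divided by μ −
l, which is the kernel D̃ up to sign. Everything else is entire in μ except for the explicit simple
pole at l. -/
theorem spectralMap_div_eq (hL : L.IsNormalized M) (hLt : Lt.IsNormalized M)
    (hx : x ∈ Icc 0 Real.pi) {l μ : ℂ} (h : L.psiQ 0 μ ≠ 0) (ht : Lt.psiQ 0 μ ≠ 0) (hlμ : μ - l ≠ 0) :
    (Lt.phi x l * (L.phi x μ * Lt.weylSolQ x μ - L.weylSol x μ * Lt.phiQ x μ) +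
        Lt.phiQ x l * (L.weylSol x μ * Lt.phi x μ - L.phi x μ * Lt.weylSol x μ)) / (μ - l) =
      (L.phi x μ * kernelD Lt x l μ * L.weyl μ - L.phi x μ * kernelD Lt x l μ * Lt.weyl μ) +
      (L.phi x μ * (Lt.phi x l * (Lt.sinSol x μ).2 - Lt.phiQ x l * (Lt.sinSol x μ).1) / (μ - l) +
        (L.sinSol x μ).1 * kernelD Lt x l μ) := by
  obtain ⟨e1, -⟩ := L.weylSol_eq hL hx h
  obtain ⟨e2, e3⟩ := Lt.weylSol_eq hLt hx ht
  have hw := wronskian_eq_kernelD hLt hx l μ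
  rw [wronskian] at hw
  have hD : kernelD Lt x l μ =
      -(Lt.phi x l * Lt.phiQ x μ - Lt.phiQ x l * Lt.phi x μ) / (μ - l) := by
    rw [hw]; field_simp; ring
  rw [e1, e2, e3, hD]
  field_simp
  ring

/-- The function G/(μ − l) is integrated over |μ| = (N + 1/2)². Its residues give 2πi times the
quantity to be estimated, while G is small on the circle and the length of the circle is matched by
|μ − l|. -/
theorem exists_norm_partialSum_sub_le (hL : L.IsNormalized M) (hS : IsSpectralData L (S 0))
    (hLt : Lt.IsNormalized M) (hT : IsSpectralData Lt (S 1)) (hx : x ∈ Icc 0 Real.pi)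
    (R₀ : ℝ) {ε : ℝ} (hε : 0 < ε) : ∃ N₀ : ℕ, ∀ N : ℕ, N₀ ≤ N → ∀ l : ℂ, ‖l‖ ≤ R₀ →
      ‖partialSum L Lt S x (N + M + 1) l - (Lt.phi x l - L.phi x l)‖ ≤ ε := by
  obtain ⟨C₁, hC₁⟩ := (isCompact_closedBall (0 : ℂ) R₀).exists_bound_of_continuousOn
    (hLt.differentiable_phi hx).continuous.continuousOn
  obtain ⟨C₂, hC₂⟩ := (isCompact_closedBall (0 : ℂ) R₀).exists_bound_of_continuousOn
    (hLt.differentiable_phiQ hx).continuous.continuousOn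
  set C := |C₁| + |C₂| + 1 with hC
  have hC0 : 0 < C := by positivity
  obtain ⟨N₁, hN₁⟩ := IsSpectralData.exists_circleIntegral_mul_weyl hL hS
  obtain ⟨N₂, hN₂⟩ := IsSpectralData.exists_circleIntegral_mul_weyl hLt hT
  obtain ⟨R, hR, hP⟩ := exists_norm_spectralMap_sub_le hL hLt hx (ε := ε / (2 * C)) (by positivity)
  -- The term 2|R₀| + 1 ensures |μ − l| ≥ r/2 on the circle for every admissible l.
  refine ⟨max (max N₁ N₂) ⌈max R (2 * |R₀| + 1)⌉₊, fun N hN l hl => ?_⟩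
  obtain ⟨hc1, hi1⟩ := hN₁ N (((le_max_left _ _).trans (le_max_left _ _)).trans hN)
  obtain ⟨hc2, hi2⟩ := hN₂ N (((le_max_right _ _).trans (le_max_left _ _)).trans hN)
  have hNR : max R (2 * |R₀| + 1) ≤ N := (Nat.le_ceil _).trans
    (Nat.cast_le.2 ((le_max_right _ _).trans hN))
  have hN1 : 2 * |R₀| + 1 ≤ N := (le_max_right _ _).trans hNR
  set r := ((N : ℝ) + 1 / 2) ^ 2 with hr
  have hrN : 2 * |R₀| + 1 ≤ r := by
    have : 0 ≤ |R₀| := abs_nonneg _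
    nlinarith
  have hr0 : 0 < r := by have : 0 ≤ |R₀| := abs_nonneg _; linarith
  have hlr : 2 * ‖l‖ + 1 ≤ r := by linarith [le_abs_self R₀]
  have hlball : l ∈ Metric.ball (0 : ℂ) r := by
    rw [mem_ball_zero_iff]; linarith [norm_nonneg l]
  have hsph : ∀ μ ∈ Metric.sphere (0 : ℂ) r, L.psiQ 0 μ ≠ 0 ∧ Lt.psiQ 0 μ ≠ 0 ∧ μ - l ≠ 0 ∧
      r / 2 ≤ ‖μ - l‖ ∧
      ‖L.phi x μ * Lt.weylSolQ x μ - L.weylSol x μ * Lt.phiQ x μ - 1‖ ≤ ε / (2 * C) ∧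
      ‖L.weylSol x μ * Lt.phi x μ - L.phi x μ * Lt.weylSol x μ‖ ≤ ε / (2 * C) := by
    intro μ hμ
    rw [mem_sphere_zero_iff_norm] at hμ
    have hμ2 := sqrtBranch_sq μ
    set ρ := sqrtBranch μ
    have hρ : ‖ρ‖ = N + 1 / 2 := by
      rw [← hμ2, norm_pow, hr] at hμ
      exact (pow_left_inj₀ (norm_nonneg _) (by positivity) two_ne_zero).1 hμ
    obtain ⟨p1, p2, p3, p4⟩ := hP ρ (by rw [hρ]; linarith [(le_max_left _ _).trans hNR])
      (le_norm_sub_int_of_norm_eq hρ)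
    rw [hμ2] at p1 p2 p3 p4
    have h1 := norm_sub_norm_le μ l
    rw [hμ] at h1
    refine ⟨p1, p2, fun h0 => ?_, by linarith, p3, p4⟩
    rw [h0, norm_zero] at h1
    linarith [norm_nonneg l]
  set g := L.phi x with hg
  set d := fun μ => kernelD Lt x l μ with hd
  have hgd : Differentiable ℂ g := hL.differentiable_phi hx
  have hdd : Differentiable ℂ d := differentiable_kernelD_right hLt hx l
  have hs : Differentiable ℂ fun μ => L.sinSol x μ :=
    Problem.differentiable_solution hL.memLp (0, 1) hx
  have hst : Differentiable ℂ fun μ => Lt.sinSol x μ :=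
    Problem.differentiable_solution hLt.memLp (0, 1) hx
  set w := fun μ => Lt.phi x l * (Lt.sinSol x μ).2 - Lt.phiQ x l * (Lt.sinSol x μ).1 with hw
  have hwd : Differentiable ℂ w := (hst.snd.const_mul _).fun_sub (hst.fst.const_mul _)
  set G := fun μ => Lt.phi x l * (g μ * Lt.weylSolQ x μ - L.weylSol x μ * Lt.phiQ x μ - 1) +
    Lt.phiQ x l * (L.weylSol x μ * Lt.phi x μ - g μ * Lt.weylSol x μ) with hG
  have hGeq : ∀ μ ∈ Metric.sphere (0 : ℂ) r, G μ / (μ - l) =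
      g μ * d μ * L.weyl μ - g μ * d μ * Lt.weyl μ +
        ((g μ * w μ / (μ - l) + (L.sinSol x μ).1 * d μ) - Lt.phi x l / (μ - l)) := by
    intro μ hμ
    obtain ⟨p1, p2, p3, -⟩ := hsph μ hμ
    have h1 := spectralMap_div_eq hL hLt hx p1 p2 p3
    rw [← add_sub_assoc, ← h1, ← sub_div]
    congr 1
    simp only [hG]
    ring
  -- At μ = l the factor w is the Wronskian of φ̃ and the sine-type solution of the model problem,
  -- which equals 1; the residue is therefore φ(l).
  have hI1 : ∮ μ in C(0, r), g μ * w μ / (μ - l) = 2 * Real.pi * I * g l := by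
    have h1 := circleIntegral_div_sub_pow (hgd.fun_mul hwd) hlball 0
    have h2 : w l = 1 := Lt.phi_mul_sinSol_sub hLt hx l
    simp only [zero_add, pow_one, iteratedDeriv_zero, Nat.factorial_zero, Nat.cast_one, div_one,
      h2, mul_one] at h1
    exact h1
  have hI2 : ∮ μ in C(0, r), Lt.phi x l / (μ - l) = 2 * Real.pi * I * Lt.phi x l := by
    have h1 := circleIntegral_div_sub_pow (differentiable_const (Lt.phi x l)) hlball 0
    simp only [zero_add, pow_one, iteratedDeriv_zero, Nat.factorial_zero, Nat.cast_one, div_one]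
      at h1
    exact h1
  have hI3 : ∮ μ in C(0, r), (L.sinSol x μ).1 * d μ = 0 :=
    (hs.fst.fun_mul hdd).diffContOnCl.circleIntegral_eq_zero hr0.le
  have hsub : ∀ μ ∈ Metric.sphere (0 : ℂ) r, μ - l ≠ 0 := fun μ hμ => (hsph μ hμ).2.2.1
  have hcs : ContinuousOn (fun μ : ℂ => μ - l) (Metric.sphere 0 r) :=
    Continuous.continuousOn (by fun_prop)
  have k1 : CircleIntegrable (fun μ => g μ * d μ * L.weyl μ) 0 r :=
    ((hgd.fun_mul hdd).continuous.continuousOn.mul hc1).circleIntegrable hr0.le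
  have k2 : CircleIntegrable (fun μ => g μ * d μ * Lt.weyl μ) 0 r :=
    ((hgd.fun_mul hdd).continuous.continuousOn.mul hc2).circleIntegrable hr0.le
  have k3 : CircleIntegrable (fun μ => g μ * w μ / (μ - l)) 0 r :=
    ((hgd.fun_mul hwd).continuous.continuousOn.div hcs hsub).circleIntegrable hr0.le
  have k4 : CircleIntegrable (fun μ => (L.sinSol x μ).1 * d μ) 0 r :=
    (hs.fst.fun_mul hdd).continuous.continuousOn.circleIntegrable hr0.le
  have k5 : CircleIntegrable (fun μ => Lt.phi x l / (μ - l)) 0 r :=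
    (continuousOn_const.div hcs hsub).circleIntegrable hr0.le
  have k12 : CircleIntegrable (fun μ => g μ * d μ * L.weyl μ - g μ * d μ * Lt.weyl μ) 0 r :=
    k1.sub k2
  have k34 : CircleIntegrable (fun μ => g μ * w μ / (μ - l) + (L.sinSol x μ).1 * d μ) 0 r :=
    k3.add k4
  have k345 : CircleIntegrable (fun μ => g μ * w μ / (μ - l) + (L.sinSol x μ).1 * d μ -
      Lt.phi x l / (μ - l)) 0 r := k34.sub k5
  have hint : ∮ μ in C(0, r), G μ / (μ - l) = 2 * Real.pi * I *
      (partialSum L Lt S x (N + M + 1) l - (Lt.phi x l - L.phi x l)) := by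
    rw [circleIntegral.integral_congr hr0.le hGeq]
    rw [circleIntegral.integral_add k12 k345,
      circleIntegral.integral_sub k1 k2, circleIntegral.integral_sub k34 k5,
      circleIntegral.integral_add k3 k4, hI1, hI2, hI3, hi1 g d hgd hdd, hi2 g d hgd hdd,
      partialSum, Finset.sum_sub_distrib]
    simp only [coeffA_eq_res, phiVal_eq_jet, hg, hd, mul_comm (SpectralSeq.res _ _ _)]
    ring
  have hφ1 : ‖Lt.phi x l‖ ≤ |C₁| := (hC₁ l (mem_closedBall_zero_iff.2 hl)).trans (le_abs_self _)
  have hφ2 : ‖Lt.phiQ x l‖ ≤ |C₂| := (hC₂ l (mem_closedBall_zero_iff.2 hl)).trans (le_abs_self _)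
  -- Smallness ε/(2C) of both entries gives |G| ≤ ε/2, and division by |μ − l| ≥ r/2 gives ε/r; the
  -- length 2πr then yields 2πε.
  have hbound := circleIntegral.norm_integral_le_of_norm_le_const (f := fun μ => G μ / (μ - l))
    (c := 0) (C := ε / r) hr0.le fun μ hμ => by
      obtain ⟨-, -, p3, p4, p5, p6⟩ := hsph μ hμ
      have h1 : ‖G μ‖ ≤ ε / 2 := by
        simp only [hG]
        refine (norm_add_le _ _).trans ?_
        rw [norm_mul, norm_mul]
        calc _ ≤ |C₁| * (ε / (2 * C)) + |C₂| * (ε / (2 * C)) := by gcongr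
          _ = (|C₁| + |C₂|) * (ε / (2 * C)) := by ring
          _ ≤ C * (ε / (2 * C)) := by
              gcongr
              linarith
          _ = ε / 2 := by field_simp
      rw [norm_div]
      calc _ ≤ (ε / 2) / (r / 2) := by gcongr
        _ = ε / r := by field_simp
  rw [hint, norm_mul, norm_mul, norm_mul, Complex.norm_I, Complex.norm_ofNat, Complex.norm_real,
    Real.norm_of_nonneg Real.pi_nonneg, mul_one, mul_assoc (2 * Real.pi), mul_div_cancel₀ _ hr0.ne']
    at hbound
  exact le_of_mul_le_mul_left hbound (by positivity)

end SturmLiouville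

end

/-! ### From partial sums to the main equation in the space m. -/

noncomputable section

namespace SturmLiouville

open Complex (I)

variable {L Lt : Problem} {S : Fin 2 → SpectralSeq} {M : ℕ} {x : ℝ}

theorem SpectralSeq.jet_sub (T : SpectralSeq) (n : ℕ) {f g : ℂ → ℂ} (hf : Differentiable ℂ f)
    (hg : Differentiable ℂ g) : T.jet n (fun z => f z - g z) = T.jet n f - T.jet n g := by
  rw [jet, jet, jet, iteratedDeriv_fun_sub hf.contDiff.contDiffAt hg.contDiff.contDiffAt, smul_sub]

theorem jet_partialSum (hLt : Lt.IsNormalized M) (hx : x ∈ Icc 0 Real.pi) (u : ℕ × Fin 2)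
    (K : ℕ) : (S u.2).jet u.1 (partialSum L Lt S x K) = ∑ k ∈ Finset.range K,
      (matQ Lt S x u (k, 0) * phiVal L (S 0) x k - matQ Lt S x u (k, 1) * phiVal L (S 1) x k) := by
  have h := (S u.2).jet_clm_comp (∑ k ∈ Finset.range K,
    (phiVal L (S 0) x k • (intForm hx).flip ((S 0).res k (solutionMap hLt.memLp (1, 0))) -
      phiVal L (S 1) x k • (intForm hx).flip ((S 1).res k (solutionMap hLt.memLp (1, 0)))))
    (differentiable_solutionMap hLt.memLp (1, 0)) u.1
  simp only [sum_apply, sub_apply, smul_apply,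
    smul_eq_mul, ← coeffA_eq_intForm hLt hx, mul_comm (phiVal _ _ _ _)] at h
  refine h.trans (Finset.sum_congr rfl fun k _ => ?_)
  rw [matQ_eq_intForm hLt hx, matQ_eq_intForm hLt hx]
  rfl

/-- Uniform convergence on compact sets in l passes to Taylor coefficients by Cauchy's estimate. The
shift by M + 1 matches the number of eigenvalues inside the circles, so every sufficiently large
partial sum is covered. -/
theorem tendsto_sum_matQ_mul_phiVal (hL : L.IsNormalized M) (hS : IsSpectralData L (S 0))
    (hLt : Lt.IsNormalized M) (hT : IsSpectralData Lt (S 1)) (hx : x ∈ Icc 0 Real.pi)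
    (u : ℕ × Fin 2) : Tendsto (fun K => ∑ k ∈ Finset.range K,
      (matQ Lt S x u (k, 0) * phiVal L (S 0) x k - matQ Lt S x u (k, 1) * phiVal L (S 1) x k)) atTop
      (𝓝 (phiVal Lt (S u.2) x u.1 - phiVal L (S u.2) x u.1)) := by
  rw [← tendsto_add_atTop_iff_nat (M + 1), Metric.tendsto_atTop]
  intro ε hε
  -- The radius is chosen so that ρ² lies in the disc whenever ρ is within 1 of ρ_n, as the Cauchy
  -- estimate in ρ demands.
  obtain ⟨N₀, hN₀⟩ := exists_norm_partialSum_sub_le hL hS hLt hT hx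
    ((‖(S u.2).rho u.1‖ + 1) ^ 2) (half_pos hε)
  refine ⟨N₀, fun N hN => ?_⟩
  have hφ := hL.differentiable_phi hx
  have hφt := hLt.differentiable_phi hx
  have hP : Differentiable ℂ (partialSum L Lt S x (N + M + 1)) :=
    differentiable_partialSum hLt hx _
  rw [dist_eq_norm, ← jet_partialSum hLt hx, phiVal_eq_jet, phiVal_eq_jet,
    ← SpectralSeq.jet_sub _ _ hφt hφ, ← add_assoc, ← SpectralSeq.jet_sub _ _ hP (hφt.fun_sub hφ)]
  refine lt_of_le_of_lt (SpectralSeq.norm_jet_le (c := (S u.2).rho u.1) (B := 0) (A := ε / 2)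
    (hP.fun_sub (hφt.fun_sub hφ)) (by simp) fun ρ hρ => hN₀ N hN _ ?_) (half_lt_self hε)
  rw [norm_pow]
  have := norm_sub_norm_le ρ ((S u.2).rho u.1)
  gcongr
  linarith

theorem xi_eq_zero_iff {n : ℕ} : xi S n = 0 ↔
    (S 0).lam n = (S 1).lam n ∧ (S 0).alpha n = (S 1).alpha n := by
  rw [xi, add_eq_zero_iff_of_nonneg (norm_nonneg _) (norm_nonneg _), norm_eq_zero, norm_eq_zero,
    sub_eq_zero, sub_eq_zero]
  refine and_congr_left fun _ => ⟨fun h => ?_, fun h => by rw [SpectralSeq.rho, h]; rfl⟩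
  rw [← (S 0).rho_sq, h, (S 1).rho_sq]

/-- The matrices `matR` and `matT` are mutually inverse on the pairs of jets. -/
theorem res_mul_jet_sub_eq {E : Type*} [NormedAddCommGroup E] [NormedSpace ℂ E]
    (hpos : ∀ n : ℕ, (S 0).lam n = (S 1).lam n → (S 0).alpha n = (S 1).alpha n →
      (S 0).pos n = (S 1).pos n) (Λ : E →L[ℂ] ℂ) (f : ℂ → E) (g : ℂ → ℂ) (k : ℕ) :
    Λ ((S 0).res k f) * (S 0).jet k g - Λ ((S 1).res k f) * (S 1).jet k g =
      Λ (colR S (k, 0) f) * rowT S (k, 0) g + Λ (colR S (k, 1) f) * rowT S (k, 1) g := by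
  rw [colR_zero, colR_one, rowT_zero, rowT_one, map_smul, map_sub, smul_eq_mul, smul_eq_mul]
  -- When ξ_k = 0 the residues may still differ, but the jets agree because the positions do. The
  -- term with ξ_k then drops out and the difference of residues multiplies the common jet.
  by_cases h : xi S k = 0
  · obtain ⟨h1, h2⟩ := xi_eq_zero_iff.1 h
    have h3 : (S 0).jet k g = (S 1).jet k g := by
      rw [SpectralSeq.jet, SpectralSeq.jet, hpos k h1 h2, h1]
    rw [h, h3]
    push_cast
    ring
  · have h1 : (xi S k : ℂ) * chi S k = 1 := by
      rw [chi, if_neg h, ← Complex.ofReal_mul, mul_inv_cancel₀ h, Complex.ofReal_one]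
    linear_combination -(Λ ((S 0).res k f) * ((S 0).jet k g - (S 1).jet k g)) * h1

theorem hasSum_prod_fin_two {E : Type*} [NormedAddCommGroup E] {f : ℕ × Fin 2 → E} {a b : E}
    (ha : HasSum (fun k => f (k, 0)) a) (hb : HasSum (fun k => f (k, 1)) b) :
    HasSum f (a + b) := by
  have h0 : HasSum (fun v : ℕ × Fin 2 => if v.2 = 0 then f v else 0) a := by
    have hi : Function.Injective fun k : ℕ => (k, (0 : Fin 2)) := fun _ _ h => congrArg Prod.fst h
    refine (hi.hasSum_iff fun v hv => if_neg fun h => hv ⟨v.1, Prod.ext rfl h.symm⟩).1 ?_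
    exact ha
  have h1 : HasSum (fun v : ℕ × Fin 2 => if v.2 = 1 then f v else 0) b := by
    have hi : Function.Injective fun k : ℕ => (k, (1 : Fin 2)) := fun _ _ h => congrArg Prod.fst h
    refine (hi.hasSum_iff fun v hv => if_neg fun h => hv ⟨v.1, Prod.ext rfl h.symm⟩).1 ?_
    exact hb
  refine (h0.add h1).congr_fun fun v => ?_
  obtain ⟨k, i⟩ := v
  fin_cases i <;> simp

theorem summable_div_prod {η : ℕ → ℝ} {n : ℕ}
    (h : Summable fun k : ℕ => η k / (1 + |(n : ℝ) - k|)) (C : ℝ) :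
    (Summable fun v : ℕ × Fin 2 => C * (η v.1 / (1 + |(n : ℝ) - v.1|))) ∧
      ∑' v : ℕ × Fin 2, C * (η v.1 / (1 + |(n : ℝ) - v.1|)) =
        2 * C * ∑' k : ℕ, η k / (1 + |(n : ℝ) - k|) := by
  have h1 := hasSum_prod_fin_two (f := fun v : ℕ × Fin 2 => C * (η v.1 / (1 + |(n : ℝ) - v.1|)))
    (h.hasSum.mul_left C) (h.hasSum.mul_left C)
  exact ⟨h1.summable, h1.tsum_eq.trans (by ring)⟩

/-- The main equation in the form of absolutely convergent double series. -/
theorem hasSum_intForm_colR_mul_psiVec (hL : L.IsNormalized M) (hS : IsSpectralData L (S 0))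
    (hLt : Lt.IsNormalized M) (hT : IsSpectralData Lt (S 1))
    (hpos : ∀ n : ℕ, (S 0).lam n = (S 1).lam n → (S 0).alpha n = (S 1).alpha n →
      (S 0).pos n = (S 1).pos n) (hx : x ∈ Icc 0 Real.pi) (u : ℕ × Fin 2) :
    HasSum (fun k => matQ Lt S x u (k, 0) * phiVal L (S 0) x k -
        matQ Lt S x u (k, 1) * phiVal L (S 1) x k)
      (phiVal Lt (S u.2) x u.1 - phiVal L (S u.2) x u.1) ∧
    HasSum (fun v => intForm hx ((S u.2).jet u.1 (solutionMap hLt.memLp (1, 0)))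
        (colR S v (solutionMap hLt.memLp (1, 0))) * psiVec L S x v)
      (phiVal Lt (S u.2) x u.1 - phiVal L (S u.2) x u.1) := by
  obtain ⟨C, η, hC, hη, hs, hψ, -, -, hG⟩ := exists_kernel_bounds hL hS hLt hT hx
  obtain ⟨K, hK⟩ := exists_tsum_div_le hη hs
  set f : ℕ × Fin 2 → ℂ := fun v => intForm hx ((S u.2).jet u.1 (solutionMap hLt.memLp (1, 0)))
    (colR S v (solutionMap hLt.memLp (1, 0))) * psiVec L S x v with hf
  have hfs : Summable f := by
    refine Summable.of_norm_bounded (summable_div_prod (hK u.1).1 (C * C)).1 fun v => ?_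
    rw [hf, norm_mul, mul_right_comm]
    exact mul_le_mul (hG u v) (hψ v) (norm_nonneg _)
      (mul_nonneg hC.le (div_nonneg (hη _) (by positivity)))
  have e : (fun k => matQ Lt S x u (k, 0) * phiVal L (S 0) x k -
      matQ Lt S x u (k, 1) * phiVal L (S 1) x k) = fun k => f (k, 0) + f (k, 1) := by
    ext k
    rw [matQ_eq_intForm hLt hx, matQ_eq_intForm hLt hx, phiVal_eq_jet, phiVal_eq_jet,
      res_mul_jet_sub_eq hpos, hf]
    simp only [psiVec_eq_rowT]
  have h0 : Summable fun k => f (k, 0) :=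
    hfs.comp_injective fun _ _ h => congrArg Prod.fst h
  have h1 : Summable fun k => f (k, 1) :=
    hfs.comp_injective fun _ _ h => congrArg Prod.fst h
  -- Absolute convergence is already known from the kernel bounds; the contour argument is used only
  -- to identify the sum.
  have h2 := h0.hasSum.add h1.hasSum
  have h3 := tendsto_sum_matQ_mul_phiVal hL hS hLt hT hx u
  rw [e] at h3 ⊢
  rw [← tendsto_nhds_unique h2.tendsto_sum_nat h3]
  exact ⟨h2, hasSum_prod_fin_two h0.hasSum h1.hasSum⟩

/-- The row matrix T_n has two columns, so it acts on the equations for i = 0, 1 by a finite linear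
combination. -/
theorem hasSum_matH_mul_psiVec (hL : L.IsNormalized M) (hS : IsSpectralData L (S 0))
    (hLt : Lt.IsNormalized M) (hT : IsSpectralData Lt (S 1))
    (hpos : ∀ n : ℕ, (S 0).lam n = (S 1).lam n → (S 0).alpha n = (S 1).alpha n →
      (S 0).pos n = (S 1).pos n) (hx : x ∈ Icc 0 Real.pi) (u : ℕ × Fin 2) :
    HasSum (fun v => matH Lt S x u v * psiVec L S x v) (psiVec Lt S x u - psiVec L S x u) := by
  have h := hasSum_sum (s := Finset.univ) fun (i : Fin 2) _ =>
    ((hasSum_intForm_colR_mul_psiVec hL hS hLt hT hpos hx (u.1, i)).2.mul_left (matT S u.1 u.2 i))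
  have e : psiVec Lt S x u - psiVec L S x u = ∑ i : Fin 2, matT S u.1 u.2 i *
      (phiVal Lt (S i) x u.1 - phiVal L (S i) x u.1) := by
    simp only [psiVec, Matrix.mulVec, dotProduct, Fin.sum_univ_two]
    ring
  rw [e]
  refine h.congr_fun fun v => ?_
  rw [matH_eq_intForm hLt hx, rowT]
  simp only [map_sum, map_smul, sum_apply, smul_apply, smul_eq_mul, Finset.sum_mul, mul_assoc]

/-- A matrix whose rows are uniformly absolutely summable acts on bounded sequences. -/
theorem exists_clm_of_tsum_le {A : ℕ × Fin 2 → ℕ × Fin 2 → ℂ} {b : ℕ × Fin 2 → ℕ × Fin 2 → ℝ}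
    {K : ℝ} (hb : ∀ u v, ‖A u v‖ ≤ b u v) (hs : ∀ u, Summable (b u)) (hK : ∀ u, ∑' v, b u v ≤ K) :
    ∃ H : BddSeq →L[ℂ] BddSeq, ∀ (a : BddSeq) (u : ℕ × Fin 2),
      HasSum (fun v => A u v * a v) (H a u) := by
  have hb0 : ∀ u v, 0 ≤ b u v := fun u v => (norm_nonneg _).trans (hb u v)
  have hK0 : 0 ≤ K := (tsum_nonneg (hb0 (0, 0))).trans (hK (0, 0))
  have hbound : ∀ (a : BddSeq) u v, ‖A u v * a v‖ ≤ b u v * ‖a‖ := fun a u v => by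
    rw [norm_mul]
    exact mul_le_mul (hb u v) (lp.norm_apply_le_norm ENNReal.top_ne_zero a v) (norm_nonneg _)
      (hb0 u v)
  have hsum : ∀ (a : BddSeq) u, Summable fun v => A u v * a v := fun a u =>
    Summable.of_norm_bounded ((hs u).mul_right ‖a‖) (hbound a u)
  have hle : ∀ (a : BddSeq) u, ‖∑' v, A u v * a v‖ ≤ K * ‖a‖ := fun a u =>
    (tsum_of_norm_bounded ((hs u).mul_right ‖a‖).hasSum (hbound a u)).trans (by
      rw [tsum_mul_right]
      exact mul_le_mul_of_nonneg_right (hK u) (norm_nonneg _))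
  let T : BddSeq →ₗ[ℂ] BddSeq :=
    { toFun := fun a => ⟨fun u => ∑' v, A u v * a v, memℓp_infty ⟨K * ‖a‖, by
        rintro _ ⟨u, rfl⟩
        exact hle a u⟩⟩
      map_add' := fun a a' => lp.ext (funext fun u => by
        show ∑' v, A u v * (a + a') v = ∑' v, A u v * a v + ∑' v, A u v * a' v
        rw [← (hsum a u).tsum_add (hsum a' u)]
        refine tsum_congr fun v => ?_
        rw [lp.coeFn_add, Pi.add_apply, mul_add])
      map_smul' := fun c a => lp.ext (funext fun u => by
        show ∑' v, A u v * (c • a) v = c * ∑' v, A u v * a v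
        rw [← tsum_mul_left]
        refine tsum_congr fun v => ?_
        rw [lp.coeFn_smul, Pi.smul_apply, smul_eq_mul, mul_left_comm]) }
  exact ⟨T.mkContinuous K fun a => lp.norm_le_of_forall_le (by positivity) fun u => hle a u,
    fun a u => (hsum a u).hasSum⟩

end SturmLiouville

end

theorem mainTheorem4 (M : ℕ) (L Lt : SturmLiouville.Problem)
    (hL : L.IsNormalized M) (hcop : IsCoprime L.r₁ L.r₂) (hLt : Lt.IsNormalized M)
    (S : Fin 2 → SturmLiouville.SpectralSeq)
    (hS : SturmLiouville.IsSpectralData L (S 0))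
    (hSt : SturmLiouville.IsSpectralData Lt (S 1))
    (hpos : ∀ n : ℕ, (S 0).lam n = (S 1).lam n → (S 0).alpha n = (S 1).alpha n →
      (S 0).pos n = (S 1).pos n)
    (x : ℝ) (hx : x ∈ Set.Icc 0 Real.pi) :
    (∀ u : ℕ × Fin 2,
      HasSum (fun k : ℕ =>
          SturmLiouville.matQ Lt S x u (k, 0) * SturmLiouville.phiVal L (S 0) x k -
          SturmLiouville.matQ Lt S x u (k, 1) * SturmLiouville.phiVal L (S 1) x k)
        (SturmLiouville.phiVal Lt (S u.2) x u.1 - SturmLiouville.phiVal L (S u.2) x u.1)) ∧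
    ∃ (hψ : Memℓp (SturmLiouville.psiVec L S x) ∞)
      (hψt : Memℓp (SturmLiouville.psiVec Lt S x) ∞)
      (H : SturmLiouville.BddSeq →L[ℂ] SturmLiouville.BddSeq),
      (∀ (a : SturmLiouville.BddSeq) (u : ℕ × Fin 2),
        HasSum (fun v : ℕ × Fin 2 => SturmLiouville.matH Lt S x u v * a v) (H a u)) ∧
      (⟨SturmLiouville.psiVec Lt S x, hψt⟩ : SturmLiouville.BddSeq) =
        (ContinuousLinearMap.id ℂ SturmLiouville.BddSeq + H)
          ⟨SturmLiouville.psiVec L S x, hψ⟩ := by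
  refine ⟨fun u => (SturmLiouville.hasSum_intForm_colR_mul_psiVec hL hS hLt hSt hpos hx u).1, ?_⟩
  obtain ⟨C, η, hC, hη, hs, hψ, hψt, hH, -⟩ :=
    SturmLiouville.exists_kernel_bounds hL hS hLt hSt hx
  obtain ⟨K, hK⟩ := SturmLiouville.exists_tsum_div_le hη hs
  -- The factor 2 counts the two columns belonging to each k.
  obtain ⟨H, hHa⟩ := SturmLiouville.exists_clm_of_tsum_le (K := 2 * C * K) hH
    (fun u => (SturmLiouville.summable_div_prod (hK u.1).1 C).1) fun u => by
      rw [(SturmLiouville.summable_div_prod (hK u.1).1 C).2]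
      exact mul_le_mul_of_nonneg_left (hK u.1).2 (by positivity)
  have m : Memℓp (SturmLiouville.psiVec L S x) ⊤ := memℓp_infty ⟨C, by
    rintro _ ⟨u, rfl⟩
    exact hψ u⟩
  refine ⟨m, memℓp_infty ⟨C, by
    rintro _ ⟨u, rfl⟩
    exact hψt u⟩, H, hHa, lp.ext (funext fun u => ?_)⟩
  have h := (hHa ⟨SturmLiouville.psiVec L S x, m⟩ u).unique
    (SturmLiouville.hasSum_matH_mul_psiVec hL hS hLt hSt hpos hx u)
  show SturmLiouville.psiVec Lt S x u = SturmLiouville.psiVec L S x u + H ⟨_, m⟩ u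
  rw [h, add_sub_cancel]
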